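/- Let $\mathsf{gr}$ be the category of finitely generated free groups and group homomorphisms, and let $\mathcal{F}(\mathsf{gr};\mathbb{Z})$ and $\mathcal{F}(\mathsf{gr}\times\mathsf{gr};\mathbb{Z})$ be the abelian categories of functors from $\mathsf{gr}$, respectively $\mathsf{gr}\times\mathsf{gr}$, to abelian groups. Let $\mathfrak{a}\in\mathcal{F}(\mathsf{gr};\mathbb{Z})$ be the abelianization functor $G\mapsto G/[G,G]$, let $S^d$ be the $d$-th symmetric power functor on abelian groups, and for $F,G\in\mathcal{F}(\mathsf{gr};\mathbb{Z})$ let $F\boxtimes G$ be the functor $(n,m)\mapsto F(n)\otimes_{\mathbb{Z}} G(m)$ on $\mathsf{gr}\times\mathsf{gr}$. **Proposition (Künneth formula).** For all integers $k,i_1,i_2\ge 0$ there is a short exact sequence of abelian groups $$0\to\bigoplus_{\alpha+\beta=k}\mathrm{Ext}^{\alpha}_{\mathcal{F}(\mathsf{gr};\mathbb{Z})}(\mathfrak{a},S^{i_1}\circ\mathfrak{a})\otimes_{\mathbb{Z}}\mathrm{Ext}^{\beta}_{\mathcal{F}(\mathsf{gr};\mathbb{Z})}(\mathfrak{a},S^{i_2}\circ\mathfrak{a})\to\mathrm{Ext}^{k}_{\mathcal{F}(\mathsf{gr}\times\mathsf{gr};\mathbb{Z})}(\mathfrak{a}\boxtimes\mathfrak{a},\,S^{i_1}\circ\mathfrak{a}\boxtimes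 S^{i_2}\circ\mathfrak{a})$$ $$\to\bigoplus_{\alpha+\beta=k+1}\mathrm{Tor}_1^{\mathbb{Z}}\bigl(\mathrm{Ext}^{\alpha}_{\mathcal{F}(\mathsf{gr};\mathbb{Z})}(\mathfrak{a},S^{i_1}\circ\mathfrak{a}),\mathrm{Ext}^{\beta}_{\mathcal{F}(\mathsf{gr};\mathbb{Z})}(\mathfrak{a},S^{i_2}\circ\mathfrak{a})\bigr)\to 0,$$ where $\alpha,\beta\ge 0$. For each $k$ these sequences can be chosen to be natural in the two coefficient functors: for all natural transformations $\varphi:S^{i_1}\circ\mathfrak{a}\to S^{j_1}\circ\mathfrak{a}$ and $\psi:S^{i_2}\circ\mathfrak{a}\to S^{j_2}\circ\mathfrak{a}$, the maps induced by $\varphi$ and $\psi$ on the outer terms and by $\varphi\boxtimes\psi$ on the middle term form a morphism from the sequence for $(i_1,i_2)$ to the sequence for $(j_1,j_2)$. -/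

import Mathlib

open CategoryTheory CategoryTheory.Abelian
open scoped TensorProduct DirectSum CategoryTheory.MonoidalCategory.ExternalProduct

noncomputable section

namespace FreeGroupFunctors

/-- The linear map `Sym^d M → Sym^d N` induced by a linear map `f : M → N`; it sends the class of
`m₁ ⊗ ⋯ ⊗ m_d` to the class of `f m₁ ⊗ ⋯ ⊗ f m_d`. -/
def symMap (d : ℕ) {M N : Type} [AddCommGroup M] [Module ℤ M] [AddCommGroup N]
    [Module ℤ N] (f : M →ₗ[ℤ] N) :
    SymmetricPower ℤ (Fin d) M →ₗ[ℤ] SymmetricPower ℤ (Fin d) N :=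
  (AddCon.lift (addConGen (SymmetricPower.Rel ℤ (Fin d) M))
    ((SymmetricPower.mk ℤ (Fin d) N).comp (PiTensorProduct.map fun _ => f)).toAddMonoidHom
    (AddCon.addConGen_le.2 fun x y h => by
      cases h with
      | perm e v =>
        change (SymmetricPower.mk ℤ (Fin d) N) (PiTensorProduct.map (fun _ => f) _) =
          (SymmetricPower.mk ℤ (Fin d) N) (PiTensorProduct.map (fun _ => f) _)
        rw [PiTensorProduct.map_tprod, PiTensorProduct.map_tprod]
        exact (SymmetricPower.tprod_equiv e fun i => f (v i)).symm)).toIntLinearMap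

theorem symMap_tprod (d : ℕ) {M N : Type} [AddCommGroup M] [Module ℤ M] [AddCommGroup N]
    [Module ℤ N] (f : M →ₗ[ℤ] N)
    (v : Fin d → M) :
    symMap d f (SymmetricPower.tprod ℤ v) = SymmetricPower.tprod ℤ fun i => f (v i) := by
  change (SymmetricPower.mk ℤ (Fin d) N) (PiTensorProduct.map (fun _ => f) _) = _
  rw [PiTensorProduct.map_tprod]
  rfl

theorem sym_hom_ext {d : ℕ} {M N : Type} [AddCommGroup M] [Module ℤ M] [AddCommGroup N]
    [Module ℤ N]
    {f g : SymmetricPower ℤ (Fin d) M →ₗ[ℤ] N}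
    (h : ∀ v : Fin d → M, f (SymmetricPower.tprod ℤ v) = g (SymmetricPower.tprod ℤ v)) : f = g :=
  LinearMap.ext_on (SymmetricPower.span_tprod_eq_top ℤ (Fin d) M) (by rintro _ ⟨v, rfl⟩; exact h v)

/-- The category of abelian groups, as the category of `ℤ`-modules. -/
abbrev AbCat := ModuleCat.{0} ℤ

/-- The `d`-th symmetric power, as a functor from abelian groups to abelian groups. -/
def symPower (d : ℕ) : AbCat ⥤ AbCat where
  obj M := ModuleCat.of ℤ (SymmetricPower ℤ (Fin d) M)
  map f := ModuleCat.ofHom (symMap d f.hom)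
  map_id M := by
    ext1
    exact sym_hom_ext fun v => symMap_tprod d _ v
  map_comp f g := by
    ext1
    refine sym_hom_ext fun v => ?_
    simp [symMap_tprod]

/-- The property of a group of being free and finitely generated. -/
def isFGFree : ObjectProperty GrpCat.{0} := fun G => IsFreeGroup G ∧ Group.FG G

/-- The category of finitely generated free groups and group homomorphisms. -/
abbrev Gr := isFGFree.FullSubcategory

/-- The category of functors from finitely generated free groups to abelian groups. -/
abbrev FGr := Gr ⥤ AbCat

/-- The category of functors from pairs of finitely generated free groups to abelian groups. -/
abbrev FGr2 := Gr × Gr ⥤ AbCat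

instance : HasExt.{1} FGr := HasExt.standard _

instance : HasExt.{1} FGr2 := HasExt.standard _

/-- The abelianization functor `G ↦ G / [G, G]` on finitely generated free groups. -/
def abelianization : FGr where
  obj G := ModuleCat.of ℤ (Additive (Abelianization G.obj))
  map f := ModuleCat.ofHom (MonoidHom.toAdditive (Abelianization.map f.hom.hom)).toIntLinearMap
  map_id G := by
    ext1
    refine LinearMap.ext fun x => ?_
    exact DFunLike.congr_fun (Abelianization.map_id (G := G.obj)) (Additive.toMul x)
  map_comp f g := by
    ext1
    refine LinearMap.ext fun x => ?_
    exact (DFunLike.congr_fun (Abelianization.map_comp f.hom.hom g.hom.hom)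
      (Additive.toMul x)).symm

/-- The functor `S^d ∘ 𝔞`. -/
def symAb (d : ℕ) : FGr := abelianization ⋙ symPower d

/-- The natural transformation `φ ⊠ ψ : F ⊠ G ⟶ F' ⊠ G'`. -/
def boxMap {F F' G G' : FGr} (φ : F ⟶ F') (ψ : G ⟶ G') : (F ⊠ G : FGr2) ⟶ (F' ⊠ G' : FGr2) :=
  (MonoidalCategory.externalProductBifunctor Gr Gr AbCat).map (Prod.mkHom φ ψ)

/-- The group `Ext^n(𝔞, F)` in the category of functors on `Gr`. -/
abbrev ExtA (n : ℕ) (F : FGr) : Type 1 := Ext.{1} abelianization F n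

/-- The group `Ext^n(𝔞 ⊠ 𝔞, H)` in the category of functors on `Gr × Gr`. -/
abbrev ExtAA (n : ℕ) (H : FGr2) : Type 1 :=
  Ext.{1} (abelianization ⊠ abelianization : FGr2) H n

/-- The map `Ext^n(𝔞, F) → Ext^n(𝔞, F')` induced by `φ : F ⟶ F'`. -/
def extAMap (n : ℕ) {F F' : FGr} (φ : F ⟶ F') : ExtA n F →ₗ[ℤ] ExtA n F' :=
  ((Ext.mk₀ φ).postcomp abelianization (add_zero n)).toIntLinearMap

/-- The map `Ext^n(𝔞 ⊠ 𝔞, H) → Ext^n(𝔞 ⊠ 𝔞, H')` induced by `φ : H ⟶ H'`. -/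
def extAAMap (n : ℕ) {H H' : FGr2} (φ : H ⟶ H') : ExtAA n H →+ ExtAA n H' :=
  (Ext.mk₀ φ).postcomp (abelianization ⊠ abelianization : FGr2) (add_zero n)

/-- The functor `B ↦ A ⊗ B` on `ℤ`-modules. -/
def tensorLeft (A : Type 1) [AddCommGroup A] : ModuleCat.{1} ℤ ⥤ ModuleCat.{1} ℤ where
  obj B := ModuleCat.of ℤ (A ⊗[ℤ] B)
  map g := ModuleCat.ofHom (g.hom.lTensor A)
  map_id B := by ext1; exact LinearMap.lTensor_id A B
  map_comp f g := by ext1; exact LinearMap.lTensor_comp A g.hom f.hom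

instance (A : Type 1) [AddCommGroup A] : (tensorLeft A).Additive where
  map_add {_ _ f g} := by ext1; exact LinearMap.lTensor_add A f.hom g.hom

/-- The natural transformation `A ⊗ - ⟶ A' ⊗ -` induced by `f : A → A'`. -/
def tensorLeftMap {A A' : Type 1} [AddCommGroup A] [AddCommGroup A'] (f : A →ₗ[ℤ] A') :
    tensorLeft A ⟶ tensorLeft A' where
  app B := ModuleCat.ofHom (f.rTensor B)
  naturality B B' g := by
    ext1
    exact (LinearMap.rTensor_comp_lTensor A f g.hom).trans
      (LinearMap.lTensor_comp_rTensor A f g.hom).symm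

/-- The group `Tor_1^ℤ(A, B)`: the first left derived functor of `A ⊗ -`, evaluated at `B`. -/
abbrev Tor1 (A B : Type 1) [AddCommGroup A] [AddCommGroup B] : Type 1 :=
  ((tensorLeft A).leftDerived 1).obj (ModuleCat.of ℤ B)

/-- The map `Tor_1^ℤ(A, B) → Tor_1^ℤ(A', B')` induced by `f : A → A'` and `g : B → B'`. -/
def tor1Map {A A' B B' : Type 1} [AddCommGroup A] [AddCommGroup A'] [AddCommGroup B]
    [AddCommGroup B'] (f : A →ₗ[ℤ] A') (g : B →ₗ[ℤ] B') : Tor1 A B →ₗ[ℤ] Tor1 A' B' :=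
  ((NatTrans.leftDerived (tensorLeftMap f) 1).app (ModuleCat.of ℤ B) ≫
    ((tensorLeft A').leftDerived 1).map (ModuleCat.ofHom g)).hom

/-- The group `⨁_{α + β = n} Ext^α(𝔞, F) ⊗ Ext^β(𝔞, G)`. -/
abbrev TensorSum (n : ℕ) (F G : FGr) : Type 1 :=
  ⨁ p : {p : ℕ × ℕ // p.1 + p.2 = n}, ExtA p.1.1 F ⊗[ℤ] ExtA p.1.2 G

/-- The group `⨁_{α + β = n} Tor_1^ℤ(Ext^α(𝔞, F), Ext^β(𝔞, G))`. -/
abbrev TorSum (n : ℕ) (F G : FGr) : Type 1 :=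
  ⨁ p : {p : ℕ × ℕ // p.1 + p.2 = n}, Tor1 (ExtA p.1.1 F) (ExtA p.1.2 G)

/-- The map of sums of tensor products induced by `φ : F ⟶ F'` and `ψ : G ⟶ G'`. -/
def tensorSumMap (n : ℕ) {F F' G G' : FGr} (φ : F ⟶ F') (ψ : G ⟶ G') :
    TensorSum n F G →+ TensorSum n F' G' :=
  DirectSum.map fun p =>
    (TensorProduct.map (extAMap p.1.1 φ) (extAMap p.1.2 ψ)).toAddMonoidHom

/-- The map of sums of torsion products induced by `φ : F ⟶ F'` and `ψ : G ⟶ G'`. -/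
def torSumMap (n : ℕ) {F F' G G' : FGr} (φ : F ⟶ F') (ψ : G ⟶ G') :
    TorSum n F G →+ TorSum n F' G' :=
  DirectSum.map fun p => (tor1Map (extAMap p.1.1 φ) (extAMap p.1.2 ψ)).toAddMonoidHom

end FreeGroupFunctors

end

/-! The theorem is the algebraic Künneth formula, applied to explicit projective resolutions.

Resolutions. The functor `G ↦ ℤ[Gⁿ]` is the linearisation of `Hom(Fₙ, -)`, hence projective by the
Yoneda lemma. A free group has homology `G^ab` in degree 1 and zero above, so the bar complex,
started at `ℤ[G]`, is a projective resolution of `𝔞` (`barResolution`). Exactness is a pointwise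
matter, and at each free group a contraction is written down by Fox calculus
(`FoxDerivation.homotopy_succ`, `FoxDerivation.homotopy_zero`). The external products `ℤ[Gᵃ] ⊗
ℤ[Hᵇ]` are again linearised representables, and the total complex of two bar complexes inherits a
contraction at each pair of groups, so it is a projective resolution of `𝔞 ⊠ 𝔞` (`boxResolution`).

Reduction to algebra. By Yoneda, `Hom(ℤ[Gᵃ], F)` is the value of `F` at the free group of rank `a`.
Since `F ⊠ G` is a pointwise tensor product, homomorphisms from the total complex to `F ⊠ G` form
the tensor product of the two complexes that compute `Ext(𝔞, F)` and `Ext(𝔞, G)` (`boxHom`,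
`totHom_famD`). For `F = Sⁱ ∘ 𝔞` the cochains are finitely generated free abelian groups, because
symmetric powers of such groups are again of this kind (`symmetricPower_free`). Their subgroups of
cocycles `Z` and coboundaries `B` are then free, and the differentials onto coboundaries split.

Künneth formula. The cross product of cocycles gives the first map; a splitting provides a
retraction, hence injectivity. The second map sends a cocycle `t` to the class of `(1 ⊗ d) t` in
`H^a ⊗ B^b`. The cocycle equation puts it in the kernel of `H^a ⊗ B^b → H^a ⊗ Z^b`, which is
`Tor_1(H^a, H^b)` because `0 → B^b → Z^b → H^b → 0` is a projective resolution (`torIncl_exact`).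
Exactness and surjectivity (`kunneth_exact`, `kunnethTor_surjective`) follow from right exactness of
the tensor product and flatness of the free groups involved. The formula for the second map uses a
splitting, but its value does not depend on it (`kunnethTor_eq`), and this gives naturality. -/

noncomputable section

namespace FreeGroupFunctors

/-! ### The bar complex of a group -/

section Cons

variable (G : Type)

/-- The group of inhomogeneous `n`-chains of `G` with integral coefficients. -/
abbrev BarChain (n : ℕ) : Type := (Fin n → G) →₀ ℤ

variable {G}

/-- Prepending an entry to a chain. -/
def barCons (n : ℕ) (s : G) : BarChain G n →ₗ[ℤ] BarChain G (n + 1) :=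
  Finsupp.lmapDomain ℤ ℤ fun z => (Fin.cons s z : Fin (n + 1) → G)

/-- Prepending a combination of pairs to a chain. -/
def barPair (n : ℕ) : ((G × G) →₀ ℤ) →ₗ[ℤ] BarChain G n →ₗ[ℤ] BarChain G (n + 2) :=
  Finsupp.lsum ℤ fun p => LinearMap.toSpanSingleton ℤ _ (barCons (n + 1) p.1 ∘ₗ barCons n p.2)

theorem barPair_single (n : ℕ) (p : G × G) (c : ℤ) (x : BarChain G n) :
    barPair n (Finsupp.single p c) x = c • barCons (n + 1) p.1 (barCons n p.2 x) := by
  simp [barPair]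

theorem barCons_single (n : ℕ) (g : G) (z : Fin n → G) (c : ℤ) :
    barCons n g (Finsupp.single z c) = Finsupp.single (Fin.cons g z : Fin (n + 1) → G) c := by
  simp [barCons]

end Cons

section Bar

variable (G : Type) [Group G]

/-- All the faces of the bar differential except the first one. -/
def barTail (n : ℕ) : BarChain G (n + 1) →ₗ[ℤ] BarChain G n :=
  Finsupp.lsum ℤ fun g => ∑ j : Fin (n + 1),
    (-1 : ℤ) ^ ((j : ℕ) + 1) • Finsupp.lsingle (Fin.contractNth j (· * ·) g)

/-- The differential of the bar complex. -/
def barD (n : ℕ) : BarChain G (n + 1) →ₗ[ℤ] BarChain G n :=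
  Finsupp.lmapDomain ℤ ℤ Fin.tail + barTail G n

variable {G}

theorem barTail_single (n : ℕ) (g : Fin (n + 1) → G) (c : ℤ) :
    barTail G n (Finsupp.single g c) = ∑ j : Fin (n + 1),
      (-1 : ℤ) ^ ((j : ℕ) + 1) • Finsupp.single (Fin.contractNth j (· * ·) g) c := by
  simp [barTail]

theorem barD_single (n : ℕ) (g : Fin (n + 1) → G) (c : ℤ) :
    barD G n (Finsupp.single g c) =
      Finsupp.single (Fin.tail g) c + barTail G n (Finsupp.single g c) := by
  simp [barD]

/-- The differential agrees with that of the inhomogeneous chains of the trivial representation `ℤ`.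
-/
theorem barD_comp_barD (n : ℕ) : barD G n ∘ₗ barD G (n + 1) = 0 := by
  have key (m : ℕ) : ModuleCat.ofHom (barD G m) =
      groupHomology.inhomogeneousChains.d (Rep.trivial ℤ G ℤ) m := by
    ext1
    refine Finsupp.lhom_ext fun g c => ?_
    have h := groupHomology.inhomogeneousChains.d_single (A := Rep.trivial ℤ G ℤ) m g c
    refine Eq.trans ?_ h.symm
    change barD G m (Finsupp.single g c) = _
    rw [barD_single, barTail_single]
    rfl
  have h := groupHomology.inhomogeneousChains.d_comp_d (Rep.trivial ℤ G ℤ) n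
  rw [← key, ← key] at h
  exact congrArg ModuleCat.Hom.hom h

theorem map_barD {H : Type} [Group H] (f : G →* H) (n : ℕ) :
    Finsupp.lmapDomain ℤ ℤ (fun g : Fin n → G => f ∘ g) ∘ₗ barD G n =
      barD H n ∘ₗ Finsupp.lmapDomain ℤ ℤ (fun g : Fin (n + 1) → G => f ∘ g) := by
  refine Finsupp.lhom_ext fun g c => ?_
  simp only [LinearMap.comp_apply, barD_single, barTail_single, map_add, map_sum, map_smul,
    Finsupp.lmapDomain_apply, Finsupp.mapDomain_single]
  simp only [Fin.comp_contractNth (· * ·) (· * ·) (f := f) (map_mul f)]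
  rfl

/-- Left multiplication of the first entry. -/
def mulHead (n : ℕ) (s : G) (z : Fin (n + 1) → G) : Fin (n + 1) → G :=
  Fin.cons (s * z 0) (Fin.tail z)

theorem contractNth_zero_cons (n : ℕ) (s : G) (z : Fin (n + 1) → G) :
    Fin.contractNth 0 (· * ·) (Fin.cons s z : Fin (n + 2) → G) = mulHead n s z := by
  funext k
  refine Fin.cases ?_ (fun k => ?_) k
  · rw [Fin.contractNth_apply_of_eq _ _ _ _ rfl]
    simp [mulHead]
  · rw [Fin.contractNth_apply_of_gt _ _ _ _ (by simp)]
    simp [mulHead, Fin.tail]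

theorem contractNth_succ_cons (n : ℕ) (s : G) (z : Fin (n + 1) → G) (j : Fin (n + 1)) :
    Fin.contractNth j.succ (· * ·) (Fin.cons s z : Fin (n + 2) → G) =
      Fin.cons s (Fin.contractNth j (· * ·) z) := by
  funext k
  refine Fin.cases ?_ (fun k => ?_) k
  · rw [Fin.contractNth_apply_of_lt _ _ _ _ (by simp)]
    simp
  · rw [Fin.cons_succ]
    rcases lt_trichotomy (k : ℕ) j with h | h | h
    · rw [Fin.contractNth_apply_of_lt _ _ _ _ (by simpa using h),
        Fin.contractNth_apply_of_lt _ _ _ _ h, Fin.castSucc_succ, Fin.cons_succ]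
    · rw [Fin.contractNth_apply_of_eq _ _ _ _ (by simpa using h),
        Fin.contractNth_apply_of_eq _ _ _ _ h, Fin.castSucc_succ, Fin.cons_succ, Fin.cons_succ]
    · rw [Fin.contractNth_apply_of_gt _ _ _ _ (by simpa using h),
        Fin.contractNth_apply_of_gt _ _ _ _ h, Fin.cons_succ]

/-- Only the contraction at 0 touches `s`; the others contract inside `z` with their sign shifted by
one. This recursion replaces index manipulations in all later boundary computations. -/
theorem barTail_cons (n : ℕ) (s : G) (z : Fin (n + 1) → G) (c : ℤ) :
    barTail G (n + 1) (Finsupp.single (Fin.cons s z) c) =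
      -Finsupp.single (mulHead n s z) c - barCons n s (barTail G n (Finsupp.single z c)) := by
  rw [barTail_single, Fin.sum_univ_succ, contractNth_zero_cons, barTail_single, map_sum]
  simp only [contractNth_succ_cons, map_smul, barCons, Finsupp.lmapDomain_apply,
    Finsupp.mapDomain_single, Fin.val_zero, Fin.val_succ, zero_add, pow_one, neg_smul, one_smul]
  rw [sub_eq_add_neg, ← Finset.sum_neg_distrib]
  congr 1
  refine Finset.sum_congr rfl fun j _ => ?_
  rw [pow_succ _ ((j : ℕ) + 1)]
  simp

theorem barTail_zero (g : Fin 1 → G) (c : ℤ) :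
    barTail G 0 (Finsupp.single g c) = -Finsupp.single default c := by
  rw [barTail_single]
  simp [Subsingleton.elim _ (default : Fin 0 → G)]

theorem barD_cons (n : ℕ) (s : G) (z : Fin (n + 1) → G) (c : ℤ) :
    barD G (n + 1) (Finsupp.single (Fin.cons s z) c) =
      Finsupp.single z c - Finsupp.single (mulHead n s z) c -
        barCons n s (barTail G n (Finsupp.single z c)) := by
  rw [barD_single, barTail_cons, Fin.tail_cons]
  abel

theorem mulHead_cons (n : ℕ) (s g : G) (y : Fin n → G) :
    mulHead n s (Fin.cons g y) = Fin.cons (s * g) y := by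
  simp [mulHead]

end Bar

/-! ### Fox calculus and the contraction of the bar complex of a free group -/

section Fox

variable {G : Type} [Group G]

/-- Right multiplication on the second entry of pairs. -/
def foxMul (g : G) : ((G × G) →₀ ℤ) →ₗ[ℤ] ((G × G) →₀ ℤ) :=
  Finsupp.lmapDomain ℤ ℤ fun p => (p.1, p.2 * g)

/-- The projection of the group ring onto the abelianization. -/
def abProj (G : Type) [Group G] : (G →₀ ℤ) →ₗ[ℤ] Additive (Abelianization G) :=
  Finsupp.lsum ℤ fun g => LinearMap.toSpanSingleton ℤ _ (Additive.ofMul (Abelianization.of g))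

theorem abProj_single {G : Type} [Group G] (g : G) (c : ℤ) :
    abProj G (Finsupp.single g c) = c • Additive.ofMul (Abelianization.of g) := by
  simp [abProj]

/-- A Fox derivation of `G`: a crossed homomorphism `G → ℤ[G × G]`, together with a factorization
of its first component through a section of the abelianization. -/
structure FoxDerivation (G : Type) [Group G] where
  toFun : G → ((G × G) →₀ ℤ)
  map_mul' : ∀ g g', toFun (g * g') = foxMul g' (toFun g) + toFun g'
  -- Reading a pair `(s, w)` as `(s - 1) w`, this is the fundamental formula of Fox calculus, `∑ (x
  -- - 1) ∂g/∂x = g - 1`.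
  boundary : ∀ g, Finsupp.lmapDomain ℤ ℤ (fun p : G × G => p.1 * p.2) (toFun g) -
    Finsupp.lmapDomain ℤ ℤ Prod.snd (toFun g) = Finsupp.single g 1 - Finsupp.single 1 1
  sec : Additive (Abelianization G) →ₗ[ℤ] (G →₀ ℤ)
  sec_of : ∀ g, sec (Additive.ofMul (Abelianization.of g)) =
    Finsupp.lmapDomain ℤ ℤ Prod.fst (toFun g)
  sec_spec : ∀ x, abProj G (sec x) = x

theorem foxMul_mul (g g' : G) (m : (G × G) →₀ ℤ) :
    foxMul (g * g') m = foxMul g' (foxMul g m) := by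
  simp only [foxMul, Finsupp.lmapDomain_apply, ← Finsupp.mapDomain_comp]
  congr 1
  funext p
  simp [mul_assoc]

theorem foxMul_one (m : (G × G) →₀ ℤ) : foxMul 1 m = m := by
  simp only [foxMul, Finsupp.lmapDomain_apply, mul_one]
  exact Finsupp.mapDomain_id

theorem foxMul_boundary (g : G) (m : (G × G) →₀ ℤ) :
    Finsupp.lmapDomain ℤ ℤ (fun p : G × G => p.1 * p.2) (foxMul g m) -
      Finsupp.lmapDomain ℤ ℤ Prod.snd (foxMul g m) =
    Finsupp.lmapDomain ℤ ℤ (· * g) (Finsupp.lmapDomain ℤ ℤ (fun p : G × G => p.1 * p.2) m -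
      Finsupp.lmapDomain ℤ ℤ Prod.snd m) := by
  simp only [foxMul, map_sub, Finsupp.lmapDomain_apply, ← Finsupp.mapDomain_comp]
  congr 2
  funext p
  simp [mul_assoc]

/-- The permutation of `ℤ[G × G] × G` attached to an element of `G`. -/
def foxPerm (x : G) : Equiv.Perm (((G × G) →₀ ℤ) × G) where
  -- Left translation by `((x, 1), x)` in the semidirect product with law `(m, g)(m', g') = (m g' +
  -- m', g g')`. Being invertible, it extends from generators to the free group by the universal
  -- property.
  toFun p := (foxMul p.2 (Finsupp.single (x, 1) 1) + p.1, x * p.2)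
  invFun p := (p.1 - foxMul (x⁻¹ * p.2) (Finsupp.single (x, 1) 1), x⁻¹ * p.2)
  left_inv p := by simp
  right_inv p := by simp

variable {X : Type}

/-- The action of a free group on `ℤ[G × G] × G` whose first component is the Fox derivation. -/
def foxHom : FreeGroup X →* Equiv.Perm (((FreeGroup X × FreeGroup X) →₀ ℤ) × FreeGroup X) :=
  FreeGroup.lift fun x => foxPerm (FreeGroup.of x)

/-- The universal Fox derivative of a free group. -/
def foxFun (g : FreeGroup X) : (FreeGroup X × FreeGroup X) →₀ ℤ := (foxHom g (0, 1)).1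

/-- Every word acts by a left translation of the semidirect product, whose first component is
`foxFun`; composing two translations is the crossed homomorphism rule. -/
theorem foxHom_apply (g : FreeGroup X) (m : (FreeGroup X × FreeGroup X) →₀ ℤ) (k : FreeGroup X) :
    foxHom g (m, k) = (foxMul k (foxFun g) + m, g * k) := by
  induction g using FreeGroup.induction_on generalizing m k with
  | C1 => simp [foxFun]
  | of x => simp [foxFun, foxHom, foxPerm, foxMul_one]
  | inv_of x _ =>
    simp only [foxFun, foxHom, map_inv, FreeGroup.lift_apply_of]
    change (foxPerm (FreeGroup.of x)).symm _ = (_ + _ , _)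
    simp [foxPerm, ← foxMul_mul, sub_eq_neg_add]
  | mul g g' h h' =>
    have e : foxFun (g * g') = foxMul g' (foxFun g) + foxFun g' := by
      conv_lhs => rw [foxFun, map_mul, Equiv.Perm.mul_apply, h', h]
      simp [foxMul_one]
    rw [map_mul, Equiv.Perm.mul_apply, h', h, e, map_add, foxMul_mul, mul_assoc, add_assoc]

theorem foxFun_mul (g g' : FreeGroup X) :
    foxFun (g * g') = foxMul g' (foxFun g) + foxFun g' := by
  conv_lhs => rw [foxFun, map_mul, Equiv.Perm.mul_apply, foxHom_apply g', foxHom_apply g]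
  simp [foxMul_one]

theorem foxFun_of (x : X) : foxFun (FreeGroup.of x) = Finsupp.single (FreeGroup.of x, 1) 1 := by
  simp [foxFun, foxHom, foxPerm, foxMul_one]

theorem foxFun_one : foxFun (1 : FreeGroup X) = 0 := by simp [foxFun]

/-- The section of the abelianization of a free group defined by its Fox derivative. -/
def foxSec : Additive (Abelianization (FreeGroup X)) →+ (FreeGroup X →₀ ℤ) :=
  -- The projection to first entries forgets the right action, so the crossed homomorphism becomes a
  -- homomorphism to an abelian group.
  MonoidHom.toAdditiveLeft (Abelianization.lift
    (MonoidHom.mk' (fun g => Multiplicative.ofAdd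
      (Finsupp.lmapDomain ℤ ℤ Prod.fst (foxFun g))) (by
      intro g g'
      rw [foxFun_mul, map_add, ofAdd_add, foxMul]
      simp only [Finsupp.lmapDomain_apply, ← Finsupp.mapDomain_comp]
      rfl)))

theorem foxSec_of (g : FreeGroup X) : foxSec (Additive.ofMul (Abelianization.of g)) =
    Finsupp.lmapDomain ℤ ℤ Prod.fst (foxFun g) := rfl

theorem abProj_foxSec (x : Additive (Abelianization (FreeGroup X))) :
    abProj _ (foxSec x) = x := by
  have h : MonoidHom.comp (AddMonoidHom.toMultiplicativeRight
      ((abProj (FreeGroup X)).toAddMonoidHom.comp foxSec)) Abelianization.of = Abelianization.of := by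
    refine FreeGroup.ext_hom _ _ fun x => ?_
    change Additive.toMul (abProj _ (foxSec (Additive.ofMul (Abelianization.of _)))) = _
    rw [foxSec_of, foxFun_of]
    simp only [Finsupp.lmapDomain_apply, Finsupp.mapDomain_single, abProj_single, one_smul]
    rfl
  obtain ⟨g, rfl⟩ := QuotientGroup.mk_surjective x.toMul
  exact DFunLike.congr_fun h g

/-- The Fox derivation of a free group. -/
def foxDerivation : FoxDerivation (FreeGroup X) where
  toFun := foxFun
  map_mul' := foxFun_mul
  boundary g := by
    induction g using FreeGroup.induction_on with
    | C1 => simp [foxFun_one]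
    | of x => simp [foxFun_of]
    | inv_of x h =>
      -- Expand the derivative of `x x⁻¹ = 1`.
      have e : foxFun (FreeGroup.of x)⁻¹ =
          -foxMul (FreeGroup.of x)⁻¹ (foxFun (FreeGroup.of x)) := by
        have h := foxFun_mul (FreeGroup.of x) (FreeGroup.of x)⁻¹
        rw [mul_inv_cancel, foxFun_one] at h
        exact (neg_eq_of_add_eq_zero_right h.symm).symm
      rw [e, foxFun_of]
      simp only [foxMul, map_neg, Finsupp.lmapDomain_apply, Finsupp.mapDomain_single, one_mul,
        mul_inv_cancel]
      abel
    | mul g g' h h' =>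
      rw [foxFun_mul, map_add, map_add, add_sub_add_comm, h', foxMul_boundary, h]
      simp only [map_sub, Finsupp.lmapDomain_apply, Finsupp.mapDomain_single, one_mul]
      abel
  sec := foxSec.toIntLinearMap
  sec_of := foxSec_of
  sec_spec := abProj_foxSec

/-- Transport of a Fox derivation along an isomorphism. -/
def FoxDerivation.ofEquiv {G H : Type} [Group G] [Group H] (e : G ≃* H) (D : FoxDerivation H) :
    FoxDerivation G where
  toFun g := Finsupp.lmapDomain ℤ ℤ (Prod.map e.symm e.symm) (D.toFun (e g))
  map_mul' g g' := by
    rw [map_mul, D.map_mul', map_add]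
    simp only [foxMul, Finsupp.lmapDomain_apply, ← Finsupp.mapDomain_comp]
    congr 2
    funext p
    simp
  boundary g := by
    have h := congrArg (Finsupp.lmapDomain ℤ ℤ e.symm) (D.boundary (e g))
    rw [map_sub, map_sub] at h
    simp only [Finsupp.lmapDomain_apply, ← Finsupp.mapDomain_comp, Finsupp.mapDomain_single,
      MulEquiv.symm_apply_apply, map_one] at h ⊢
    rw [← h]
    congr 2
    funext p
    simp
  sec := Finsupp.lmapDomain ℤ ℤ e.symm ∘ₗ D.sec ∘ₗ
    (MonoidHom.toAdditive (Abelianization.map e.toMonoidHom)).toIntLinearMap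
  sec_of g := by
    have h := congrArg (Finsupp.lmapDomain ℤ ℤ e.symm) (D.sec_of (e g))
    refine h.trans ?_
    simp only [Finsupp.lmapDomain_apply, ← Finsupp.mapDomain_comp]
    rfl
  sec_spec x := by
    have key : abProj G ∘ₗ Finsupp.lmapDomain ℤ ℤ e.symm =
        (MonoidHom.toAdditive (Abelianization.map e.symm.toMonoidHom)).toIntLinearMap ∘ₗ
          abProj H := by
      refine Finsupp.lhom_ext fun g c => ?_
      simp only [LinearMap.comp_apply, Finsupp.lmapDomain_apply, Finsupp.mapDomain_single,
        abProj_single, map_smul]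
      rfl
    refine (LinearMap.congr_fun key _).trans ?_
    simp only [LinearMap.comp_apply]
    rw [D.sec_spec]
    obtain ⟨g, rfl⟩ := QuotientGroup.mk_surjective x.toMul
    change Additive.ofMul (Abelianization.of (e.symm (e g))) = _
    simp
    rfl

/-- The Fox derivation of a group that is free. -/
def freeFoxDerivation (G : Type) [Group G] [IsFreeGroup G] : FoxDerivation G :=
  FoxDerivation.ofEquiv (IsFreeGroup.toFreeGroup G) foxDerivation

/-- For `E = (s, w)`: the first two faces of `[s|w|g|y]` delete `s` or multiply it into `w`, the
third multiplies `g` into `w`, which is the right action on `E`, and the other faces only see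
`[g|y]`. -/
theorem barD_barPair (n : ℕ) (E : (G × G) →₀ ℤ) (g : G) (y : Fin n → G) :
    barD G (n + 2) (barPair (n + 1) E (Finsupp.single (Fin.cons g y : Fin (n + 1) → G) 1)) =
      Finsupp.lmapDomain ℤ ℤ (fun w => (Fin.cons w (Fin.cons g y) : Fin (n + 2) → G))
        (Finsupp.lmapDomain ℤ ℤ Prod.snd E -
          Finsupp.lmapDomain ℤ ℤ (fun p : G × G => p.1 * p.2) E) +
      barPair n (foxMul g E) (Finsupp.single y 1) +
      barPair n E (barTail G n (Finsupp.single (Fin.cons g y : Fin (n + 1) → G) 1)) := by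
  induction E using Finsupp.induction_linear with
  | zero => simp
  | add E E' h h' =>
    simp only [map_add, LinearMap.add_apply, h, h', map_sub]
    abel
  | single p c =>
    obtain ⟨s, w⟩ := p
    simp only [foxMul, Finsupp.lmapDomain_apply, Finsupp.mapDomain_single, map_sub,
      barPair_single, barCons_single, map_smul]
    rw [barD_cons, barTail_cons, mulHead_cons, mulHead_cons, map_sub, map_neg, barCons_single]
    simp only [smul_sub, smul_neg, Finsupp.smul_single, smul_eq_mul, mul_one]
    abel

theorem barD_barPair_zero (E : (G × G) →₀ ℤ) (y : Fin 0 → G) :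
    barD G 1 (barPair 0 E (Finsupp.single y 1)) =
      Finsupp.lmapDomain ℤ ℤ (fun w => (Fin.cons w y : Fin 1 → G))
        (Finsupp.lmapDomain ℤ ℤ Prod.snd E -
          Finsupp.lmapDomain ℤ ℤ (fun p : G × G => p.1 * p.2) E +
            Finsupp.lmapDomain ℤ ℤ Prod.fst E) := by
  induction E using Finsupp.induction_linear with
  | zero => simp
  | add E E' h h' =>
    simp only [map_add, LinearMap.add_apply, h, h', map_sub]
    abel
  | single p c =>
    obtain ⟨s, w⟩ := p
    simp only [Finsupp.lmapDomain_apply, Finsupp.mapDomain_single, map_sub, map_add,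
      barPair_single, barCons_single, map_smul]
    rw [barD_cons, barTail_zero, mulHead_cons, map_neg, barCons_single]
    simp only [smul_sub, Finsupp.smul_single, smul_eq_mul, mul_one,
      Subsingleton.elim (default : Fin 0 → G) y, sub_neg_eq_add, smul_add]

/-- The augmentation of the bar complex onto the abelianization. -/
def barAug (G : Type) [Group G] : BarChain G 1 →ₗ[ℤ] Additive (Abelianization G) :=
  abProj G ∘ₗ Finsupp.lmapDomain ℤ ℤ fun g => g 0

theorem barAug_single (g : Fin 1 → G) (c : ℤ) :
    barAug G (Finsupp.single g c) = c • Additive.ofMul (Abelianization.of (g 0)) := by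
  simp [barAug, abProj_single]

theorem barAug_comp_barD : barAug G ∘ₗ barD G 1 = 0 := by
  refine Finsupp.lhom_ext fun g c => ?_
  obtain ⟨s, z, rfl⟩ : ∃ (s : G) (z : Fin 1 → G), g = Fin.cons s z :=
    ⟨g 0, Fin.tail g, (Fin.cons_self_tail g).symm⟩
  have h (z : Fin (0 + 1) → G) (c : ℤ) : barAug G (Finsupp.single z c) =
    c • Additive.ofMul (Abelianization.of (z 0)) := barAug_single z c
  rw [LinearMap.comp_apply, barD_cons, barTail_zero, map_neg, barCons_single]
  simp only [map_sub, map_neg, h, mulHead, Fin.cons_zero, map_mul, ofMul_mul,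
    smul_add, LinearMap.zero_apply]
  abel

namespace FoxDerivation

variable (D : FoxDerivation G)

/-- The contraction of the bar complex. -/
def homotopy (n : ℕ) : BarChain G (n + 1) →ₗ[ℤ] BarChain G (n + 2) :=
  Finsupp.lsum ℤ fun z => LinearMap.toSpanSingleton ℤ _
    -- The Fox formula yields `g - 1` instead of `g`; the pair `(1, 1)` compensates for the
    -- resulting chain with first entry 1.
    (barPair n (Finsupp.single (1, 1) 1 - D.toFun (z 0)) (Finsupp.single (Fin.tail z) 1))

theorem homotopy_single (n : ℕ) (g : G) (z : Fin n → G) :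
    D.homotopy n (Finsupp.single (Fin.cons g z : Fin (n + 1) → G) 1) =
      barPair n (Finsupp.single (1, 1) 1 - D.toFun g) (Finsupp.single z 1) := by
  simp [homotopy]

theorem homotopy_barCons (n : ℕ) (g : G) (x : BarChain G n) :
    D.homotopy n (barCons n g x) = barPair n (Finsupp.single (1, 1) 1 - D.toFun g) x := by
  induction x using Finsupp.induction_linear with
  | zero => simp
  | add x y hx hy => simp only [map_add, hx, hy]
  | single z c =>
    rw [← mul_one c, ← smul_eq_mul, ← Finsupp.smul_single, map_smul, map_smul, map_smul,
      barCons_single, homotopy_single]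

/-- The section of the augmentation. -/
def augSec : Additive (Abelianization G) →ₗ[ℤ] BarChain G 1 :=
  Finsupp.lmapDomain ℤ ℤ (fun g _ => g) ∘ₗ D.sec

theorem barAug_augSec (x : Additive (Abelianization G)) : barAug G (D.augSec x) = x := by
  simp only [barAug, augSec, LinearMap.comp_apply, Finsupp.lmapDomain_apply,
    ← Finsupp.mapDomain_comp]
  refine Eq.trans (congrArg _ ?_) (D.sec_spec x)
  exact Finsupp.mapDomain_id

/-- On `[g|g'|y]`, the terms with the tail of `[g'|y]` cancel between the two summands, the Fox
derivatives of `g`, `g'` and `g g'` cancel by the crossed homomorphism rule, and `(1, 1) g'`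
contributes the `[1|g'|y]` that the Fox formula removes. -/
theorem homotopy_succ (n : ℕ) (x : BarChain G (n + 2)) :
    barD G (n + 2) (D.homotopy (n + 1) x) + D.homotopy n (barD G (n + 1) x) = x := by
  suffices h : barD G (n + 2) ∘ₗ D.homotopy (n + 1) + D.homotopy n ∘ₗ barD G (n + 1) =
      LinearMap.id from LinearMap.congr_fun h x
  refine Finsupp.lhom_ext' fun z => LinearMap.ext_ring ?_
  obtain ⟨g, g', y, rfl⟩ : ∃ (g g' : G) (y : Fin n → G), z = Fin.cons g (Fin.cons g' y) :=
    ⟨z 0, Fin.tail z 0, Fin.tail (Fin.tail z), by simp⟩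
  simp only [LinearMap.comp_apply, LinearMap.add_apply, Finsupp.lsingle_apply, LinearMap.id_apply]
  rw [homotopy_single, barD_barPair, barD_cons, mulHead_cons, (D.homotopy n).map_sub,
    (D.homotopy n).map_sub, homotopy_single, homotopy_single, homotopy_barCons, D.map_mul']
  have hb := D.boundary g
  have hb' : Finsupp.lmapDomain ℤ ℤ Prod.snd (Finsupp.single ((1 : G), (1 : G)) 1 - D.toFun g) -
      Finsupp.lmapDomain ℤ ℤ (fun p : G × G => p.1 * p.2) (Finsupp.single (1, 1) 1 - D.toFun g) =
      Finsupp.single g (1 : ℤ) - Finsupp.single 1 1 := by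
    rw [← hb]
    simp only [map_sub, Finsupp.lmapDomain_apply, Finsupp.mapDomain_single, mul_one]
    abel
  rw [hb']
  have hf : foxMul g' (Finsupp.single ((1 : G), (1 : G)) 1) = Finsupp.single (1, g') 1 := by
    simp [foxMul]
  simp only [map_sub, map_add, LinearMap.sub_apply, LinearMap.add_apply, hf, barPair_single,
    barCons_single, Finsupp.lmapDomain_apply, Finsupp.mapDomain_single, one_smul]
  abel

/-- In lowest degree the last face deletes `w` from `[s|w]`. The sum of the remaining `[s]` is the
value of the section at the class of `g`, which is why the section is part of the data of a Fox
derivation. -/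
theorem homotopy_zero (x : BarChain G 1) :
    barD G 1 (D.homotopy 0 x) + D.augSec (barAug G x) = x := by
  suffices h : barD G 1 ∘ₗ D.homotopy 0 + D.augSec ∘ₗ barAug G =
      LinearMap.id from LinearMap.congr_fun h x
  refine Finsupp.lhom_ext' fun z => LinearMap.ext_ring ?_
  obtain ⟨g, y, rfl⟩ : ∃ (g : G) (y : Fin 0 → G), z = Fin.cons g y :=
    ⟨z 0, Fin.tail z, by simp⟩
  simp only [LinearMap.comp_apply, LinearMap.add_apply, Finsupp.lsingle_apply, LinearMap.id_apply]
  rw [homotopy_single, barD_barPair_zero, barAug_single, one_smul, Fin.cons_zero]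
  have hb := D.boundary g
  have hb' : Finsupp.lmapDomain ℤ ℤ Prod.snd (Finsupp.single ((1 : G), (1 : G)) 1 - D.toFun g) -
      Finsupp.lmapDomain ℤ ℤ (fun p : G × G => p.1 * p.2) (Finsupp.single (1, 1) 1 - D.toFun g) =
      Finsupp.single g (1 : ℤ) - Finsupp.single 1 1 := by
    rw [← hb]
    simp only [map_sub, Finsupp.lmapDomain_apply, Finsupp.mapDomain_single, mul_one]
    abel
  have hy : (fun w : G => (Fin.cons w y : Fin 1 → G)) = fun w _ => w := by
    funext w k
    refine Fin.cases rfl (fun k => k.elim0) k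
  rw [hb', augSec, LinearMap.comp_apply, D.sec_of, hy]
  simp only [map_sub, map_add, Finsupp.lmapDomain_apply, Finsupp.mapDomain_single, ← hy]
  abel

end FoxDerivation

end Fox

end FreeGroupFunctors

end

noncomputable section

namespace FreeGroupFunctors

open Limits

/-! ### Projective resolutions in functor categories -/

section Resolution

variable {J : Type*} [Category J]

/-- Evaluation at an object commutes with homology, and a functor with zero values is zero. -/
theorem functor_exact {S : ShortComplex (J ⥤ AbCat)}
    (h : ∀ (t : J) (x : S.X₂.obj t), (S.g.app t).hom x = 0 → ∃ y, (S.f.app t).hom y = x) :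
    S.Exact := by
  rw [ShortComplex.exact_iff_isZero_homology, Functor.isZero_iff]
  intro t
  have ht : (S.map ((evaluation J AbCat).obj t)).Exact :=
    (ShortComplex.moduleCat_exact_iff _).2 fun x hx => h t x hx
  exact ((ShortComplex.exact_iff_isZero_homology _).1 ht).of_iso
    (S.mapHomologyIso ((evaluation J AbCat).obj t)).symm

/-- A pointwise exact augmented complex of projective functors is a projective resolution. -/
def resolutionOfExact (K : ChainComplex (J ⥤ AbCat) ℕ) (hK : ∀ n, Projective (K.X n))
    {Z : J ⥤ AbCat} (e : K.X 0 ⟶ Z) (w : K.d 1 0 ≫ e = 0)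
    (he : ∀ t, Function.Surjective (e.app t).hom)
    (h₀ : ∀ t (x : (K.X 0).obj t), (e.app t).hom x = 0 → ∃ y, ((K.d 1 0).app t).hom y = x)
    (h₁ : ∀ n t (x : (K.X (n + 1)).obj t), ((K.d (n + 1) n).app t).hom x = 0 →
      ∃ y, ((K.d (n + 2) (n + 1)).app t).hom y = x) : ProjectiveResolution Z where
  complex := K
  projective := hK
  π := (ChainComplex.toSingle₀Equiv _ _).symm ⟨e, w⟩
  quasiIso := ⟨fun n => by
    have : Epi e := by
      rw [NatTrans.epi_iff_epi_app]
      exact fun t => (ModuleCat.epi_iff_surjective _).2 (he t)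
    cases n with
    | zero =>
      rw [ChainComplex.quasiIsoAt₀_iff, ShortComplex.quasiIso_iff_of_zeros']
      · refine (ShortComplex.exact_and_epi_g_iff_of_iso ?_).2
          (⟨functor_exact (S := ShortComplex.mk (K.d 1 0) e w) h₀, this⟩)
        exact ShortComplex.isoMk (Iso.refl _) (Iso.refl _) (Iso.refl _)
          ((Category.id_comp _).trans (Category.comp_id _).symm)
          ((Category.id_comp _).trans ((ChainComplex.toSingle₀Equiv_symm_apply_f_zero e w).symm.trans
            (Category.comp_id _).symm))
      all_goals first | rfl | exact K.shape _ _ (by simp)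
    | succ n =>
      rw [quasiIsoAt_iff_exactAt']
      · rw [HomologicalComplex.exactAt_iff' _ (n + 1 + 1) (n + 1) n (by simp) (by simp)]
        exact functor_exact (h₁ n)
      · apply ChainComplex.exactAt_succ_single_obj⟩

end Resolution

/-! ### The bar resolution of the abelianization functor -/

/-- The free group on `n` generators. -/
abbrev freeGr (n : ℕ) : Gr :=
  ⟨GrpCat.of (FreeGroup (Fin n)), by
    constructor
    · change IsFreeGroup (FreeGroup (Fin n))
      infer_instance
    · change Group.FG (FreeGroup (Fin n))
      infer_instance⟩

/-- The homomorphism out of a free group given by the images of the generators. -/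
def freeGrLift {n : ℕ} {G : Gr} (g : Fin n → G.obj) : freeGr n ⟶ G :=
  ObjectProperty.homMk (GrpCat.ofHom (FreeGroup.lift g))

/-- The functor `G ↦ ℤ[Gⁿ]`. -/
def barFun (n : ℕ) : FGr where
  obj G := ModuleCat.of ℤ (BarChain G.obj n)
  map f := ModuleCat.ofHom (Finsupp.lmapDomain ℤ ℤ fun g => f.hom.hom ∘ g)
  map_id G := by
    ext1
    exact Finsupp.lmapDomain_id ℤ ℤ
  map_comp f g := by
    ext1
    exact Finsupp.lmapDomain_comp ℤ ℤ (fun x : Fin n → _ => f.hom.hom ∘ x) fun x => g.hom.hom ∘ x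

/-- The tautological element of `ℤ[Fₙⁿ]`. -/
def barGen (n : ℕ) : (barFun n).obj (freeGr n) :=
  (Finsupp.single FreeGroup.of 1 : BarChain (FreeGroup (Fin n)) n)

theorem barFun_map_barGen {n : ℕ} {G : Gr} (g : Fin n → G.obj) :
    ((barFun n).map (freeGrLift g)).hom (barGen n) = (Finsupp.single g 1 : BarChain G.obj n) := by
  change Finsupp.mapDomain _ (Finsupp.single _ _) = _
  rw [Finsupp.mapDomain_single]
  congr 1
  funext i
  exact FreeGroup.lift_apply_of

theorem freeGrLift_comp {n : ℕ} {G H : Gr} (g : Fin n → G.obj) (f : G ⟶ H) :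
    freeGrLift g ≫ f = freeGrLift (f.hom.hom ∘ g) := by
  ext : 2
  refine FreeGroup.ext_hom _ _ fun i => ?_
  change f.hom.hom (FreeGroup.lift g (FreeGroup.of i)) = FreeGroup.lift _ (FreeGroup.of i)
  rw [FreeGroup.lift_apply_of, FreeGroup.lift_apply_of]
  rfl

theorem linearCombination_single_one {R α M : Type*} [Ring R] [AddCommGroup M] [Module R M]
    (v : α → M) (g : α) : Finsupp.linearCombination R v (Finsupp.single g 1) = v g := by
  simp

/-- The natural transformation out of `barFun n` attached to an element. -/
def barDesc {n : ℕ} {F : FGr} (x : F.obj (freeGr n)) : barFun n ⟶ F where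
  app G := ModuleCat.ofHom (Finsupp.linearCombination ℤ fun g : Fin n → G.obj =>
    (F.map (freeGrLift g)).hom x)
  naturality G H f := by
    ext1
    refine Finsupp.lhom_ext' fun g => LinearMap.ext_ring ?_
    change Finsupp.linearCombination ℤ (fun g : Fin n → H.obj => (F.map (freeGrLift g)).hom x)
      (Finsupp.mapDomain _ (Finsupp.single g 1)) =
        (F.map f).hom (Finsupp.linearCombination ℤ _ (Finsupp.single g 1))
    rw [Finsupp.mapDomain_single, linearCombination_single_one, linearCombination_single_one]
    refine Eq.trans ?_ (ConcreteCategory.congr_hom (F.map_comp (freeGrLift g) f) x)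
    rw [freeGrLift_comp]

theorem barDesc_app_single {n : ℕ} {F : FGr} (x : F.obj (freeGr n)) {G : Gr}
    (g : Fin n → G.obj) : ((barDesc x).app G).hom (Finsupp.single g 1 : BarChain G.obj n) =
      (F.map (freeGrLift g)).hom x :=
  linearCombination_single_one _ g

theorem freeGrLift_of (n : ℕ) : freeGrLift (G := freeGr n) FreeGroup.of = 𝟙 _ := by
  ext : 2
  refine FreeGroup.ext_hom _ _ fun i => ?_
  change FreeGroup.lift _ (FreeGroup.of i) = _
  rw [FreeGroup.lift_apply_of]
  rfl

/-- The Yoneda isomorphism for `barFun n`. -/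
def barYoneda (n : ℕ) (F : FGr) : (barFun n ⟶ F) ≃+ F.obj (freeGr n) where
  toFun f := (f.app _).hom (barGen n)
  map_add' f g := rfl
  invFun x := barDesc x
  left_inv f := by
    ext G : 3
    refine Finsupp.lhom_ext' fun g => LinearMap.ext_ring ?_
    refine (barDesc_app_single _ g).trans ?_
    refine (ConcreteCategory.congr_hom (f.naturality (freeGrLift g)) (barGen n)).symm.trans ?_
    exact congrArg (f.app G).hom (barFun_map_barGen g)
  right_inv x := by
    refine (barDesc_app_single _ _).trans ?_
    rw [freeGrLift_of, F.map_id]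
    rfl

/-- Lifting a map out of `barFun n` amounts to lifting one element at the free group of rank `n`,
and epimorphisms of functors are pointwise surjective. -/
instance (n : ℕ) : Projective (barFun n) where
  factors {E X} f e he := by
    obtain ⟨y, hy⟩ := (ModuleCat.epi_iff_surjective _).1
      ((NatTrans.epi_iff_epi_app e).1 he (freeGr n)) (barYoneda n X f)
    refine ⟨(barYoneda n E).symm y, (barYoneda n X).injective ?_⟩
    change (e.app (freeGr n)).hom (barYoneda n E ((barYoneda n E).symm y)) = _
    rw [AddEquiv.apply_symm_apply]
    exact hy

/-- The bar differential as a natural transformation. -/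
def barFunD (n : ℕ) : barFun (n + 1) ⟶ barFun n where
  app G := ModuleCat.ofHom (barD G.obj n)
  naturality G H f := by
    ext1
    exact (map_barD f.hom.hom n).symm

theorem barFunD_comp (n : ℕ) : barFunD (n + 1) ≫ barFunD n = 0 := by
  ext G : 3
  exact barD_comp_barD n

/-- The augmentation of the bar complex as a natural transformation. -/
def barFunAug : barFun 1 ⟶ abelianization where
  app G := ModuleCat.ofHom (barAug G.obj)
  naturality G H f := by
    ext1
    refine Finsupp.lhom_ext' fun g => LinearMap.ext_ring ?_
    change barAug _ (Finsupp.mapDomain _ (Finsupp.single g 1)) =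
      (abelianization.map f).hom (barAug _ (Finsupp.single g 1))
    rw [Finsupp.mapDomain_single, barAug_single, barAug_single, one_smul, one_smul]
    rfl

/-- The bar complex of functors, shifted so as to start with `ℤ[G]`. -/
def barComplex : ChainComplex FGr ℕ :=
  ChainComplex.of (fun n => barFun (n + 1)) (fun n => barFunD (n + 1))
    fun n => barFunD_comp (n + 1)

theorem barComplex_d (n : ℕ) : barComplex.d (n + 1) n = barFunD (n + 1) :=
  ChainComplex.of_d (fun n => barFun (n + 1)) (fun n => barFunD (n + 1)) n

/-- The Fox derivation of a finitely generated free group. -/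
def grFox (G : Gr) : FoxDerivation G.obj :=
  haveI : IsFreeGroup G.obj := G.property.1
  freeFoxDerivation G.obj

/-- The bar resolution of the abelianization functor. -/
def barResolution : ProjectiveResolution abelianization :=
  resolutionOfExact barComplex (fun n => inferInstanceAs (Projective (barFun (n + 1)))) barFunAug
    (by
      rw [barComplex_d]
      ext G : 3
      exact barAug_comp_barD)
    -- The Fox derivation depends on a basis of `G`, so neither section nor contraction is claimed
    -- to be natural; pointwise exactness does not need it.
    (fun G x => ⟨(grFox G).augSec x, (grFox G).barAug_augSec x⟩)
    (fun G x hx => ⟨(grFox G).homotopy 0 x, by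
      rw [barComplex_d]
      have h := (grFox G).homotopy_zero x
      have hx' : barAug G.obj x = 0 := hx
      rw [hx', map_zero, add_zero] at h
      exact h⟩)
    (fun n G x hx => ⟨(grFox G).homotopy (n + 1) x, by
      rw [barComplex_d] at hx ⊢
      have h := (grFox G).homotopy_succ n x
      have hx' : barD G.obj (n + 1) x = 0 := hx
      rw [hx', map_zero, add_zero] at h
      exact h⟩)

end FreeGroupFunctors

end

noncomputable section

namespace FreeGroupFunctors

open Limits

/-! ### The total complex of a tensor product of chain complexes -/

section Tot

variable {R : Type} [CommRing R] (A B : ℕ → ModuleCat.{0} R)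

/-- The total tensor product in degree `k`. -/
abbrev Tot (k : ℕ) : Type := ∀ p : {p : ℕ × ℕ // p.1 + p.2 = k}, A p.1.1 ⊗[R] B p.1.2

variable {A B} (dA : ∀ n, A (n + 1) →ₗ[R] A n) (dB : ∀ n, B (n + 1) →ₗ[R] B n)

/-- The differential of the total tensor product. -/
def totD (k : ℕ) : Tot A B (k + 1) →ₗ[R] Tot A B k where
  toFun t p := (dA p.1.1).rTensor (B p.1.2) (t ⟨(p.1.1 + 1, p.1.2), by
      have := p.2; dsimp only; omega⟩) +
    (-1 : R) ^ p.1.1 • (dB p.1.2).lTensor (A p.1.1) (t ⟨(p.1.1, p.1.2 + 1), by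
      have := p.2; dsimp only; omega⟩)
  map_add' s t := by
    funext p
    simp only [Pi.add_apply, map_add, smul_add]
    abel
  map_smul' c t := by
    funext p
    simp only [Pi.smul_apply, map_smul, smul_add, RingHom.id_apply]
    rw [smul_comm c]

theorem totD_apply (k : ℕ) (t : Tot A B (k + 1)) (a b : ℕ) (h : a + b = k) :
    totD dA dB k t ⟨(a, b), h⟩ =
      (dA a).rTensor (B b) (t ⟨(a + 1, b), by dsimp only; omega⟩) +
        (-1 : R) ^ a • (dB b).lTensor (A a) (t ⟨(a, b + 1), by dsimp only; omega⟩) := rfl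

theorem totD_comp_totD (hA : ∀ n, dA n ∘ₗ dA (n + 1) = 0) (hB : ∀ n, dB n ∘ₗ dB (n + 1) = 0)
    (k : ℕ) : totD dA dB k ∘ₗ totD dA dB (k + 1) = 0 := by
  refine LinearMap.ext fun t => funext fun ⟨⟨a, b⟩, h⟩ => ?_
  simp only [LinearMap.comp_apply, totD_apply, map_add, map_smul]
  have h1 (x) : (dA a).rTensor (B b) ((dA (a + 1)).rTensor (B b) x) = 0 := by
    rw [← LinearMap.comp_apply, ← LinearMap.rTensor_comp, hA, LinearMap.rTensor_zero]
    rfl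
  have h2 (x) : (dB b).lTensor (A a) ((dB (b + 1)).lTensor (A a) x) = 0 := by
    rw [← LinearMap.comp_apply, ← LinearMap.lTensor_comp, hB, LinearMap.lTensor_zero]
    rfl
  have h3 (x) : (dB b).lTensor (A a) ((dA a).rTensor (B (b + 1)) x) =
      (dA a).rTensor (B b) ((dB b).lTensor (A (a + 1)) x) := by
    rw [← LinearMap.comp_apply, ← LinearMap.comp_apply, LinearMap.lTensor_comp_rTensor,
      LinearMap.rTensor_comp_lTensor]
  rw [h1, h2, h3, pow_succ]
  simp

/-- The inclusion of the summand of bidegree `(a, b)`; it vanishes unless `a + b = k`. -/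
def totInc (a b k : ℕ) : A a ⊗[R] B b →ₗ[R] Tot A B k :=
  if h : a + b = k then LinearMap.single R (fun p : {p : ℕ × ℕ // p.1 + p.2 = k} =>
    A p.1.1 ⊗[R] B p.1.2) ⟨(a, b), h⟩ else 0

theorem totInc_same {a b k : ℕ} (h : a + b = k) (x : A a ⊗[R] B b) :
    totInc a b k x ⟨(a, b), h⟩ = x := by
  rw [totInc, dif_pos h]
  exact Pi.single_eq_same (M := fun p : {p : ℕ × ℕ // p.1 + p.2 = k} =>
    A p.1.1 ⊗[R] B p.1.2) _ _

theorem totInc_ne {a b k : ℕ} (x : A a ⊗[R] B b) (p : {p : ℕ × ℕ // p.1 + p.2 = k})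
    (hp : p.1 ≠ (a, b)) : totInc a b k x p = 0 := by
  rw [totInc]
  split_ifs with h
  · exact Pi.single_eq_of_ne (M := fun p : {p : ℕ × ℕ // p.1 + p.2 = k} =>
      A p.1.1 ⊗[R] B p.1.2) (fun e => hp (congrArg Subtype.val e)) _
  · rfl

theorem rTensor_totInc (a b k : ℕ) (x : A (a + 1) ⊗[R] B b) (a' b' : ℕ) (h) (h') :
    (dA a').rTensor (B b') ((totInc (a + 1) b (k + 1) x : Tot A B (k + 1)) ⟨(a' + 1, b'), h⟩) =
      (totInc a b k ((dA a).rTensor (B b) x) : Tot A B k) ⟨(a', b'), h'⟩ := by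
  by_cases e : a' = a ∧ b' = b
  · obtain ⟨rfl, rfl⟩ := e
    rw [totInc_same, totInc_same]
  · rw [totInc_ne, totInc_ne, map_zero]
    · simpa using e
    · simpa using e

theorem lTensor_totInc (a b k : ℕ) (x : A a ⊗[R] B (b + 1)) (a' b' : ℕ) (h) (h') :
    (dB b').lTensor (A a') ((totInc a (b + 1) (k + 1) x : Tot A B (k + 1)) ⟨(a', b' + 1), h⟩) =
      (totInc a b k ((dB b).lTensor (A a) x) : Tot A B k) ⟨(a', b'), h'⟩ := by
  by_cases e : a' = a ∧ b' = b
  · obtain ⟨rfl, rfl⟩ := e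
    rw [totInc_same, totInc_same]
  · rw [totInc_ne, totInc_ne, map_zero]
    · simpa using e
    · simpa using e

/-- The element is supported in column `a`, so the sign attached to the position may be replaced by
a constant one. -/
theorem smul_totInc_apply (a b k : ℕ) (x : A a ⊗[R] B b) (a' b' : ℕ) (h) :
    (-1 : R) ^ a' • (totInc a b k x : Tot A B k) ⟨(a', b'), h⟩ =
      (-1 : R) ^ a • (totInc a b k x : Tot A B k) ⟨(a', b'), h⟩ := by
  by_cases e : a' = a
  · subst e
    rfl
  · rw [totInc_ne, smul_zero, smul_zero]
    simp [e]

theorem totD_totInc_succ_succ (a b k : ℕ) (x : A (a + 1) ⊗[R] B (b + 1)) :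
    totD dA dB k (totInc (a + 1) (b + 1) (k + 1) x) =
      totInc a (b + 1) k ((dA a).rTensor _ x) +
        (-1 : R) ^ (a + 1) • totInc (a + 1) b k ((dB b).lTensor _ x) := by
  refine funext fun ⟨⟨a', b'⟩, h⟩ => ?_
  rw [totD_apply, rTensor_totInc dA _ _ _ _ _ _ _ h, lTensor_totInc dB _ _ _ _ _ _ _ h,
    smul_totInc_apply]
  rfl

theorem totD_totInc_succ_zero (a k : ℕ) (x : A (a + 1) ⊗[R] B 0) :
    totD dA dB k (totInc (a + 1) 0 (k + 1) x) = totInc a 0 k ((dA a).rTensor _ x) := by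
  refine funext fun ⟨⟨a', b'⟩, h⟩ => ?_
  have e : (totInc (a + 1) 0 (k + 1) x : Tot A B (k + 1))
    ⟨(a', b' + 1), by dsimp only at h ⊢; omega⟩ = 0 := totInc_ne _ _ (by simp)
  rw [totD_apply, rTensor_totInc dA _ _ _ _ _ _ _ h, e, map_zero, smul_zero, add_zero]

theorem totD_totInc_zero_succ (b k : ℕ) (x : A 0 ⊗[R] B (b + 1)) :
    totD dA dB k (totInc 0 (b + 1) (k + 1) x) = totInc 0 b k ((dB b).lTensor _ x) := by
  refine funext fun ⟨⟨a', b'⟩, h⟩ => ?_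
  rw [totD_apply, lTensor_totInc dB _ _ _ _ _ _ _ h, totInc_ne, map_zero, zero_add,
    smul_totInc_apply]
  · simp
  · simp

theorem sum_totInc (k : ℕ) (t : Tot A B k) :
    ∑ p : {p : ℕ × ℕ // p ∈ Finset.HasAntidiagonal.antidiagonal k},
      totInc p.1.1 p.1.2 k (t ⟨p.1, Finset.HasAntidiagonal.mem_antidiagonal.1 p.2⟩) = t := by
  refine funext fun ⟨⟨a, b⟩, h⟩ => ?_
  rw [Finset.sum_apply, Finset.sum_eq_single ⟨(a, b), Finset.HasAntidiagonal.mem_antidiagonal.2 h⟩]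
  · exact totInc_same h _
  · intro p _ hp
    refine totInc_ne _ _ fun e => hp ?_
    exact Subtype.ext e.symm
  · intro h
    exact absurd (Finset.mem_univ _) h

variable {A₀ B₀ : ModuleCat.{0} R}
  (eA : A 0 →ₗ[R] A₀) (eB : B 0 →ₗ[R] B₀) (sA : A₀ →ₗ[R] A 0) (sB : B₀ →ₗ[R] B 0)
  (hA : ∀ n, A n →ₗ[R] A (n + 1)) (hB : ∀ n, B n →ₗ[R] B (n + 1))

theorem map_totD_zero (heA : eA ∘ₗ dA 0 = 0) (heB : eB ∘ₗ dB 0 = 0) (t : Tot A B (0 + 1)) :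
    TensorProduct.map eA eB (totD dA dB 0 t ⟨(0, 0), rfl⟩) = 0 := by
  rw [totD_apply, map_add, pow_zero, one_smul, ← LinearMap.comp_apply,
    LinearMap.map_comp_rTensor, heA, TensorProduct.map_zero_left, ← LinearMap.comp_apply,
    LinearMap.map_comp_lTensor, heB, TensorProduct.map_zero_right, LinearMap.zero_apply,
    LinearMap.zero_apply, add_zero]

/-- The contraction of the total complex built from contractions of the factors. -/
def totContraction (k : ℕ) (t : Tot A B k) : Tot A B (k + 1)
  | ⟨(a + 1, b), h⟩ => (hA a).rTensor (B b) (t ⟨(a, b), by dsimp only at h ⊢; omega⟩)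
  -- In column 0 one has `d h_A = 1 - s ε` instead of `d h + h d = 1`; the term `s ε ⊗ h_B` makes up
  -- for `s ε`.
  | ⟨(0, b + 1), h⟩ => TensorProduct.map (sA ∘ₗ eA) (hB b)
      (t ⟨(0, b), by dsimp only at h ⊢; omega⟩)
  | ⟨(0, 0), h⟩ => absurd h (by simp)

/-- On `A 0 ⊗ B 0` the identity is `d h ⊗ 1 + s ε ⊗ d h + s ε ⊗ s ε`, and the last term vanishes on
the kernel of the augmentation. -/
theorem totD_totContraction_zero (hdA : ∀ x, dA 0 (hA 0 x) + sA (eA x) = x)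
    (hdB : ∀ x, dB 0 (hB 0 x) + sB (eB x) = x)
    (t : Tot A B 0) (ht : TensorProduct.map eA eB (t ⟨(0, 0), rfl⟩) = 0) :
    totD dA dB 0 (totContraction eA sA hA hB 0 t) = t := by
  refine funext fun ⟨⟨a, b⟩, h⟩ => ?_
  obtain ⟨rfl, rfl⟩ : a = 0 ∧ b = 0 := by simpa using h
  rw [totD_apply]
  simp only [totContraction, pow_zero, one_smul]
  have key (x : A 0 ⊗[R] B 0) : (dA 0).rTensor (B 0) ((hA 0).rTensor (B 0) x) +
      (dB 0).lTensor (A 0) (TensorProduct.map (sA ∘ₗ eA) (hB 0) x) +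
      TensorProduct.map sA sB (TensorProduct.map eA eB x) = x := by
    induction x with
    | zero => simp
    | add x y hx hy =>
      simp only [map_add]
      conv_rhs => rw [← hx, ← hy]
      abel
    | tmul x y =>
      simp only [LinearMap.rTensor_tmul, TensorProduct.map_tmul, LinearMap.lTensor_tmul,
        LinearMap.comp_apply]
      rw [add_assoc, ← TensorProduct.tmul_add, hdB, ← TensorProduct.add_tmul, hdA]
  have := key (t ⟨(0, 0), rfl⟩)
  rw [ht, map_zero, add_zero] at this
  exact this

/-- In column `a + 1`, applying `h ⊗ 1` to the cycle equation in column `a` trades the vertical part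
of the differential for `h d ⊗ 1`, and `d h + h d = 1` concludes. In column 0, `s ε ⊗ h` plays this
role, and `ε d = 0` removes the horizontal part. -/
theorem totD_totContraction_succ (hdA : ∀ x, dA 0 (hA 0 x) + sA (eA x) = x)
    (heA : eA ∘ₗ dA 0 = 0)
    (hdA' : ∀ n x, dA (n + 1) (hA (n + 1) x) + hA n (dA n x) = x)
    (hdB' : ∀ n x, dB (n + 1) (hB (n + 1) x) + hB n (dB n x) = x) (k : ℕ)
    (t : Tot A B (k + 1)) (ht : totD dA dB k t = 0) :
    totD dA dB (k + 1) (totContraction eA sA hA hB (k + 1) t) = t := by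
  refine funext fun ⟨⟨a, b⟩, h⟩ => ?_
  rw [totD_apply]
  cases a with
  | succ a =>
    have h0 := congrFun ht ⟨(a, b), by dsimp only at h ⊢; omega⟩
    rw [totD_apply] at h0
    have h1 := congrArg ((hA a).rTensor (B b)) h0
    rw [Pi.zero_apply, map_zero, map_add, map_smul] at h1
    have h2 (x : A (a + 1) ⊗[R] B b) : (dA (a + 1)).rTensor (B b) ((hA (a + 1)).rTensor (B b) x) +
        (hA a).rTensor (B b) ((dA a).rTensor (B b) x) = x := by
      induction x with
      | zero => simp
      | add x y hx hy =>
        simp only [map_add]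
        conv_rhs => rw [← hx, ← hy]
        abel
      | tmul x y =>
        simp only [LinearMap.rTensor_tmul]
        rw [← TensorProduct.add_tmul, hdA']
    have h3 (x : A a ⊗[R] B (b + 1)) : (hA a).rTensor (B b) ((dB b).lTensor (A a) x) =
        (dB b).lTensor (A (a + 1)) ((hA a).rTensor (B (b + 1)) x) := by
      rw [← LinearMap.comp_apply, ← LinearMap.comp_apply, LinearMap.lTensor_comp_rTensor,
        LinearMap.rTensor_comp_lTensor]
    rw [h3] at h1
    have h4 := h2 (t ⟨(a + 1, b), h⟩)
    simp only [totContraction]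
    rw [pow_succ, mul_neg_one, neg_smul]
    rw [eq_neg_of_add_eq_zero_left h1] at h4
    exact h4
  | zero =>
    obtain ⟨rfl⟩ : b = k + 1 := by simpa using h
    have h0 := congrFun ht ⟨(0, k), by dsimp only; omega⟩
    rw [totD_apply] at h0
    have h1 := congrArg (TensorProduct.map (sA ∘ₗ eA) (hB k)) h0
    have h5 (x : A 1 ⊗[R] B k) :
        TensorProduct.map (sA ∘ₗ eA) (hB k) ((dA 0).rTensor (B k) x) = 0 := by
      rw [← LinearMap.comp_apply, LinearMap.map_comp_rTensor, LinearMap.comp_assoc, heA]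
      simp
    rw [Pi.zero_apply, map_zero, map_add, h5, zero_add, pow_zero, one_smul] at h1
    have key (x : A 0 ⊗[R] B (k + 1)) :
        (dA 0).rTensor (B (k + 1)) ((hA 0).rTensor (B (k + 1)) x) +
        (dB (k + 1)).lTensor (A 0) (TensorProduct.map (sA ∘ₗ eA) (hB (k + 1)) x) +
        TensorProduct.map (sA ∘ₗ eA) (hB k) ((dB k).lTensor (A 0) x) = x := by
      induction x with
      | zero => simp
      | add x y hx hy =>
        simp only [map_add]
        conv_rhs => rw [← hx, ← hy]
        abel
      | tmul x y =>
        simp only [LinearMap.rTensor_tmul, TensorProduct.map_tmul, LinearMap.lTensor_tmul,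
          LinearMap.comp_apply]
        rw [add_assoc, ← TensorProduct.tmul_add, hdB', ← TensorProduct.add_tmul, hdA]
    have h4 := key (t ⟨(0, k + 1), h⟩)
    rw [h1, add_zero] at h4
    simp only [totContraction, pow_zero, one_smul]
    exact h4

end Tot

/-! ### The bar resolution in two variables -/

/-- The functor `(G, H) ↦ ℤ[Gᵃ] ⊗ ℤ[Hᵇ]`. -/
abbrev boxBar (a b : ℕ) : FGr2 := barFun a ⊠ barFun b

theorem finsupp_tmul_ext {R α β M : Type*} [CommRing R] [AddCommGroup M] [Module R M]
    {f g : (α →₀ R) ⊗[R] (β →₀ R) →ₗ[R] M}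
    (h : ∀ a b, f (Finsupp.single a 1 ⊗ₜ Finsupp.single b 1) =
      g (Finsupp.single a 1 ⊗ₜ Finsupp.single b 1)) : f = g := by
  refine TensorProduct.ext (Finsupp.lhom_ext' fun a => LinearMap.ext_ring
    (Finsupp.lhom_ext' fun b => LinearMap.ext_ring ?_))
  exact h a b

/-- The linear map out of a tensor product of free modules with given values on the basis. -/
def finsuppTmulDesc {R α β M : Type*} [CommRing R] [AddCommGroup M] [Module R M]
    (v : α → β → M) : (α →₀ R) ⊗[R] (β →₀ R) →ₗ[R] M :=
  Finsupp.linearCombination R (fun p : α × β => v p.1 p.2) ∘ₗ (finsuppTensorFinsupp' R α β).toLinearMap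

theorem finsuppTmulDesc_single {R α β M : Type*} [CommRing R] [AddCommGroup M] [Module R M]
    (v : α → β → M) (a : α) (b : β) :
    finsuppTmulDesc (R := R) v (Finsupp.single a 1 ⊗ₜ Finsupp.single b 1) = v a b := by
  simp [finsuppTmulDesc]

theorem box_map_tmul {F G : FGr} {X Y X' Y' : Gr} (f : X ⟶ X') (g : Y ⟶ Y') (x : F.obj X)
    (y : G.obj Y) : ((F ⊠ G : FGr2).map (Prod.mkHom f g : (X, Y) ⟶ (X', Y'))).hom
      ((x ⊗ₜ[ℤ] y : F.obj X ⊗[ℤ] G.obj Y)) =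
      ((F.map f).hom x ⊗ₜ[ℤ] (G.map g).hom y : F.obj X' ⊗[ℤ] G.obj Y') := rfl

theorem box_hom_ext {a b : ℕ} {X : FGr2} {f g : boxBar a b ⟶ X}
    (h : ∀ (G H : Gr) (u : Fin a → G.obj) (v : Fin b → H.obj),
      (f.app (G, H)).hom (Finsupp.single u 1 ⊗ₜ Finsupp.single v 1 :
        BarChain G.obj a ⊗[ℤ] BarChain H.obj b) =
      (g.app (G, H)).hom (Finsupp.single u 1 ⊗ₜ Finsupp.single v 1 :
        BarChain G.obj a ⊗[ℤ] BarChain H.obj b)) : f = g := by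
  ext ⟨G, H⟩ : 3
  exact finsupp_tmul_ext (h G H)

/-- The components of `boxDesc`. -/
def boxDescApp {a b : ℕ} {X : FGr2} (x : X.obj (freeGr a, freeGr b)) (G H : Gr) :
    BarChain G.obj a ⊗[ℤ] BarChain H.obj b →ₗ[ℤ] X.obj (G, H) :=
  finsuppTmulDesc fun u v => (X.map (Prod.mkHom (freeGrLift u) (freeGrLift v) :
    (freeGr a, freeGr b) ⟶ (G, H))).hom x

theorem boxDescApp_single {a b : ℕ} {X : FGr2} (x : X.obj (freeGr a, freeGr b)) {G H : Gr}
    (u : Fin a → G.obj) (v : Fin b → H.obj) :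
    boxDescApp x G H (Finsupp.single u 1 ⊗ₜ Finsupp.single v 1) =
      (X.map (Prod.mkHom (freeGrLift u) (freeGrLift v) :
        (freeGr a, freeGr b) ⟶ (G, H))).hom x :=
  finsuppTmulDesc_single _ u v

theorem boxBar_map_single {a b : ℕ} {G H G' H' : Gr} (f : G ⟶ G') (g : H ⟶ H')
    (u : Fin a → G.obj) (v : Fin b → H.obj) :
    ((boxBar a b).map (Prod.mkHom f g : (G, H) ⟶ (G', H'))).hom
      (Finsupp.single u 1 ⊗ₜ Finsupp.single v 1 : BarChain G.obj a ⊗[ℤ] BarChain H.obj b) =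
    (Finsupp.single (f.hom.hom ∘ u) 1 ⊗ₜ Finsupp.single (g.hom.hom ∘ v) 1 :
      BarChain G'.obj a ⊗[ℤ] BarChain H'.obj b) := by
  change (Finsupp.mapDomain _ (Finsupp.single u 1) ⊗ₜ Finsupp.mapDomain _ (Finsupp.single v 1) :
    BarChain G'.obj a ⊗[ℤ] BarChain H'.obj b) = _
  rw [Finsupp.mapDomain_single, Finsupp.mapDomain_single]

/-- The natural transformation out of `boxBar a b` attached to an element. -/
def boxDesc {a b : ℕ} {X : FGr2} (x : X.obj (freeGr a, freeGr b)) : boxBar a b ⟶ X where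
  app P := ModuleCat.ofHom (boxDescApp x P.1 P.2)
  naturality := by
    rintro ⟨G, H⟩ ⟨G', H'⟩ ⟨f, g⟩
    ext1
    refine finsupp_tmul_ext fun u v => ?_
    refine (congrArg (boxDescApp x G' H') (boxBar_map_single f g u v)).trans ?_
    refine Eq.trans ?_ (congrArg (X.map (Prod.mkHom f g)).hom (boxDescApp_single x u v)).symm
    rw [boxDescApp_single, ← freeGrLift_comp, ← freeGrLift_comp]
    exact ConcreteCategory.congr_hom (X.map_comp
      (Prod.mkHom (freeGrLift u) (freeGrLift v) : (freeGr a, freeGr b) ⟶ (G, H))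
      (Prod.mkHom f g)) x

/-- The Yoneda isomorphism for `boxBar a b`. -/
def boxYoneda (a b : ℕ) (X : FGr2) : (boxBar a b ⟶ X) ≃+ X.obj (freeGr a, freeGr b) where
  toFun f := (f.app (freeGr a, freeGr b)).hom (barGen a ⊗ₜ[ℤ] barGen b :
    (barFun a).obj (freeGr a) ⊗[ℤ] (barFun b).obj (freeGr b))
  map_add' f g := rfl
  invFun x := boxDesc x
  left_inv f := by
    refine box_hom_ext fun G H u v => ?_
    refine (boxDescApp_single _ u v).trans ?_
    refine (ConcreteCategory.congr_hom (f.naturality (Prod.mkHom (freeGrLift u) (freeGrLift v) :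
      (freeGr a, freeGr b) ⟶ (G, H))) (barGen a ⊗ₜ[ℤ] barGen b :
      (barFun a).obj (freeGr a) ⊗[ℤ] (barFun b).obj (freeGr b))).symm.trans ?_
    refine congrArg (f.app (G, H)).hom ((box_map_tmul (F := barFun a) (G := barFun b) _ _ _ _).trans ?_)
    rw [barFun_map_barGen, barFun_map_barGen]
    rfl
  right_inv x := by
    refine (boxDescApp_single _ _ _).trans ?_
    rw [freeGrLift_of, freeGrLift_of]
    exact ConcreteCategory.congr_hom (X.map_id (freeGr a, freeGr b)) x

theorem boxYoneda_comp {a b : ℕ} {X Y : FGr2} (f : boxBar a b ⟶ X) (g : X ⟶ Y) :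
    boxYoneda a b Y (f ≫ g) = (g.app _).hom (boxYoneda a b X f) := rfl

/-- The tensor product of two linearised representables is the linearisation of the functor
represented by the pair of free groups, so the Yoneda argument applies again. -/
instance (a b : ℕ) : Projective (boxBar a b) where
  factors {E X} f e he := by
    obtain ⟨y, hy⟩ := (ModuleCat.epi_iff_surjective _).1
      ((NatTrans.epi_iff_epi_app e).1 he (freeGr a, freeGr b)) (boxYoneda a b X f)
    refine ⟨(boxYoneda a b E).symm y, (boxYoneda a b X).injective ?_⟩
    rw [boxYoneda_comp, AddEquiv.apply_symm_apply]
    exact hy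

end FreeGroupFunctors

end

noncomputable section

namespace FreeGroupFunctors

open Limits

/-! ### The total bar complex as a projective resolution of functors in two variables -/

theorem boxMap_app {F F' G G' : FGr} (φ : F ⟶ F') (ψ : G ⟶ G') (X Y : Gr) :
    ((boxMap φ ψ).app (X, Y)).hom = TensorProduct.map (φ.app X).hom (ψ.app Y).hom :=
  TensorProduct.ext' fun _ _ => rfl

theorem boxMap_comp {F F' F'' G G' G'' : FGr} (φ : F ⟶ F') (φ' : F' ⟶ F'') (ψ : G ⟶ G')
    (ψ' : G' ⟶ G'') : boxMap (φ ≫ φ') (ψ ≫ ψ') = boxMap φ ψ ≫ boxMap φ' ψ' := by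
  ext ⟨X, Y⟩ : 3
  exact TensorProduct.ext' fun _ _ => rfl

section TotMap

variable {R : Type} [CommRing R] {A B A' B' A'' B'' : ℕ → ModuleCat.{0} R}
  (f : ∀ n, A n →ₗ[R] A' n) (g : ∀ n, B n →ₗ[R] B' n)
  (f' : ∀ n, A' n →ₗ[R] A'' n) (g' : ∀ n, B' n →ₗ[R] B'' n)

/-- The map of total tensor products induced by maps of the factors. -/
def totMap (k : ℕ) : Tot A B k →ₗ[R] Tot A' B' k where
  toFun t p := TensorProduct.map (f p.1.1) (g p.1.2) (t p)
  map_add' s t := by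
    funext p
    simp only [Pi.add_apply, map_add]
  map_smul' c t := by
    funext p
    simp only [Pi.smul_apply, map_smul, RingHom.id_apply]

theorem totMap_id (k : ℕ) (t : Tot A B k) :
    totMap (fun _ => LinearMap.id) (fun _ => LinearMap.id) k t = t :=
  funext fun p => LinearMap.congr_fun TensorProduct.map_id (t p)

theorem totMap_comp (k : ℕ) (t : Tot A B k) :
    totMap (fun n => f' n ∘ₗ f n) (fun n => g' n ∘ₗ g n) k t = totMap f' g' k (totMap f g k t) :=
  funext fun p => LinearMap.congr_fun (TensorProduct.map_comp (f' _) (g' _) (f _) (g _)) (t p)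

theorem totMap_totInc (a b k : ℕ) (x : A a ⊗[R] B b) :
    totMap f g k (totInc a b k x) = totInc a b k (TensorProduct.map (f a) (g b) x) := by
  refine funext fun ⟨⟨a', b'⟩, h⟩ => ?_
  change TensorProduct.map (f a') (g b') (totInc a b k x ⟨(a', b'), h⟩) = _
  by_cases e : a' = a ∧ b' = b
  · obtain ⟨rfl, rfl⟩ := e
    rw [totInc_same, totInc_same]
  · rw [totInc_ne, totInc_ne, map_zero]
    · simpa using e
    · simpa using e

theorem totMap_totD {dA : ∀ n, A (n + 1) →ₗ[R] A n} {dB : ∀ n, B (n + 1) →ₗ[R] B n}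
    {dA' : ∀ n, A' (n + 1) →ₗ[R] A' n} {dB' : ∀ n, B' (n + 1) →ₗ[R] B' n}
    (hf : ∀ n, f n ∘ₗ dA n = dA' n ∘ₗ f (n + 1)) (hg : ∀ n, g n ∘ₗ dB n = dB' n ∘ₗ g (n + 1))
    (k : ℕ) (t : Tot A B (k + 1)) :
    totMap f g k (totD dA dB k t) = totD dA' dB' k (totMap f g (k + 1) t) := by
  refine funext fun ⟨⟨a, b⟩, h⟩ => ?_
  have h1 (x : A (a + 1) ⊗[R] B b) : TensorProduct.map (f a) (g b) ((dA a).rTensor (B b) x) =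
      (dA' a).rTensor (B' b) (TensorProduct.map (f (a + 1)) (g b) x) := by
    rw [← LinearMap.comp_apply, ← LinearMap.comp_apply, LinearMap.map_comp_rTensor,
      LinearMap.rTensor_comp_map, hf]
  have h2 (x : A a ⊗[R] B (b + 1)) : TensorProduct.map (f a) (g b) ((dB b).lTensor (A a) x) =
      (dB' b).lTensor (A' a) (TensorProduct.map (f a) (g (b + 1)) x) := by
    rw [← LinearMap.comp_apply, ← LinearMap.comp_apply, LinearMap.map_comp_lTensor,
      LinearMap.lTensor_comp_map, hg]
  refine (map_add (TensorProduct.map (f a) (g b)) _ _).trans ?_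
  rw [map_smul, h1, h2]
  rfl

end TotMap

theorem box_map_hom {F G : FGr} {P P' : Gr × Gr} (f : P ⟶ P') :
    ((F ⊠ G : FGr2).map f).hom = TensorProduct.map (F.map f.1).hom (G.map f.2).hom :=
  TensorProduct.ext' fun _ _ => rfl

/-- The values on a group of the functors in the bar resolution. -/
abbrev barObj (G : Gr) (n : ℕ) : AbCat := (barFun (n + 1)).obj G

/-- The map of bar complexes induced by a homomorphism. -/
abbrev barObjMap {G H : Gr} (f : G ⟶ H) (n : ℕ) : barObj G n →ₗ[ℤ] barObj H n :=
  ((barFun (n + 1)).map f).hom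

/-- The differential of the bar complex of a group. -/
abbrev barObjD (G : Gr) (n : ℕ) : barObj G (n + 1) →ₗ[ℤ] barObj G n :=
  ((barFunD (n + 1)).app G).hom

theorem barObjD_comp (G : Gr) (n : ℕ) : barObjD G n ∘ₗ barObjD G (n + 1) = 0 :=
  barD_comp_barD (n + 1)

theorem barObjMap_comp_barObjD {G H : Gr} (f : G ⟶ H) (n : ℕ) :
    barObjMap f n ∘ₗ barObjD G n = barObjD H n ∘ₗ barObjMap f (n + 1) :=
  congrArg ModuleCat.Hom.hom ((barFunD (n + 1)).naturality f).symm

theorem barObjMap_id (G : Gr) : barObjMap (𝟙 G) = fun _ => LinearMap.id :=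
  funext fun n => congrArg ModuleCat.Hom.hom ((barFun (n + 1)).map_id G)

theorem barObjMap_comp {G H K : Gr} (f : G ⟶ H) (g : H ⟶ K) :
    barObjMap (f ≫ g) = fun n => barObjMap g n ∘ₗ barObjMap f n :=
  funext fun n => congrArg ModuleCat.Hom.hom ((barFun (n + 1)).map_comp f g)

/-- The total complex of the external product of two bar complexes, in degree `k`. -/
def totFun (k : ℕ) : FGr2 where
  obj P := ModuleCat.of ℤ (Tot (barObj P.1) (barObj P.2) k)
  map f := ModuleCat.ofHom (totMap (barObjMap f.1) (barObjMap f.2) k)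
  map_id P := by
    ext1
    refine LinearMap.ext fun t => Eq.trans ?_ (totMap_id (A := barObj P.1) (B := barObj P.2) k t)
    rw [prod_id_fst, prod_id_snd, barObjMap_id, barObjMap_id]
    rfl
  map_comp {P P' P''} f g := by
    ext1
    refine LinearMap.ext fun t => Eq.trans ?_ (totMap_comp (barObjMap f.1) (barObjMap f.2)
      (barObjMap g.1) (barObjMap g.2) k t)
    rw [prod_comp_fst, prod_comp_snd, barObjMap_comp, barObjMap_comp]
    rfl

/-- The differential of the total complex. -/
def totFunD (k : ℕ) : totFun (k + 1) ⟶ totFun k where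
  app P := ModuleCat.ofHom (totD (barObjD P.1) (barObjD P.2) k)
  naturality P P' f := by
    ext1
    exact LinearMap.ext fun t => (totMap_totD (barObjMap f.1) (barObjMap f.2)
      (barObjMap_comp_barObjD f.1) (barObjMap_comp_barObjD f.2) k t).symm

theorem totFunD_comp (k : ℕ) : totFunD (k + 1) ≫ totFunD k = 0 := by
  ext P : 3
  exact totD_comp_totD (barObjD P.1) (barObjD P.2) (barObjD_comp P.1) (barObjD_comp P.2) k

/-- The inclusion of the summand of bidegree `(a, b)` of the total complex. -/
def totFunInc (a b k : ℕ) : boxBar (a + 1) (b + 1) ⟶ totFun k where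
  app P := ModuleCat.ofHom (totInc (A := barObj P.1) (B := barObj P.2) a b k)
  naturality P P' f := by
    ext1
    refine LinearMap.ext fun t => ?_
    refine Eq.trans ?_ (totMap_totInc (barObjMap f.1) (barObjMap f.2) a b k t).symm
    exact congrArg (totInc (A := barObj P'.1) (B := barObj P'.2) a b k)
      (LinearMap.congr_fun (box_map_hom (F := barFun (a + 1)) (G := barFun (b + 1)) f) t)

theorem totFunInc_eq_zero {a b k : ℕ} (h : a + b ≠ k) : totFunInc a b k = 0 := by
  ext P : 3
  exact dif_neg h

/-- The projection to the summand of bidegree `(a, b)` of the total complex. -/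
def totFunProj {a b k : ℕ} (h : a + b = k) : totFun k ⟶ boxBar (a + 1) (b + 1) where
  app P := ModuleCat.ofHom (LinearMap.proj (R := ℤ) (φ := fun p : {p : ℕ × ℕ // p.1 + p.2 = k} =>
    (barFun (p.1.1 + 1)).obj P.1 ⊗[ℤ] (barFun (p.1.2 + 1)).obj P.2) ⟨(a, b), h⟩)
  naturality P P' f := by
    ext1
    refine LinearMap.ext fun t => ?_
    exact (LinearMap.congr_fun (box_map_hom (F := barFun (a + 1)) (G := barFun (b + 1)) f)
      (t ⟨(a, b), h⟩)).symm

theorem sum_app_hom {ι : Type*} (s : Finset ι) {X Y : FGr2} (f : ι → (X ⟶ Y)) (P : Gr × Gr)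
    (x : X.obj P) : ((∑ i ∈ s, f i).app P).hom x = ∑ i ∈ s, ((f i).app P).hom x := by
  classical
  induction s using Finset.induction_on with
  | empty => rfl
  | insert i s hi h =>
    rw [Finset.sum_insert hi, Finset.sum_insert hi, ← h]
    rfl

/-- There are finitely many bidegrees, so the product that defines the total complex is a direct
sum. Projectivity and the description of maps out of it rest on this. -/
theorem sum_totFunProj_totFunInc (k : ℕ) :
    ∑ p : {p : ℕ × ℕ // p ∈ Finset.HasAntidiagonal.antidiagonal k},
      totFunProj (Finset.HasAntidiagonal.mem_antidiagonal.1 p.2) ≫ totFunInc p.1.1 p.1.2 k =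
        𝟙 (totFun k) := by
  ext P : 3
  refine LinearMap.ext fun t => ?_
  refine (sum_app_hom _ _ _ _).trans ?_
  exact sum_totInc (A := barObj P.1)
    (B := barObj P.2) k t

instance (k : ℕ) : Projective (totFun k) where
  factors {E X} f e he := by
    refine ⟨∑ p : {p : ℕ × ℕ // p ∈ Finset.HasAntidiagonal.antidiagonal k},
      totFunProj (Finset.HasAntidiagonal.mem_antidiagonal.1 p.2) ≫
        Projective.factorThru (totFunInc p.1.1 p.1.2 k ≫ f) e, ?_⟩
    rw [Preadditive.sum_comp]
    simp only [Category.assoc, Projective.factorThru_comp]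
    simp only [← Category.assoc, ← Preadditive.sum_comp]
    rw [sum_totFunProj_totFunInc, Category.id_comp]

theorem boxMap_id_right {F F' G : FGr} (φ : F ⟶ F') (X Y : Gr) :
    ((boxMap φ (𝟙 G)).app (X, Y)).hom = (φ.app X).hom.rTensor (G.obj Y) :=
  TensorProduct.ext' fun _ _ => rfl

theorem boxMap_id_left {F G G' : FGr} (ψ : G ⟶ G') (X Y : Gr) :
    ((boxMap (𝟙 F) ψ).app (X, Y)).hom = (ψ.app Y).hom.lTensor (F.obj X) :=
  TensorProduct.ext' fun _ _ => rfl

/-- The edges of the quadrant get separate formulas below, since one of the two partial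
differentials is missing there. -/
theorem totFunInc_succ_succ (a b k : ℕ) :
    totFunInc (a + 1) (b + 1) (k + 1) ≫ totFunD k =
      boxMap (barFunD (a + 1)) (𝟙 _) ≫ totFunInc a (b + 1) k +
        (-1 : ℤ) ^ (a + 1) • (boxMap (𝟙 _) (barFunD (b + 1)) ≫ totFunInc (a + 1) b k) := by
  ext ⟨G, H⟩ : 3
  refine LinearMap.ext fun t => ?_
  change totD (barObjD G) (barObjD H) k (totInc (a + 1) (b + 1) (k + 1) t) =
    totInc a (b + 1) k (((boxMap (barFunD (a + 1)) (𝟙 _)).app (G, H)).hom t) +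
      (-1 : ℤ) ^ (a + 1) • totInc (a + 1) b k (((boxMap (𝟙 _) (barFunD (b + 1))).app (G, H)).hom t)
  rw [boxMap_id_right, boxMap_id_left]
  exact totD_totInc_succ_succ (barObjD G) (barObjD H) a b k t

theorem totFunInc_succ_zero (a k : ℕ) :
    totFunInc (a + 1) 0 (k + 1) ≫ totFunD k =
      boxMap (barFunD (a + 1)) (𝟙 (barFun (0 + 1))) ≫ totFunInc a 0 k := by
  ext ⟨G, H⟩ : 3
  refine LinearMap.ext fun t => ?_
  change totD (barObjD G) (barObjD H) k (totInc (a + 1) 0 (k + 1) t) =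
    totInc (A := barObj G) (B := barObj H) a 0 k
      (((boxMap (barFunD (a + 1)) (𝟙 (barFun (0 + 1)))).app (G, H)).hom t)
  rw [boxMap_id_right]
  exact totD_totInc_succ_zero (barObjD G) (barObjD H) a k t

theorem totFunInc_zero_succ (b k : ℕ) :
    totFunInc 0 (b + 1) (k + 1) ≫ totFunD k =
      boxMap (𝟙 (barFun (0 + 1))) (barFunD (b + 1)) ≫ totFunInc 0 b k := by
  ext ⟨G, H⟩ : 3
  refine LinearMap.ext fun t => ?_
  change totD (barObjD G) (barObjD H) k (totInc 0 (b + 1) (k + 1) t) =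
    totInc (A := barObj G) (B := barObj H) 0 b k
      (((boxMap (𝟙 (barFun (0 + 1))) (barFunD (b + 1))).app (G, H)).hom t)
  rw [boxMap_id_left]
  exact totD_totInc_zero_succ (barObjD G) (barObjD H) b k t

/-- The total complex of the external product of two bar complexes. -/
def totComplex : ChainComplex FGr2 ℕ :=
  ChainComplex.of totFun totFunD totFunD_comp

theorem totComplex_d (k : ℕ) : totComplex.d (k + 1) k = totFunD k :=
  ChainComplex.of_d totFun totFunD k

/-- The augmentation of the total complex. -/
def totAug : totFun 0 ⟶ (abelianization ⊠ abelianization : FGr2) :=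
  totFunProj (a := 0) (b := 0) rfl ≫ boxMap barFunAug barFunAug

/-- The augmentation of the bar complex of a group. -/
abbrev barObjAug (G : Gr) : barObj G 0 →ₗ[ℤ] abelianization.obj G := (barFunAug.app G).hom

theorem barObjAug_comp (G : Gr) : barObjAug G ∘ₗ barObjD G 0 = 0 := barAug_comp_barD

/-- The section of the augmentation. -/
def barObjSec (G : Gr) : abelianization.obj G →ₗ[ℤ] barObj G 0 := (grFox G).augSec

/-- The contraction of the bar complex of a free group. -/
def barObjHomotopy (G : Gr) (n : ℕ) : barObj G n →ₗ[ℤ] barObj G (n + 1) := (grFox G).homotopy n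

theorem barObjAug_sec (G : Gr) (x : abelianization.obj G) : barObjAug G (barObjSec G x) = x :=
  (grFox G).barAug_augSec x

theorem barObjHomotopy_zero (G : Gr) (x : barObj G 0) :
    barObjD G 0 (barObjHomotopy G 0 x) + barObjSec G (barObjAug G x) = x :=
  (grFox G).homotopy_zero x

theorem barObjHomotopy_succ (G : Gr) (n : ℕ) (x : barObj G (n + 1)) :
    barObjD G (n + 1) (barObjHomotopy G (n + 1) x) + barObjHomotopy G n (barObjD G n x) = x :=
  (grFox G).homotopy_succ n x

theorem totAug_app (G H : Gr) (t : Tot (barObj G) (barObj H) 0) :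
    (totAug.app (G, H)).hom t =
      TensorProduct.map (barObjAug G) (barObjAug H) (t ⟨(0, 0), rfl⟩) :=
  LinearMap.congr_fun (boxMap_app barFunAug barFunAug G H) (t ⟨(0, 0), rfl⟩)

theorem totFunD_totAug : totFunD 0 ≫ totAug = 0 := by
  ext ⟨G, H⟩ : 3
  refine LinearMap.ext fun (t : Tot (barObj G) (barObj H) (0 + 1)) => ?_
  exact (totAug_app G H (totD (barObjD G) (barObjD H) 0 t)).trans
    (map_totD_zero (barObjD G) (barObjD H) (barObjAug G) (barObjAug H) (barObjAug_comp G)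
      (barObjAug_comp H) t)

theorem totAug_surjective (G H : Gr) : Function.Surjective (totAug.app (G, H)).hom := by
  intro x
  refine ⟨totInc (A := barObj G) (B := barObj H) 0 0 0
    (TensorProduct.map (barObjSec G) (barObjSec H) x), ?_⟩
  refine (totAug_app G H _).trans ?_
  rw [totInc_same, ← LinearMap.comp_apply, ← TensorProduct.map_comp]
  have h (G : Gr) : barObjAug G ∘ₗ barObjSec G = LinearMap.id :=
    LinearMap.ext (barObjAug_sec G)
  rw [h, h, TensorProduct.map_id]
  rfl

theorem totFunD_exact_zero (G H : Gr) (t : Tot (barObj G) (barObj H) 0)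
    (ht : (totAug.app (G, H)).hom t = 0) : ∃ y, ((totFunD 0).app (G, H)).hom y = t := by
  refine ⟨totContraction (barObjAug G) (barObjSec G) (barObjHomotopy G) (barObjHomotopy H) 0 t, ?_⟩
  rw [totAug_app] at ht
  exact totD_totContraction_zero (barObjD G) (barObjD H) (barObjAug G) (barObjAug H)
    (barObjSec G) (barObjSec H) (barObjHomotopy G) (barObjHomotopy H) (barObjHomotopy_zero G)
    (barObjHomotopy_zero H) t ht

theorem totFunD_exact_succ (n : ℕ) (G H : Gr) (t : Tot (barObj G) (barObj H) (n + 1))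
    (ht : ((totFunD n).app (G, H)).hom t = 0) :
    ∃ y, ((totFunD (n + 1)).app (G, H)).hom y = t :=
  ⟨totContraction (barObjAug G) (barObjSec G) (barObjHomotopy G) (barObjHomotopy H) (n + 1) t,
    totD_totContraction_succ (barObjD G) (barObjD H) (barObjAug G)
      (barObjSec G) (barObjHomotopy G) (barObjHomotopy H) (barObjHomotopy_zero G)
      (barObjAug_comp G) (barObjHomotopy_succ G) (barObjHomotopy_succ H) n t ht⟩

/-- The bar resolution of the external square of the abelianization functor. -/
def boxResolution : ProjectiveResolution (abelianization ⊠ abelianization : FGr2) :=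
  resolutionOfExact totComplex (fun n => inferInstanceAs (Projective (totFun n))) totAug
    (by
      rw [totComplex_d]
      exact totFunD_totAug)
    (fun P => totAug_surjective P.1 P.2)
    (fun P t ht => by
      rw [totComplex_d]
      exact totFunD_exact_zero P.1 P.2 t ht)
    (fun n P t ht => by
      rw [totComplex_d] at ht ⊢
      exact totFunD_exact_succ n P.1 P.2 t ht)

end FreeGroupFunctors

end

noncomputable section

namespace FreeGroupFunctors

/-! ### The algebraic Künneth formula for cochain complexes -/

section Kunneth

variable {R : Type} [CommRing R]

/-- The differential of a cochain complex of modules, as a linear map. -/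
abbrev cd (C : CochainComplex (ModuleCat.{1} R) ℕ) (i j : ℕ) : C.X i →ₗ[R] C.X j := (C.d i j).hom

theorem cd_cd (C : CochainComplex (ModuleCat.{1} R) ℕ) (i j k : ℕ) (x : C.X i) :
    cd C j k (cd C i j x) = 0 :=
  LinearMap.congr_fun (congrArg ModuleCat.Hom.hom (C.d_comp_d i j k)) x

theorem cd_comp_cd (C : CochainComplex (ModuleCat.{1} R) ℕ) (i j k : ℕ) :
    cd C j k ∘ₗ cd C i j = 0 :=
  congrArg ModuleCat.Hom.hom (C.d_comp_d i j k)

theorem cd_zero (C : CochainComplex (ModuleCat.{1} R) ℕ) : cd C 0 0 = 0 :=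
  congrArg ModuleCat.Hom.hom (C.shape 0 0 (by simp))

/-- The cocycles of degree `n`. -/
abbrev cocyc (C : CochainComplex (ModuleCat.{1} R) ℕ) (n : ℕ) : Submodule R (C.X n) :=
  LinearMap.ker (cd C n (n + 1))

/-- The coboundaries of degree `n`. -/
abbrev cobd (C : CochainComplex (ModuleCat.{1} R) ℕ) (n : ℕ) : Submodule R (C.X n) :=
  -- For `n = 0` truncated subtraction gives `cd C 0 0`, which is zero by `cd_zero`, so there are no
  -- nonzero coboundaries.
  LinearMap.range (cd C (n - 1) n)

/-- The differential with values in the coboundaries. -/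
abbrev toCobd (C : CochainComplex (ModuleCat.{1} R) ℕ) (n : ℕ) : C.X (n - 1) →ₗ[R] cobd C n :=
  (cd C (n - 1) n).rangeRestrict

theorem cobd_le_cocyc (C : CochainComplex (ModuleCat.{1} R) ℕ) (n : ℕ) : cobd C n ≤ cocyc C n := by
  rintro _ ⟨x, rfl⟩
  exact cd_cd C _ _ _ x

/-- The inclusion of coboundaries in cocycles. -/
abbrev cobdIncl (C : CochainComplex (ModuleCat.{1} R) ℕ) (n : ℕ) : cobd C n →ₗ[R] cocyc C n :=
  Submodule.inclusion (cobd_le_cocyc C n)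

/-- A presentation of the cohomology of `C` in degree `n` as a quotient of the cocycles. -/
structure CohomologyPresentation (C : CochainComplex (ModuleCat.{1} R) ℕ) (n : ℕ)
    (H : ModuleCat.{1} R) where
  π : cocyc C n →ₗ[R] H
  surjective : Function.Surjective π
  ker : ∀ x, π x = 0 ↔ (x : C.X n) ∈ cobd C n

variable (C D : CochainComplex (ModuleCat.{1} R) ℕ)

/-- Families of elements of the tensor products `C a ⊗ D b`. -/
abbrev Fam : Type 1 := ∀ a b : ℕ, C.X a ⊗[R] D.X b

/-- The differential on families. -/
def famD : Fam C D →ₗ[R] Fam C D where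
  toFun t a b := (cd C (a - 1) a).rTensor (D.X b) (t (a - 1) b) +
    (-1 : R) ^ a • (cd D (b - 1) b).lTensor (C.X a) (t a (b - 1))
  map_add' s t := by
    funext a b
    simp only [Pi.add_apply, map_add, smul_add]
    abel
  map_smul' c t := by
    funext a b
    simp only [Pi.smul_apply, map_smul, smul_add, RingHom.id_apply]
    rw [smul_comm c]

theorem famD_apply (t : Fam C D) (a b : ℕ) :
    famD C D t a b = (cd C (a - 1) a).rTensor (D.X b) (t (a - 1) b) +
      (-1 : R) ^ a • (cd D (b - 1) b).lTensor (C.X a) (t a (b - 1)) := rfl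

/-- The cocycles of total degree `k`. -/
def famCocyc (k : ℕ) : Submodule R (Fam C D) where
  carrier := {t | (∀ a b, a + b ≠ k → t a b = 0) ∧ famD C D t = 0}
  add_mem' := by
    rintro s t ⟨hs, hs'⟩ ⟨ht, ht'⟩
    refine ⟨fun a b h => ?_, by rw [map_add, hs', ht', add_zero]⟩
    rw [Pi.add_apply, Pi.add_apply, hs a b h, ht a b h, add_zero]
  zero_mem' := ⟨fun _ _ _ => rfl, map_zero _⟩
  smul_mem' := by
    rintro c t ⟨ht, ht'⟩
    refine ⟨fun a b h => ?_, by rw [map_smul, ht', smul_zero]⟩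
    rw [Pi.smul_apply, Pi.smul_apply, ht a b h, smul_zero]

/-- A presentation of the cohomology of `C ⊗ D` in degree `k` as a quotient of the cocycles. -/
structure FamPresentation (k : ℕ) (H : ModuleCat.{1} R) where
  π : famCocyc C D k →ₗ[R] H
  surjective : Function.Surjective π
  -- The support condition puts `y` in total degree `k - 1`, and forces `y = 0` when `k = 0`.
  ker : ∀ x, π x = 0 ↔ ∃ y : Fam C D, (∀ a b, a + b + 1 ≠ k → y a b = 0) ∧ famD C D y = x

variable {C D}

/-- The family concentrated in one bidegree. -/
def famInc (a b : ℕ) : C.X a ⊗[R] D.X b →ₗ[R] Fam C D :=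
  LinearMap.single R (fun a => ∀ b, C.X a ⊗[R] D.X b) a ∘ₗ
    LinearMap.single R (fun b => C.X a ⊗[R] D.X b) b

theorem famInc_same (a b : ℕ) (x : C.X a ⊗[R] D.X b) : famInc a b x a b = x := by
  simp [famInc]

theorem famInc_ne {a b a' b' : ℕ} (x : C.X a ⊗[R] D.X b) (h : ¬(a' = a ∧ b' = b)) :
    famInc a b x a' b' = 0 := by
  by_cases e : a' = a
  · subst e
    simp [famInc, Pi.single_eq_of_ne (fun e => h ⟨rfl, e⟩)]
  · simp [famInc, Pi.single_eq_of_ne e]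

theorem famD_famInc (a b : ℕ) (x : C.X a ⊗[R] D.X b) :
    famD C D (famInc a b x) = famInc (a + 1) b ((cd C a (a + 1)).rTensor _ x) +
      (-1 : R) ^ a • famInc a (b + 1) ((cd D b (b + 1)).lTensor _ x) := by
  funext a' b'
  rw [famD_apply, Pi.add_apply, Pi.add_apply, Pi.smul_apply, Pi.smul_apply]
  congr 1
  · cases a' with
    | zero =>
      rw [Nat.zero_sub, cd_zero, LinearMap.rTensor_zero, LinearMap.zero_apply,
        famInc_ne _ (by simp)]
    | succ a' =>
      rw [Nat.add_sub_cancel]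
      by_cases h : a' = a ∧ b' = b
      · obtain ⟨rfl, rfl⟩ := h
        rw [famInc_same, famInc_same]
      · rw [famInc_ne _ h, famInc_ne _ (by simpa using h), map_zero]
  · cases b' with
    | zero =>
      rw [Nat.zero_sub, cd_zero, LinearMap.lTensor_zero, LinearMap.zero_apply,
        famInc_ne _ (by simp), smul_zero, smul_zero]
    | succ b' =>
      rw [Nat.add_sub_cancel]
      by_cases h : a' = a ∧ b' = b
      · obtain ⟨rfl, rfl⟩ := h
        rw [famInc_same, famInc_same]
      · rw [famInc_ne _ h, famInc_ne _ (by simpa using h), map_zero, smul_zero, smul_zero]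

theorem famInc_supp {a b k : ℕ} (h : a + b = k) (x : C.X a ⊗[R] D.X b) (a' b' : ℕ)
    (h' : a' + b' ≠ k) : famInc a b x a' b' = 0 :=
  famInc_ne x (by omega)

/-- The cross product of cocycles. -/
def crossCocyc {a b k : ℕ} (h : a + b = k) : cocyc C a ⊗[R] cocyc D b →ₗ[R] famCocyc C D k :=
  (famInc a b ∘ₗ TensorProduct.map (cocyc C a).subtype (cocyc D b).subtype).codRestrict _ (by
    intro x
    refine ⟨famInc_supp h _, ?_⟩
    have h₁ : (cd C a (a + 1)).rTensor (D.X b)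
        (TensorProduct.map (cocyc C a).subtype (cocyc D b).subtype x) = 0 := by
      rw [← LinearMap.comp_apply, LinearMap.rTensor_comp_map, LinearMap.comp_ker_subtype,
        TensorProduct.map_zero_left, LinearMap.zero_apply]
    have h₂ : (cd D b (b + 1)).lTensor (C.X a)
        (TensorProduct.map (cocyc C a).subtype (cocyc D b).subtype x) = 0 := by
      rw [← LinearMap.comp_apply, LinearMap.lTensor_comp_map, LinearMap.comp_ker_subtype,
        TensorProduct.map_zero_right, LinearMap.zero_apply]
    rw [LinearMap.comp_apply, famD_famInc, h₁, h₂, map_zero, map_zero, smul_zero, add_zero])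

theorem crossCocyc_coe {a b k : ℕ} (h : a + b = k) (x : cocyc C a ⊗[R] cocyc D b) :
    (crossCocyc h x : Fam C D) =
      famInc a b (TensorProduct.map (cocyc C a).subtype (cocyc D b).subtype x) := rfl

/-- Descent of a linear map along a surjective linear map. -/
def descend {P H N : Type*} [AddCommGroup P] [Module R P] [AddCommGroup H] [Module R H]
    [AddCommGroup N] [Module R N] (π : P →ₗ[R] H) (hπ : Function.Surjective π) (f : P →ₗ[R] N)
    (hf : ∀ x, π x = 0 → f x = 0) : H →ₗ[R] N :=
  (LinearMap.ker π).liftQ f (fun x hx => hf x hx) ∘ₗ (π.quotKerEquivOfSurjective hπ).symm.toLinearMap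

theorem descend_apply {P H N : Type*} [AddCommGroup P] [Module R P] [AddCommGroup H] [Module R H]
    [AddCommGroup N] [Module R N] (π : P →ₗ[R] H) (hπ : Function.Surjective π) (f : P →ₗ[R] N)
    (hf : ∀ x, π x = 0 → f x = 0) (x : P) : descend π hπ f hf (π x) = f x := by
  have h : (π.quotKerEquivOfSurjective hπ).symm (π x) = Submodule.Quotient.mk x := by
    rw [LinearEquiv.symm_apply_eq]
    rfl
  exact congrArg ((LinearMap.ker π).liftQ f (fun x hx => hf x hx)) h

/-- A splitting of the differentials of a cochain complex. -/
structure Splitting (C : CochainComplex (ModuleCat.{1} R) ℕ) where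
  s : ∀ n, cobd C n →ₗ[R] C.X (n - 1)
  toCobd_s : ∀ n, toCobd C n ∘ₗ s n = LinearMap.id

namespace Splitting

variable (S : Splitting C)

/-- The retraction onto the cocycles defined by a splitting. -/
def ρ (n : ℕ) : C.X n →ₗ[R] cocyc C n :=
  -- The result is closed because `d ∘ s` is the identity on coboundaries.
  (LinearMap.id - S.s (n + 1) ∘ₗ toCobd C (n + 1)).codRestrict _ (by
    intro x
    have h := congrArg Subtype.val (LinearMap.congr_fun (S.toCobd_s (n + 1)) (toCobd C (n + 1) x))
    rw [LinearMap.mem_ker, LinearMap.sub_apply, map_sub, sub_eq_zero]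
    exact h.symm)

theorem subtype_ρ (n : ℕ) : (cocyc C n).subtype ∘ₗ S.ρ n =
    LinearMap.id - S.s (n + 1) ∘ₗ toCobd C (n + 1) := rfl

theorem ρ_subtype (n : ℕ) : S.ρ n ∘ₗ (cocyc C n).subtype = LinearMap.id := by
  refine LinearMap.ext fun x => Subtype.ext ?_
  have h : toCobd C (n + 1) (x : C.X n) = 0 := Subtype.ext x.2
  exact sub_eq_self.2 ((congrArg (S.s (n + 1)) h).trans (map_zero _))

end Splitting

end Kunneth

end FreeGroupFunctors

end

noncomputable section

namespace FreeGroupFunctors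

section Kunneth

variable {R : Type} [CommRing R]

/-! ### The cross product and the connecting map for split complexes -/

theorem cobd_zero_eq_zero (C : CochainComplex (ModuleCat.{1} R) ℕ) (c : cobd C 0) : c = 0 := by
  obtain ⟨_, x, rfl⟩ := c
  exact Subtype.ext (LinearMap.congr_fun (cd_zero C) x)

theorem toCobd_comp_cd (C : CochainComplex (ModuleCat.{1} R) ℕ) (n : ℕ) :
    toCobd C n ∘ₗ cd C (n - 1 - 1) (n - 1) = 0 :=
  LinearMap.ext fun x => Subtype.ext (cd_cd C _ _ _ x)

/-- The differential with values in the coboundaries of positive degree. -/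
def succToCobd (C : CochainComplex (ModuleCat.{1} R) ℕ) (n : ℕ) :
    C.X n →ₗ[R] cobd C (n + 1) := toCobd C (n + 1)

theorem succToCobd_comp_subtype (C : CochainComplex (ModuleCat.{1} R) ℕ) (n : ℕ) :
    succToCobd C n ∘ₗ (cocyc C n).subtype = 0 :=
  LinearMap.ext fun x => Subtype.ext x.2

/-- A cochain complex with split differentials and flat terms, together with presentations of its
cohomology. -/
structure SplitComplex (R : Type) [CommRing R] where
  C : CochainComplex (ModuleCat.{1} R) ℕ
  H : ℕ → ModuleCat.{1} R
  S : Splitting C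
  pres : ∀ n, CohomologyPresentation C n (H n)
  flat : ∀ n, Module.Flat R (C.X n)
  flat_cobd : ∀ n, Module.Flat R (cobd C n)

namespace SplitComplex

variable (X Y : SplitComplex R)

/-- The projection of a cocycle to cohomology. -/
abbrev π (n : ℕ) : cocyc X.C n →ₗ[R] X.H n := (X.pres n).π

theorem π_surjective (n : ℕ) : Function.Surjective (X.π n) := (X.pres n).surjective

/-- The extension of the projection to all cochains that is defined by the splitting. -/
def r (n : ℕ) : X.C.X n →ₗ[R] X.H n := X.π n ∘ₗ X.S.ρ n

theorem r_comp_subtype (n : ℕ) : X.r n ∘ₗ (cocyc X.C n).subtype = X.π n := by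
  rw [r, LinearMap.comp_assoc, X.S.ρ_subtype, LinearMap.comp_id]

/-- Thus `r` is a chain map to the cohomology with zero differential. This makes the cochain
formulas for the retraction and the connecting map vanish on coboundaries of the tensor product. -/
theorem r_comp_cd (n : ℕ) : X.r n ∘ₗ cd X.C (n - 1) n = 0 := by
  refine LinearMap.ext fun x => ?_
  have h := LinearMap.congr_fun (X.r_comp_subtype n)
    ⟨cd X.C (n - 1) n x, cobd_le_cocyc X.C n ⟨x, rfl⟩⟩
  exact h.trans (((X.pres n).ker _).2 ⟨x, rfl⟩)

theorem exact_cobdIncl (n : ℕ) : Function.Exact (cobdIncl X.C n) (X.π n) := fun x =>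
  ((X.pres n).ker x).trans
    ⟨fun h => ⟨⟨x, h⟩, rfl⟩, by rintro ⟨y, rfl⟩; exact y.2⟩

theorem exact_cobdIncl_toCobd (n : ℕ) :
    Function.Exact (cobdIncl X.C n ∘ₗ toCobd X.C n) (X.π n) := fun x =>
  ((X.pres n).ker x).trans
    ⟨fun ⟨y, h⟩ => ⟨y, Subtype.ext h⟩, by rintro ⟨y, rfl⟩; exact ⟨y, rfl⟩⟩

/-- The projection to cocycles fixes elements on which the differential vanishes, after tensoring
on the right with a flat module. -/
theorem rTensor_ρ (n : ℕ) (M : Type 1) [AddCommGroup M] [Module R M] [Module.Flat R M]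
    (x : X.C.X n ⊗[R] M) (hx : (cd X.C n (n + 1)).rTensor M x = 0) :
    ((cocyc X.C n).subtype ∘ₗ X.S.ρ n).rTensor M x = x := by
  have h : (toCobd X.C (n + 1)).rTensor M x = 0 := by
    apply Module.Flat.rTensor_preserves_injective_linearMap (M := M) (cobd X.C (n + 1)).subtype
      Subtype.val_injective
    rw [map_zero, ← LinearMap.comp_apply, ← LinearMap.rTensor_comp]
    exact hx
  rw [X.S.subtype_ρ, LinearMap.rTensor_sub, LinearMap.rTensor_comp, LinearMap.sub_apply,
    LinearMap.comp_apply]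
  exact sub_eq_of_eq_add ((LinearMap.rTensor_id_apply _ _ _).trans
    (by rw [h, map_zero, add_zero]))

theorem lTensor_ρ (n : ℕ) (M : Type 1) [AddCommGroup M] [Module R M] [Module.Flat R M]
    (x : M ⊗[R] X.C.X n) (hx : (cd X.C n (n + 1)).lTensor M x = 0) :
    ((cocyc X.C n).subtype ∘ₗ X.S.ρ n).lTensor M x = x := by
  have h : (toCobd X.C (n + 1)).lTensor M x = 0 := by
    apply Module.Flat.lTensor_preserves_injective_linearMap (M := M) (cobd X.C (n + 1)).subtype
      Subtype.val_injective
    rw [map_zero, ← LinearMap.comp_apply, ← LinearMap.lTensor_comp]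
    exact hx
  rw [X.S.subtype_ρ, LinearMap.lTensor_sub, LinearMap.lTensor_comp, LinearMap.sub_apply,
    LinearMap.comp_apply]
  exact sub_eq_of_eq_add ((LinearMap.lTensor_id_apply _ _ _).trans
    (by rw [h, map_zero, add_zero]))

end SplitComplex

variable {X Y : SplitComplex R} {k : ℕ} {HT : ModuleCat.{1} R}
  (P : FamPresentation X.C Y.C k HT)

/-- For a cocycle `z`, the total differential of `x ⊗ z` is `dx ⊗ z`. -/
theorem cross_rTensor_eq_zero {a b : ℕ} (h : a + b = k) :
    P.π ∘ₗ crossCocyc h ∘ₗ (cobdIncl X.C a).rTensor (cocyc Y.C b) = 0 := by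
  refine TensorProduct.ext' fun c z => (P.ker _).2 ?_
  cases a with
  | zero =>
    refine ⟨0, fun _ _ _ => rfl, ?_⟩
    rw [cobd_zero_eq_zero X.C c, TensorProduct.zero_tmul, map_zero, map_zero]
    rfl
  | succ a =>
    obtain ⟨_, x, rfl⟩ := c
    refine ⟨famInc a b (x ⊗ₜ (z : Y.C.X b)), fun a' b' h' =>
      famInc_supp (k := a + b) rfl _ _ _ (by omega), ?_⟩
    have hz : cd Y.C b (b + 1) z = 0 := z.2
    rw [famD_famInc, LinearMap.lTensor_tmul, hz, TensorProduct.tmul_zero, map_zero, smul_zero,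
      add_zero]
    rfl

theorem cross_lTensor_eq_zero {a b : ℕ} (h : a + b = k) :
    P.π ∘ₗ crossCocyc h ∘ₗ (cobdIncl Y.C b).lTensor (cocyc X.C a) = 0 := by
  refine TensorProduct.ext' fun z c => (P.ker _).2 ?_
  cases b with
  | zero =>
    refine ⟨0, fun _ _ _ => rfl, ?_⟩
    rw [cobd_zero_eq_zero Y.C c, TensorProduct.tmul_zero, map_zero, map_zero]
    rfl
  | succ b =>
    obtain ⟨_, x, rfl⟩ := c
    -- The factor cancels the sign of the second partial differential in column `a`.
    refine ⟨(-1 : R) ^ a • famInc a b ((z : X.C.X a) ⊗ₜ x), fun a' b' h' => ?_, ?_⟩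
    · rw [Pi.smul_apply, Pi.smul_apply, famInc_supp (k := a + b) rfl _ _ _ (by omega), smul_zero]
    have hz : cd X.C a (a + 1) z = 0 := z.2
    rw [map_smul, famD_famInc, LinearMap.rTensor_tmul, hz, TensorProduct.zero_tmul, map_zero,
      zero_add, smul_smul, ← mul_pow, neg_mul_neg, one_mul, one_pow, one_smul]
    rfl

/-- The cross product in cohomology. -/
def kunnethCross {a b : ℕ} (h : a + b = k) : X.H a ⊗[R] Y.H b →ₗ[R] HT :=
  descend (TensorProduct.map (X.π a) (Y.π b))
    (TensorProduct.map_surjective (X.π_surjective a) (Y.π_surjective b)) (P.π ∘ₗ crossCocyc h) (by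
      intro x hx
      -- By right exactness, the kernel of `Z ⊗ Z → H ⊗ H` is generated by the images of `Z ⊗ B` and
      -- `B ⊗ Z`.
      rw [← LinearMap.mem_ker, TensorProduct.map_ker (X.exact_cobdIncl a) (X.π_surjective a)
        (Y.exact_cobdIncl b) (Y.π_surjective b)] at hx
      obtain ⟨_, ⟨y, rfl⟩, _, ⟨z, rfl⟩, rfl⟩ := Submodule.mem_sup.1 hx
      rw [map_add]
      exact (congrArg₂ (· + ·) (LinearMap.congr_fun (cross_lTensor_eq_zero P h) y)
        (LinearMap.congr_fun (cross_rTensor_eq_zero P h) z)).trans (add_zero _))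

theorem kunnethCross_apply {a b : ℕ} (h : a + b = k) (x : cocyc X.C a ⊗[R] cocyc Y.C b) :
    kunnethCross P h (TensorProduct.map (X.π a) (Y.π b) x) = P.π (crossCocyc h x) :=
  descend_apply _ _ _ _ x

/-- A left inverse of the cross product, defined by splittings. -/
def kunnethRetract (a b : ℕ) : HT →ₗ[R] X.H a ⊗[R] Y.H b :=
  descend P.π P.surjective
    (TensorProduct.map (X.r a) (Y.r b) ∘ₗ LinearMap.proj b ∘ₗ LinearMap.proj a ∘ₗ
      (famCocyc X.C Y.C k).subtype) (by
    intro x hx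
    obtain ⟨y, -, hy⟩ := (P.ker x).1 hx
    change TensorProduct.map (X.r a) (Y.r b) ((x : Fam X.C Y.C) a b) = 0
    rw [← hy, famD_apply, map_add, map_smul, ← LinearMap.comp_apply, LinearMap.map_comp_rTensor,
      X.r_comp_cd, ← LinearMap.comp_apply, LinearMap.map_comp_lTensor, Y.r_comp_cd,
      TensorProduct.map_zero_left, TensorProduct.map_zero_right, LinearMap.zero_apply,
      LinearMap.zero_apply, smul_zero, add_zero])

theorem kunnethRetract_apply (a b : ℕ) (t : famCocyc X.C Y.C k) :
    kunnethRetract P a b (P.π t) = TensorProduct.map (X.r a) (Y.r b) ((t : Fam X.C Y.C) a b) :=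
  descend_apply _ _ _ _ t

/-- The map `r` restricts to the projection on cocycles. The retraction depends on the splittings
and serves only for injectivity; no naturality is claimed for it. -/
theorem kunnethRetract_cross_same {a b : ℕ} (h : a + b = k) (x : X.H a ⊗[R] Y.H b) :
    kunnethRetract P a b (kunnethCross P h x) = x := by
  obtain ⟨x, rfl⟩ := TensorProduct.map_surjective (X.π_surjective a) (Y.π_surjective b) x
  rw [kunnethCross_apply, kunnethRetract_apply, crossCocyc_coe, famInc_same,
    ← LinearMap.comp_apply, ← TensorProduct.map_comp, X.r_comp_subtype, Y.r_comp_subtype]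

theorem kunnethRetract_cross_ne {a b a' b' : ℕ} (h : a + b = k) (h' : ¬(a' = a ∧ b' = b))
    (x : X.H a ⊗[R] Y.H b) : kunnethRetract P a' b' (kunnethCross P h x) = 0 := by
  obtain ⟨x, rfl⟩ := TensorProduct.map_surjective (X.π_surjective a) (Y.π_surjective b) x
  rw [kunnethCross_apply, kunnethRetract_apply, crossCocyc_coe, famInc_ne _ h', map_zero]

/-- The connecting map of the Künneth sequence. -/
def kunnethTor (a b : ℕ) : HT →ₗ[R] X.H a ⊗[R] cobd Y.C b :=
  descend P.π P.surjective
    -- The differential raises the second degree, so bidegree `(a, b - 1)` of total degree `k`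
    -- contributes to the pair with `a + b = k + 1`. For `b = 0` the target is zero.
    (TensorProduct.map (X.r a) (toCobd Y.C b) ∘ₗ LinearMap.proj (b - 1) ∘ₗ LinearMap.proj a ∘ₗ
      (famCocyc X.C Y.C k).subtype) (by
    intro x hx
    obtain ⟨y, -, hy⟩ := (P.ker x).1 hx
    change TensorProduct.map (X.r a) (toCobd Y.C b) ((x : Fam X.C Y.C) a (b - 1)) = 0
    rw [← hy, famD_apply, map_add, map_smul, ← LinearMap.comp_apply, LinearMap.map_comp_rTensor,
      X.r_comp_cd, ← LinearMap.comp_apply, LinearMap.map_comp_lTensor, toCobd_comp_cd,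
      TensorProduct.map_zero_left, TensorProduct.map_zero_right, LinearMap.zero_apply,
      LinearMap.zero_apply, smul_zero, add_zero])

theorem kunnethTor_apply (a b : ℕ) (t : famCocyc X.C Y.C k) :
    kunnethTor P a b (P.π t) =
      TensorProduct.map (X.r a) (toCobd Y.C b) ((t : Fam X.C Y.C) a (b - 1)) :=
  descend_apply _ _ _ _ t

theorem kunnethTor_apply_succ (a b : ℕ) (t : famCocyc X.C Y.C k) :
    kunnethTor P a (b + 1) (P.π t) =
      TensorProduct.map (X.r a) (succToCobd Y.C b) ((t : Fam X.C Y.C) a b) :=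
  kunnethTor_apply P a (b + 1) t

theorem kunnethTor_cross {a b : ℕ} (h : a + b = k) (a' b' : ℕ) (h' : a' + b' = k + 1)
    (x : X.H a ⊗[R] Y.H b) : kunnethTor P a' b' (kunnethCross P h x) = 0 := by
  obtain ⟨x, rfl⟩ := TensorProduct.map_surjective (X.π_surjective a) (Y.π_surjective b) x
  cases b' with
  | zero =>
    rw [kunnethCross_apply, kunnethTor_apply, crossCocyc_coe, famInc_ne _ (by omega), map_zero]
  | succ b' =>
    rw [kunnethCross_apply, kunnethTor_apply_succ, crossCocyc_coe]
    by_cases e : a' = a ∧ b' = b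
    · obtain ⟨rfl, rfl⟩ := e
      rw [famInc_same, ← LinearMap.comp_apply, ← TensorProduct.map_comp, succToCobd_comp_subtype, TensorProduct.map_zero_right, LinearMap.zero_apply]
    · rw [famInc_ne _ e, map_zero]

/-- Apply `r ⊗ ρ` to the component `(a, b)` of the cocycle equation: `r` kills the first partial
differential, and the second becomes, up to sign, the image in `H ⊗ Z`. The kernel in question will
be `Tor_1`. -/
theorem kunnethTor_mem_ker (a b : ℕ) (x : HT) :
    (cobdIncl Y.C b).lTensor (X.H a) (kunnethTor P a b x) = 0 := by
  obtain ⟨t, rfl⟩ := P.surjective x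
  have e : cobdIncl Y.C b ∘ₗ toCobd Y.C b = Y.S.ρ b ∘ₗ cd Y.C (b - 1) b := by
    refine LinearMap.ext fun y => ?_
    exact (LinearMap.congr_fun (Y.S.ρ_subtype b)
      ((cobdIncl Y.C b ∘ₗ toCobd Y.C b) y)).symm
  have h := congrFun (congrFun t.2.2 a) b
  rw [famD_apply] at h
  have h₁ := congrArg (TensorProduct.map (X.r a) (Y.S.ρ b)) h
  rw [map_add, map_smul, ← LinearMap.comp_apply, LinearMap.map_comp_rTensor, X.r_comp_cd,
    TensorProduct.map_zero_left, LinearMap.zero_apply, zero_add, ← LinearMap.comp_apply,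
    LinearMap.map_comp_lTensor, ← e] at h₁
  have h₂ := congrArg (fun z => (-1 : R) ^ a • z) h₁
  simp only [smul_smul, ← mul_pow, neg_mul_neg, one_mul, one_pow, one_smul] at h₂
  rw [kunnethTor_apply, ← LinearMap.comp_apply, LinearMap.lTensor_comp_map, h₂]
  exact (congrArg _ (map_zero _)).trans (smul_zero _)

/-- The element of `Z ⊗ B` that represents the image under the connecting map. -/
theorem subtype_rTensor_ρ (t : famCocyc X.C Y.C k) (a b : ℕ) :
    (cocyc X.C a).subtype.rTensor (cobd Y.C b)
      (TensorProduct.map (X.S.ρ a) (toCobd Y.C b) ((t : Fam X.C Y.C) a (b - 1))) =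
      (toCobd Y.C b).lTensor (X.C.X a) ((t : Fam X.C Y.C) a (b - 1)) := by
  have := Y.flat_cobd b
  have h := X.rTensor_ρ a (cobd Y.C b)
    ((toCobd Y.C b).lTensor (X.C.X a) ((t : Fam X.C Y.C) a (b - 1))) (by
      -- Applying `1 ⊗ d` to this component of the cocycle equation shows that `(1 ⊗ d) t` is closed
      -- in the first variable; as the coboundaries of `Y` are flat, it then lies in `Z ⊗ B`.
      have h := congrFun (congrFun t.2.2 (a + 1)) (b - 1)
      rw [famD_apply] at h
      have h₁ := congrArg ((toCobd Y.C b).lTensor (X.C.X (a + 1))) h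
      rw [map_add, map_smul, ← LinearMap.comp_apply, ← LinearMap.comp_apply,
        ← LinearMap.lTensor_comp, toCobd_comp_cd, LinearMap.lTensor_zero, LinearMap.zero_apply,
        smul_zero, add_zero, LinearMap.lTensor_comp_rTensor, ← LinearMap.rTensor_comp_lTensor] at h₁
      exact h₁)
  rw [← LinearMap.comp_apply, LinearMap.rTensor_comp_map]
  rw [← LinearMap.comp_apply, LinearMap.rTensor_comp_lTensor] at h
  exact h

/-- The connecting map can be computed from any lift `u` to `Z ⊗ B`, hence without reference to the
splitting of `X`. -/
theorem kunnethTor_eq {a b : ℕ} (t : famCocyc X.C Y.C k) (u : cocyc X.C a ⊗[R] cobd Y.C b)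
    (hu : (cocyc X.C a).subtype.rTensor (cobd Y.C b) u =
      (toCobd Y.C b).lTensor (X.C.X a) ((t : Fam X.C Y.C) a (b - 1))) :
    kunnethTor P a b (P.π t) = (X.π a).rTensor (cobd Y.C b) u := by
  rw [kunnethTor_apply, ← X.r_comp_subtype, LinearMap.rTensor_comp, LinearMap.comp_apply, hu,
    ← LinearMap.comp_apply, LinearMap.rTensor_comp_lTensor]

end Kunneth

end FreeGroupFunctors

end

noncomputable section

namespace FreeGroupFunctors

section Kunneth

variable {R : Type} [CommRing R] {X Y : SplitComplex R} {k : ℕ} {HT : ModuleCat.{1} R}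
  (P : FamPresentation X.C Y.C k HT)

/-! ### Exactness of the Künneth sequence in the middle and on the right -/

theorem succToCobd_comp_s (b : ℕ) : cd Y.C b (b + 1) ∘ₗ (Y.S.s (b + 1) : _ →ₗ[R] Y.C.X b) =
    (cobd Y.C (b + 1)).subtype :=
  congrArg ((cobd Y.C (b + 1)).subtype ∘ₗ ·) (Y.S.toCobd_s (b + 1))

/-- The cochain is `w` itself, seen in bidegree `(a - 1, b)`. Its second factors are closed, so it
is invisible to the connecting map; it is the correction term for surjectivity. -/
theorem exists_famD_eq (a b : ℕ) (h : a + b = k + 1) (w : X.C.X (a - 1) ⊗[R] cocyc Y.C b) :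
    ∃ t : Fam X.C Y.C, (∀ a' b', a' + b' ≠ k → t a' b' = 0) ∧
      famD X.C Y.C t = famInc a b (TensorProduct.map (cocyc X.C a).subtype (cocyc Y.C b).subtype
        ((cobdIncl X.C a ∘ₗ toCobd X.C a).rTensor _ w)) ∧
      ∀ a' b', TensorProduct.map (X.r a') (succToCobd Y.C b') (t a' b') = 0 := by
  cases a with
  | zero =>
    refine ⟨0, fun _ _ _ => rfl, ?_, fun _ _ => map_zero _⟩
    have e : cobdIncl X.C 0 ∘ₗ toCobd X.C 0 = 0 := by
      refine LinearMap.ext fun x => ?_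
      rw [LinearMap.comp_apply, cobd_zero_eq_zero X.C (toCobd X.C 0 x), map_zero,
        LinearMap.zero_apply]
    rw [e, LinearMap.rTensor_zero, LinearMap.zero_apply, map_zero, map_zero, map_zero]
  | succ a =>
    let w' : X.C.X a ⊗[R] cocyc Y.C b := w
    refine ⟨famInc a b ((cocyc Y.C b).subtype.lTensor (X.C.X a) w'),
      famInc_supp (by omega) _, ?_, fun a' b' => ?_⟩
    · have h₁ : (cd Y.C b (b + 1)).lTensor (X.C.X a)
          ((cocyc Y.C b).subtype.lTensor (X.C.X a) w') = 0 := by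
        rw [← LinearMap.comp_apply, ← LinearMap.lTensor_comp, LinearMap.comp_ker_subtype,
          LinearMap.lTensor_zero, LinearMap.zero_apply]
      rw [famD_famInc, h₁, map_zero, smul_zero, add_zero]
      refine congrArg (famInc (a + 1) b) ?_
      exact (LinearMap.congr_fun (LinearMap.rTensor_comp_lTensor _ (cd X.C a (a + 1))
        (cocyc Y.C b).subtype) w').trans (LinearMap.congr_fun (LinearMap.map_comp_rTensor _
          (cocyc X.C (a + 1)).subtype (cocyc Y.C b).subtype
          (cobdIncl X.C (a + 1) ∘ₗ toCobd X.C (a + 1))) w).symm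
    · by_cases e : a' = a ∧ b' = b
      · obtain ⟨rfl, rfl⟩ := e
        rw [famInc_same, ← LinearMap.comp_apply, LinearMap.map_comp_lTensor,
          succToCobd_comp_subtype, TensorProduct.map_zero_right, LinearMap.zero_apply]
      · rw [famInc_ne _ e, map_zero]

/-- Lift `v` to `u` in `Z ⊗ B`. By hypothesis and right exactness, the image of `u` in `Z ⊗ Z` is a
boundary in the first variable. Up to sign, this image is the total differential of `(1 ⊗ s) u`, so
subtracting the correction term leaves a cocycle, with the same image as `(1 ⊗ s) u`. -/
theorem kunnethTor_surjective (a b : ℕ) (h : a + b = k + 1) (v : X.H a ⊗[R] cobd Y.C b)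
    (hv : (cobdIncl Y.C b).lTensor (X.H a) v = 0) :
    ∃ x : HT, kunnethTor P a b x = v ∧
      ∀ a' b', a' + b' = k + 1 → ¬(a' = a ∧ b' = b) → kunnethTor P a' b' x = 0 := by
  cases b with
  | zero =>
    refine ⟨0, ?_, fun _ _ _ _ => map_zero _⟩
    rw [map_zero]
    have e : (LinearMap.id : cobd Y.C 0 →ₗ[R] cobd Y.C 0) = 0 :=
      LinearMap.ext fun c => cobd_zero_eq_zero Y.C c
    have := LinearMap.congr_fun (congrArg (LinearMap.lTensor (X.H a)) e) v
    rw [LinearMap.lTensor_id, LinearMap.lTensor_zero] at this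
    exact this.symm
  | succ b =>
    obtain ⟨u, rfl⟩ := LinearMap.rTensor_surjective (cobd Y.C (b + 1)) (X.π_surjective a) v
    rw [← LinearMap.comp_apply, LinearMap.lTensor_comp_rTensor, ← LinearMap.rTensor_comp_lTensor,
      LinearMap.comp_apply] at hv
    obtain ⟨w, hw⟩ := (rTensor_exact (cocyc Y.C (b + 1)) (X.exact_cobdIncl_toCobd a)
      (X.π_surjective a) _).1 hv
    obtain ⟨t, ht, ht', ht''⟩ := exists_famD_eq (k := k) a (b + 1) h w
    let s : cobd Y.C (b + 1) →ₗ[R] Y.C.X b := Y.S.s (b + 1)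
    have hs : cd Y.C b (b + 1) ∘ₗ s = (cobd Y.C (b + 1)).subtype := succToCobd_comp_s b
    have hs' : succToCobd Y.C b ∘ₗ s = LinearMap.id := Y.S.toCobd_s (b + 1)
    let t₀ : X.C.X a ⊗[R] Y.C.X b := TensorProduct.map (cocyc X.C a).subtype s u
    have h₁ : (cd X.C a (a + 1)).rTensor (Y.C.X b) t₀ = 0 := by
      rw [← LinearMap.comp_apply, LinearMap.rTensor_comp_map, LinearMap.comp_ker_subtype,
        TensorProduct.map_zero_left, LinearMap.zero_apply]
    have h₂ : (cd Y.C b (b + 1)).lTensor (X.C.X a) t₀ =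
        TensorProduct.map (cocyc X.C a).subtype (cocyc Y.C (b + 1)).subtype
          ((cobdIncl Y.C (b + 1)).lTensor _ u) := by
      rw [← LinearMap.comp_apply, LinearMap.lTensor_comp_map, hs, ← LinearMap.comp_apply,
        LinearMap.map_comp_lTensor]
      rfl
    let T : famCocyc X.C Y.C k := ⟨famInc a b t₀ - (-1 : R) ^ a • t, by
      refine ⟨fun a' b' h' => ?_, ?_⟩
      · rw [Pi.sub_apply, Pi.sub_apply, Pi.smul_apply, Pi.smul_apply, ht a' b' h',
          famInc_supp (k := k) (by omega) _ _ _ h', smul_zero, sub_zero]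
      · rw [map_sub, map_smul, ht', famD_famInc, h₁, h₂, hw, map_zero, zero_add, sub_self]⟩
    have hT : ∀ a' b', TensorProduct.map (X.r a') (succToCobd Y.C b') ((T : Fam X.C Y.C) a' b') =
        TensorProduct.map (X.r a') (succToCobd Y.C b') (famInc a b t₀ a' b') := fun a' b' => by
      change TensorProduct.map (X.r a') (succToCobd Y.C b')
        (famInc a b t₀ a' b' - (-1 : R) ^ a • t a' b') = _
      rw [map_sub, map_smul, ht'', smul_zero, sub_zero]
    refine ⟨P.π T, ?_, fun a' b' h' hne => ?_⟩
    · rw [kunnethTor_apply_succ, hT, famInc_same, ← LinearMap.comp_apply,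
        ← TensorProduct.map_comp, X.r_comp_subtype, hs']
      rfl
    · cases b' with
      | zero =>
        rw [kunnethTor_apply, T.2.1 _ _ (by omega), map_zero]
      | succ b' =>
        rw [kunnethTor_apply_succ, hT, famInc_ne _ (by omega), map_zero]

theorem eq_sum_famInc {C D : CochainComplex (ModuleCat.{1} R) ℕ} (t : Fam C D)
    (ht : ∀ a b, a + b ≠ k → t a b = 0) :
    t = ∑ p ∈ Finset.HasAntidiagonal.antidiagonal k, famInc p.1 p.2 (t p.1 p.2) := by
  funext a b
  rw [Finset.sum_apply, Finset.sum_apply]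
  by_cases h : a + b = k
  · rw [Finset.sum_eq_single (a, b), famInc_same]
    · rintro ⟨a', b'⟩ - hne
      exact famInc_ne _ (by rintro ⟨rfl, rfl⟩; exact hne rfl)
    · intro h'
      exact absurd (Finset.HasAntidiagonal.mem_antidiagonal.2 h) h'
  · rw [ht a b h, Finset.sum_eq_zero]
    intro p hp
    exact famInc_supp (Finset.HasAntidiagonal.mem_antidiagonal.1 hp) _ _ _ h

/-- The representative of `(1 ⊗ d) t` in `Z ⊗ B` dies in `H ⊗ B`, so by right exactness it comes
from `C^(a-1) ⊗ B`; its second factor is then lifted along the surjection `d`. -/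
theorem exists_lTensor_eq (t : famCocyc X.C Y.C k) (a b : ℕ)
    (ht : kunnethTor P a (b + 1) (P.π t) = 0) :
    ∃ y : X.C.X (a - 1) ⊗[R] Y.C.X b,
      (succToCobd Y.C b).lTensor _ ((t : Fam X.C Y.C) a b) =
        (succToCobd Y.C b).lTensor _ ((cd X.C (a - 1) a).rTensor _ y) := by
  rw [kunnethTor_eq P t _ (subtype_rTensor_ρ t _ _)] at ht
  obtain ⟨w, hw⟩ := (rTensor_exact (cobd Y.C (b + 1)) (X.exact_cobdIncl_toCobd a)
      (X.π_surjective a) _).1 ht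
  have hu := subtype_rTensor_ρ t a (b + 1)
  rw [← hw] at hu
  obtain ⟨y, hy⟩ := LinearMap.lTensor_surjective (X.C.X (a - 1)) (g := succToCobd Y.C b)
    (LinearMap.surjective_rangeRestrict _) w
  refine ⟨y, hu.symm.trans ?_⟩
  rw [← hy, ← LinearMap.comp_apply, ← LinearMap.rTensor_comp]
  exact (LinearMap.congr_fun (LinearMap.rTensor_comp_lTensor _ (cd X.C (a - 1) a)
    (succToCobd Y.C b)) y).trans (LinearMap.congr_fun (LinearMap.lTensor_comp_rTensor _
      (cd X.C (a - 1) a) (succToCobd Y.C b)) y).symm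

theorem famD_supp {C D : CochainComplex (ModuleCat.{1} R) ℕ} {z : Fam C D}
    (hz : ∀ a b, a + b + 1 ≠ k → z a b = 0) (a b : ℕ) (h : a + b ≠ k) : famD C D z a b = 0 := by
  have h₁ : (cd C (a - 1) a).rTensor (D.X b) (z (a - 1) b) = 0 := by
    cases a with
    | zero => rw [Nat.zero_sub, cd_zero, LinearMap.rTensor_zero, LinearMap.zero_apply]
    | succ a => rw [hz _ _ (by omega), map_zero]
  have h₂ : (cd D (b - 1) b).lTensor (C.X a) (z a (b - 1)) = 0 := by
    cases b with
    | zero => rw [Nat.zero_sub, cd_zero, LinearMap.lTensor_zero, LinearMap.zero_apply]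
    | succ b => rw [hz _ _ (by omega), map_zero]
  rw [famD_apply, h₁, h₂, smul_zero, add_zero]

theorem famD_famD {C D : CochainComplex (ModuleCat.{1} R) ℕ} (z : Fam C D) :
    famD C D (famD C D z) = 0 := by
  funext a b
  have h₁ : ∀ a b (x : C.X (a - 1 - 1) ⊗[R] D.X b), (cd C (a - 1) a).rTensor (D.X b)
      ((cd C (a - 1 - 1) (a - 1)).rTensor (D.X b) x) = 0 := fun a b x => by
    rw [← LinearMap.comp_apply, ← LinearMap.rTensor_comp, cd_comp_cd, LinearMap.rTensor_zero,
      LinearMap.zero_apply]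
  have h₂ : ∀ a b (x : C.X a ⊗[R] D.X (b - 1 - 1)), (cd D (b - 1) b).lTensor (C.X a)
      ((cd D (b - 1 - 1) (b - 1)).lTensor (C.X a) x) = 0 := fun a b x => by
    rw [← LinearMap.comp_apply, ← LinearMap.lTensor_comp, cd_comp_cd, LinearMap.lTensor_zero,
      LinearMap.zero_apply]
  rw [famD_apply, famD_apply, famD_apply, map_add, map_add, map_smul, map_smul, h₁, h₂, zero_add,
    smul_zero, add_zero, ← LinearMap.comp_apply, ← LinearMap.comp_apply,
    LinearMap.rTensor_comp_lTensor, LinearMap.lTensor_comp_rTensor, ← add_smul]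
  cases a with
  | zero =>
    rw [Nat.zero_sub, cd_zero, TensorProduct.map_zero_left, LinearMap.zero_apply, smul_zero]
    rfl
  | succ a =>
    rw [Nat.add_sub_cancel, pow_succ, mul_neg_one, add_neg_cancel, zero_smul]
    rfl

theorem exists_lTensor_eq_zero (t : famCocyc X.C Y.C k)
    (ht : ∀ a b, a + b = k + 1 → kunnethTor P a b (P.π t) = 0) :
    ∃ t' : famCocyc X.C Y.C k, P.π t' = P.π t ∧
      ∀ a b, (cd Y.C b (b + 1)).lTensor (X.C.X a) ((t' : Fam X.C Y.C) a b) = 0 := by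
  classical
  have h : ∀ a b, a + b + 1 = k → ∃ y : X.C.X a ⊗[R] Y.C.X b,
      (succToCobd Y.C b).lTensor _ ((t : Fam X.C Y.C) (a + 1) b) =
        (succToCobd Y.C b).lTensor _ ((cd X.C a (a + 1)).rTensor _ y) := fun a b hab =>
    exists_lTensor_eq P t (a + 1) b (ht _ _ (by omega))
  choose! y hy using h
  -- Subtracting the total differential of `z` changes `(1 ⊗ d) t` only by `(1 ⊗ d)(d ⊗ 1) z`, since
  -- `d ∘ d = 0` in the second factor.
  let z : Fam X.C Y.C := fun a b => if a + b + 1 = k then y a b else 0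
  have hz : ∀ a b, a + b + 1 ≠ k → z a b = 0 := fun a b h => if_neg h
  let T : famCocyc X.C Y.C k := ⟨t - famD X.C Y.C z, fun a b hab => by
    rw [Pi.sub_apply, Pi.sub_apply, t.2.1 a b hab, famD_supp hz a b hab, sub_zero],
    by rw [map_sub, famD_famD, t.2.2, sub_zero]⟩
  refine ⟨T, ?_, fun a b => ?_⟩
  · have : P.π (t - T) = 0 := (P.ker _).2 ⟨z, hz, by
      change _ = (t : Fam X.C Y.C) - (t - famD X.C Y.C z)
      rw [sub_sub_cancel]⟩
    rw [map_sub, sub_eq_zero] at this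
    exact this.symm
  by_cases hab : a + b = k
  · suffices h : (succToCobd Y.C b).lTensor (X.C.X a) ((T : Fam X.C Y.C) a b) = 0 by
      have := congrArg ((cobd Y.C (b + 1)).subtype.lTensor (X.C.X a)) h
      rw [← LinearMap.comp_apply, ← LinearMap.lTensor_comp, map_zero] at this
      exact this
    have e : succToCobd Y.C b ∘ₗ cd Y.C (b - 1) b = 0 :=
      LinearMap.ext fun x => Subtype.ext (cd_cd Y.C _ _ _ x)
    change (succToCobd Y.C b).lTensor (X.C.X a) ((t : Fam X.C Y.C) a b - famD X.C Y.C z a b) = 0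
    rw [famD_apply, map_sub, map_add, map_smul, ← LinearMap.comp_apply (LinearMap.lTensor _ _)
      (LinearMap.lTensor _ _), ← LinearMap.lTensor_comp, e, LinearMap.lTensor_zero,
      LinearMap.zero_apply, smul_zero, add_zero]
    cases a with
    | zero =>
      rw [Nat.zero_sub, cd_zero, LinearMap.rTensor_zero, LinearMap.zero_apply, map_zero, sub_zero]
      -- In column 0 no correction is available, but none is needed: the incoming differential is
      -- zero, so `(1 ⊗ d) t` already vanishes.
      obtain ⟨x, hx⟩ := exists_lTensor_eq P t 0 b (ht _ _ (by omega))
      rw [hx, show cd X.C (0 - 1) 0 = 0 from cd_zero X.C, LinearMap.rTensor_zero, LinearMap.zero_apply, map_zero]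
    | succ a =>
      have e' : z a b = y a b := if_pos (by omega)
      rw [hy a b (by omega), ← e']
      exact sub_self _
  · rw [T.2.1 a b hab, map_zero]

/-- Once `(1 ⊗ d) t = 0`, the cocycle equation gives `(d ⊗ 1) t = 0` as well. By flatness, `ρ ⊗ ρ`
fixes each component, so `t` is a sum of cross products of cocycles. -/
theorem kunneth_exact (x : HT) (hx : ∀ a b, a + b = k + 1 → kunnethTor P a b x = 0)
    (N : Submodule R HT) (hN : ∀ a b (h : a + b = k) z, kunnethCross P h z ∈ N) : x ∈ N := by
  obtain ⟨t, rfl⟩ := P.surjective x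
  obtain ⟨t, ht, h₂⟩ := exists_lTensor_eq_zero P t hx
  rw [← ht]
  have h₁ : ∀ a b, (cd X.C a (a + 1)).rTensor (Y.C.X b) ((t : Fam X.C Y.C) a b) = 0 := by
    intro a b
    have h := congrFun (congrFun t.2.2 (a + 1)) b
    rw [famD_apply] at h
    cases b with
    | zero =>
      rw [Nat.zero_sub, cd_zero, LinearMap.lTensor_zero, LinearMap.zero_apply, smul_zero,
        add_zero] at h
      exact h
    | succ b =>
      exact (add_eq_left.2 ((congrArg _ (h₂ (a + 1) b)).trans (smul_zero _))).symm.trans h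
  have e : t = ∑ p : {p // p ∈ Finset.HasAntidiagonal.antidiagonal k},
      crossCocyc (C := X.C) (D := Y.C) (Finset.HasAntidiagonal.mem_antidiagonal.1 p.2)
        (TensorProduct.map (X.S.ρ p.1.1) (Y.S.ρ p.1.2) ((t : Fam X.C Y.C) p.1.1 p.1.2)) := by
    refine Subtype.ext ((eq_sum_famInc (t : Fam X.C Y.C) t.2.1).trans ?_)
    rw [AddSubmonoidClass.coe_finsetSum, ← Finset.sum_coe_sort]
    refine Finset.sum_congr rfl fun p _ => ?_
    rw [crossCocyc_coe]
    congr 1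
    have := X.flat p.1.1
    have := Y.flat p.1.2
    have e₁ := X.rTensor_ρ p.1.1 (Y.C.X p.1.2) _ (h₁ p.1.1 p.1.2)
    have e₂ := Y.lTensor_ρ p.1.2 (X.C.X p.1.1) _ (h₂ p.1.1 p.1.2)
    rw [← LinearMap.comp_apply, ← TensorProduct.map_comp]
    exact (e₁.symm.trans (congrArg _ e₂.symm)).trans
      (LinearMap.congr_fun (LinearMap.rTensor_comp_lTensor _ _ _) _)
  rw [e, map_sum]
  refine N.sum_mem fun p _ => ?_
  rw [← kunnethCross_apply]
  exact hN _ _ _ _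

end Kunneth

end FreeGroupFunctors

end

noncomputable section

namespace FreeGroupFunctors

section Kunneth

variable {R : Type} [CommRing R]

/-! ### Naturality of the cross product and of the connecting map -/

theorem map_cd {C C' : CochainComplex (ModuleCat.{1} R) ℕ} (f : C ⟶ C') (i j : ℕ) (x : C.X i) :
    (f.f j).hom (cd C i j x) = cd C' i j ((f.f i).hom x) :=
  (LinearMap.congr_fun (congrArg ModuleCat.Hom.hom (f.comm i j)) x).symm

/-- The map induced on cocycles. -/
def cocycMap {C C' : CochainComplex (ModuleCat.{1} R) ℕ} (f : C ⟶ C') (n : ℕ) :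
    cocyc C n →ₗ[R] cocyc C' n :=
  (f.f n).hom.restrict fun x hx => by
    rw [LinearMap.mem_ker] at hx ⊢
    rw [← map_cd, hx, map_zero]

/-- The map induced on coboundaries. -/
def cobdMap {C C' : CochainComplex (ModuleCat.{1} R) ℕ} (f : C ⟶ C') (n : ℕ) :
    cobd C n →ₗ[R] cobd C' n :=
  (f.f n).hom.restrict (by
    rintro _ ⟨y, rfl⟩
    exact ⟨(f.f (n - 1)).hom y, (map_cd f _ _ y).symm⟩)

theorem toCobd_comp_map {C C' : CochainComplex (ModuleCat.{1} R) ℕ} (f : C ⟶ C') (n : ℕ) :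
    toCobd C' n ∘ₗ (f.f (n - 1)).hom = cobdMap f n ∘ₗ toCobd C n :=
  LinearMap.ext fun x => Subtype.ext (map_cd f _ _ x).symm

/-- The map induced on families. -/
def famMap {C C' D D' : CochainComplex (ModuleCat.{1} R) ℕ} (f : C ⟶ C') (g : D ⟶ D') :
    Fam C D →ₗ[R] Fam C' D' :=
  LinearMap.pi fun a => LinearMap.pi fun b =>
    TensorProduct.map (f.f a).hom (g.f b).hom ∘ₗ LinearMap.proj b ∘ₗ LinearMap.proj a

theorem famMap_apply {C C' D D' : CochainComplex (ModuleCat.{1} R) ℕ} (f : C ⟶ C') (g : D ⟶ D')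
    (t : Fam C D) (a b : ℕ) :
    famMap f g t a b = TensorProduct.map (f.f a).hom (g.f b).hom (t a b) := rfl

theorem famMap_famInc {C C' D D' : CochainComplex (ModuleCat.{1} R) ℕ} (f : C ⟶ C') (g : D ⟶ D')
    (a b : ℕ) (x : C.X a ⊗[R] D.X b) :
    famMap f g (famInc a b x) = famInc a b (TensorProduct.map (f.f a).hom (g.f b).hom x) := by
  funext a' b'
  rw [famMap_apply]
  by_cases e : a' = a ∧ b' = b
  · obtain ⟨rfl, rfl⟩ := e
    rw [famInc_same, famInc_same]
  · rw [famInc_ne _ e, famInc_ne _ e, map_zero]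

theorem famD_famMap {C C' D D' : CochainComplex (ModuleCat.{1} R) ℕ} (f : C ⟶ C') (g : D ⟶ D')
    (t : Fam C D) : famD C' D' (famMap f g t) = famMap f g (famD C D t) := by
  funext a b
  have hf : cd C' (a - 1) a ∘ₗ (f.f (a - 1)).hom = (f.f a).hom ∘ₗ cd C (a - 1) a :=
    LinearMap.ext fun x => (map_cd f _ _ x).symm
  have hg : cd D' (b - 1) b ∘ₗ (g.f (b - 1)).hom = (g.f b).hom ∘ₗ cd D (b - 1) b :=
    LinearMap.ext fun x => (map_cd g _ _ x).symm
  rw [famMap_apply, famD_apply, famD_apply, map_add, map_smul, famMap_apply, famMap_apply,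
    ← LinearMap.comp_apply, ← LinearMap.comp_apply, ← LinearMap.comp_apply (TensorProduct.map _ _),
    ← LinearMap.comp_apply (TensorProduct.map _ _), LinearMap.rTensor_comp_map,
    LinearMap.lTensor_comp_map, LinearMap.map_comp_rTensor, LinearMap.map_comp_lTensor, hf, hg]

/-- The map induced on cocycles of the tensor product. -/
def famCocycMap {C C' D D' : CochainComplex (ModuleCat.{1} R) ℕ} (f : C ⟶ C') (g : D ⟶ D')
    (k : ℕ) : famCocyc C D k →ₗ[R] famCocyc C' D' k :=
  (famMap f g).restrict fun t ht => ⟨fun a b h => by rw [famMap_apply, ht.1 a b h, map_zero], by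
    rw [famD_famMap, ht.2, map_zero]⟩

variable {X Y X' Y' : SplitComplex R} {k : ℕ} {HT HT' : ModuleCat.{1} R}
  (P : FamPresentation X.C Y.C k HT) (P' : FamPresentation X'.C Y'.C k HT')

theorem kunnethCross_natural (f : X.C ⟶ X'.C) (g : Y.C ⟶ Y'.C) (hT : HT →ₗ[R] HT')
    (h : ∀ t, hT (P.π t) = P'.π (famCocycMap f g k t)) {a b : ℕ} (hab : a + b = k)
    (hX : X.H a →ₗ[R] X'.H a) (hY : Y.H b →ₗ[R] Y'.H b)
    (hf : hX ∘ₗ X.π a = X'.π a ∘ₗ cocycMap f a) (hg : hY ∘ₗ Y.π b = Y'.π b ∘ₗ cocycMap g b)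
    (z : X.H a ⊗[R] Y.H b) :
    hT (kunnethCross P hab z) = kunnethCross P' hab (TensorProduct.map hX hY z) := by
  obtain ⟨z, rfl⟩ := TensorProduct.map_surjective (X.π_surjective a) (Y.π_surjective b) z
  rw [kunnethCross_apply, h, ← LinearMap.comp_apply (TensorProduct.map _ _),
    ← TensorProduct.map_comp, hf, hg, TensorProduct.map_comp, LinearMap.comp_apply,
    kunnethCross_apply]
  congr 1
  refine Subtype.ext ((famMap_famInc f g a b _).trans ?_)
  rw [crossCocyc_coe]
  refine congrArg (famInc a b) ?_
  rw [← LinearMap.comp_apply, ← LinearMap.comp_apply (TensorProduct.map _ _),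
    ← TensorProduct.map_comp, ← TensorProduct.map_comp]
  rfl

/-- The chain maps need not respect the splittings. However, they carry a lift to `Z ⊗ B` for `t` to
one for the image of `t`, and by `kunnethTor_eq` every lift computes the connecting map. -/
theorem kunnethTor_natural (f : X.C ⟶ X'.C) (g : Y.C ⟶ Y'.C) (hT : HT →ₗ[R] HT')
    (h : ∀ t, hT (P.π t) = P'.π (famCocycMap f g k t)) (a b : ℕ)
    (hX : X.H a →ₗ[R] X'.H a) (hf : hX ∘ₗ X.π a = X'.π a ∘ₗ cocycMap f a) (x : HT) :
    kunnethTor P' a b (hT x) = TensorProduct.map hX (cobdMap g b) (kunnethTor P a b x) := by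
  obtain ⟨t, rfl⟩ := P.surjective x
  have hu := subtype_rTensor_ρ t a b
  rw [h, kunnethTor_eq P t _ hu, kunnethTor_eq P' (famCocycMap f g k t)
    (TensorProduct.map (cocycMap f a) (cobdMap g b)
      (TensorProduct.map (X.S.ρ a) (toCobd Y.C b) ((t : Fam X.C Y.C) a (b - 1)))),
    ← LinearMap.comp_apply, ← LinearMap.comp_apply (TensorProduct.map hX _),
    LinearMap.rTensor_comp_map, LinearMap.map_comp_rTensor, hf]
  have e : (cocyc X'.C a).subtype ∘ₗ cocycMap f a = (f.f a).hom ∘ₗ (cocyc X.C a).subtype := rfl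
  have hu' := congrArg (TensorProduct.map (f.f a).hom (cobdMap g b)) hu
  rw [← LinearMap.comp_apply, LinearMap.map_comp_rTensor, ← e,
    ← LinearMap.comp_apply (TensorProduct.map (f.f a).hom _), LinearMap.map_comp_lTensor,
    ← toCobd_comp_map, ← LinearMap.lTensor_comp_map, LinearMap.comp_apply] at hu'
  rw [← LinearMap.comp_apply, LinearMap.rTensor_comp_map]
  exact hu'

end Kunneth

end FreeGroupFunctors

end

noncomputable section

namespace FreeGroupFunctors

open Limits

/-! ### The first left derived functor and projective resolutions of length one -/

section LengthOne

open scoped ZeroObject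

variable {𝓐 𝓑 : Type*} [Category 𝓐] [Abelian 𝓐] [Category 𝓑] [Abelian 𝓑]

/-- The objects of the complex of length one attached to a short complex. -/
def lengthOneX (S : ShortComplex 𝓐) : ℕ → 𝓐
  | 0 => S.X₂
  | 1 => S.X₁
  | _ + 2 => 0

/-- The differential of the complex of length one attached to a short complex. -/
def lengthOneD (S : ShortComplex 𝓐) : ∀ n, lengthOneX S (n + 1) ⟶ lengthOneX S n
  | 0 => S.f
  | _ + 1 => 0

/-- The complex of length one attached to a short complex. -/
abbrev lengthOne (S : ShortComplex 𝓐) : ChainComplex 𝓐 ℕ :=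
  ChainComplex.of (lengthOneX S) (lengthOneD S) fun _ => zero_comp

theorem lengthOne_d (S : ShortComplex 𝓐) (n : ℕ) :
    (lengthOne S).d (n + 1) n = lengthOneD S n := ChainComplex.of_d _ _ _

/-- The components of the map of complexes of length one induced by a morphism of short
complexes. -/
def lengthOneMapF {S S' : ShortComplex 𝓐} (f : S ⟶ S') : ∀ n, lengthOneX S n ⟶ lengthOneX S' n
  | 0 => f.τ₂
  | 1 => f.τ₁
  | _ + 2 => 0

/-- The map of complexes of length one induced by a morphism of short complexes. -/
def lengthOneMap {S S' : ShortComplex 𝓐} (f : S ⟶ S') : lengthOne S ⟶ lengthOne S' where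
  f := lengthOneMapF f
  comm' i j h := by
    obtain rfl : j + 1 = i := h
    rw [lengthOne_d, lengthOne_d]
    cases j with
    | zero => exact f.comm₁₂
    | succ j => exact comp_zero.trans zero_comp.symm

/-- A short exact sequence whose first two terms are projective is a projective resolution. -/
def lengthOneResolution {S : ShortComplex 𝓐} (hS : S.ShortExact) (h₁ : Projective S.X₁)
    (h₂ : Projective S.X₂) : ProjectiveResolution S.X₃ where
  complex := lengthOne S
  projective n := match n with
    | 0 => h₂
    | 1 => h₁
    | _ + 2 => inferInstanceAs (Projective (0 : 𝓐))
  π := (ChainComplex.toSingle₀Equiv _ _).symm ⟨S.g, by rw [lengthOne_d]; exact S.zero⟩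
  quasiIso := ⟨fun n => by
    have := hS.epi_g
    have := hS.mono_f
    cases n with
    | zero =>
      rw [ChainComplex.quasiIsoAt₀_iff, ShortComplex.quasiIso_iff_of_zeros']
      · refine (ShortComplex.exact_and_epi_g_iff_of_iso ?_).2 ⟨hS.exact, hS.epi_g⟩
        refine ShortComplex.isoMk (Iso.refl _) (Iso.refl _) (Iso.refl _) ?_ ?_
        · refine (Category.id_comp _).trans (Eq.trans ?_ (Category.comp_id _).symm)
          exact (lengthOne_d S 0).symm
        · exact (Category.id_comp _).trans
            ((ChainComplex.toSingle₀Equiv_symm_apply_f_zero (C := lengthOne S) S.g _).symm.trans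
            (Category.comp_id _).symm)
      all_goals rfl
    | succ n =>
      rw [quasiIsoAt_iff_exactAt']
      · rw [HomologicalComplex.exactAt_iff' _ (n + 1 + 1) (n + 1) n (by simp) (by simp)]
        cases n with
        | zero =>
          rw [ShortComplex.exact_iff_mono]
          · change Mono ((lengthOne S).d (0 + 1) 0)
            rw [lengthOne_d]
            exact hS.mono_f
          · exact lengthOne_d S 1
        | succ n => exact ShortComplex.exact_of_isZero_X₂ _ (isZero_zero 𝓐)
      · apply ChainComplex.exactAt_succ_single_obj⟩

theorem lengthOneResolution_d {S : ShortComplex 𝓐} (hS : S.ShortExact) (h₁ : Projective S.X₁)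
    (h₂ : Projective S.X₂) : (lengthOneResolution hS h₁ h₂).complex.d 2 1 = 0 := lengthOne_d S 1

/-- The inclusion of the homology of a complex in the cochains, in a degree where the incoming
differential vanishes. -/
def homologyIncl (K : ChainComplex 𝓐 ℕ) (n : ℕ) (h : K.d (n + 1) n = 0) : K.homology n ⟶ K.X n :=
  haveI := K.isIso_homologyπ (n + 1) n (by simp) h
  inv (K.homologyπ n) ≫ K.iCycles n

instance (K : ChainComplex 𝓐 ℕ) (n : ℕ) (h : K.d (n + 1) n = 0) : Mono (homologyIncl K n h) := by
  have := K.isIso_homologyπ (n + 1) n (by simp) h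
  unfold homologyIncl
  infer_instance

theorem homologyIncl_natural {K L : ChainComplex 𝓐 ℕ} (φ : K ⟶ L) (n : ℕ)
    (h : K.d (n + 1) n = 0) (h' : L.d (n + 1) n = 0) :
    HomologicalComplex.homologyMap φ n ≫ homologyIncl L n h' = homologyIncl K n h ≫ φ.f n := by
  have := K.isIso_homologyπ (n + 1) n (by simp) h
  have := L.isIso_homologyπ (n + 1) n (by simp) h'
  rw [← cancel_epi (K.homologyπ n), homologyIncl, homologyIncl,
    HomologicalComplex.homologyπ_naturality_assoc, IsIso.hom_inv_id_assoc, Category.assoc,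
    IsIso.hom_inv_id_assoc, HomologicalComplex.cyclesMap_i]

theorem homologyIncl_d (K : ChainComplex 𝓐 ℕ) (n m : ℕ) (h : K.d (n + 1) n = 0) :
    homologyIncl K n h ≫ K.d n m = 0 := by
  rw [homologyIncl, Category.assoc, HomologicalComplex.iCycles_d, comp_zero]

/-- Without incoming differential the homology is the object of cycles, that is, the kernel of the
outgoing differential. -/
theorem homologyIncl_exact (K : ChainComplex 𝓐 ℕ) (n : ℕ) (h : K.d (n + 1 + 1) (n + 1) = 0) :
    (ShortComplex.mk _ _ (homologyIncl_d K (n + 1) n h)).Exact := by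
  have := K.isIso_homologyπ (n + 1 + 1) (n + 1) (by simp) h
  have e := ShortComplex.exact_of_f_is_kernel
    (ShortComplex.mk _ _ (K.iCycles_d (n + 1) n)) (K.cyclesIsKernel (n + 1) n (by simp))
  refine ShortComplex.exact_of_iso ?_ e
  refine ShortComplex.isoMk (asIso (K.homologyπ (n + 1))) (Iso.refl _) (Iso.refl _) ?_ ?_
  · simp [homologyIncl]
  · simp

theorem lengthOneMap_comm {S S' : ShortComplex 𝓐} (hS : S.ShortExact)
    (h₁ : Projective S.X₁) (h₂ : Projective S.X₂)
    (hS' : S'.ShortExact) (h₁' : Projective S'.X₁) (h₂' : Projective S'.X₂) (f : S ⟶ S') :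
    (lengthOneMap f).f 0 ≫ (lengthOneResolution hS' h₁' h₂').π.f 0 =
      (lengthOneResolution hS h₁ h₂).π.f 0 ≫ f.τ₃ := by
  have e : (lengthOneResolution hS h₁ h₂).π.f 0 = S.g :=
    ChainComplex.toSingle₀Equiv_symm_apply_f_zero (C := lengthOne S) S.g _
  have e' : (lengthOneResolution hS' h₁' h₂').π.f 0 = S'.g :=
    ChainComplex.toSingle₀Equiv_symm_apply_f_zero (C := lengthOne S') S'.g _
  rw [e, e']
  exact f.comm₂₃

theorem map_d_eq_zero (F : 𝓐 ⥤ 𝓑) [F.Additive] (K : ChainComplex 𝓐 ℕ) {i j : ℕ}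
    (h : K.d i j = 0) : ((F.mapHomologicalComplex (ComplexShape.down ℕ)).obj K).d i j = 0 :=
  (congrArg F.map h).trans (F.map_zero _ _)

variable [HasProjectiveResolutions 𝓐]

/-- The first left derived functor as homology of a projective resolution. -/
def leftDerivedOneIso (F : 𝓐 ⥤ 𝓑) [F.Additive] {Z : 𝓐} (P : ProjectiveResolution Z) :
    (F.leftDerived 1).obj Z ≅
      ((F.mapHomologicalComplex (ComplexShape.down ℕ)).obj P.complex).homology 1 :=
  P.isoLeftDerivedObj F 1

theorem leftDerivedOneIso_natural (F : 𝓐 ⥤ 𝓑) [F.Additive] {Z Z' : 𝓐} (f : Z ⟶ Z')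
    (P : ProjectiveResolution Z) (P' : ProjectiveResolution Z') (φ : P.complex ⟶ P'.complex)
    (h : φ.f 0 ≫ P'.π.f 0 = P.π.f 0 ≫ f) :
    (F.leftDerived 1).map f ≫ (leftDerivedOneIso F P').hom = (leftDerivedOneIso F P).hom ≫
      HomologicalComplex.homologyMap
        ((F.mapHomologicalComplex (ComplexShape.down ℕ)).map φ) 1 :=
  ProjectiveResolution.isoLeftDerivedObj_hom_naturality f P P' φ h F 1

theorem leftDerivedOneIso_natural_functor {F F' : 𝓐 ⥤ 𝓑} [F.Additive] [F'.Additive] (α : F ⟶ F')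
    {Z : 𝓐} (P : ProjectiveResolution Z) :
    (NatTrans.leftDerived α 1).app Z ≫ (leftDerivedOneIso F' P).hom =
      (leftDerivedOneIso F P).hom ≫ HomologicalComplex.homologyMap
        ((NatTrans.mapHomologicalComplex α (ComplexShape.down ℕ)).app P.complex) 1 := by
  rw [← Iso.eq_comp_inv, Category.assoc]
  exact P.leftDerived_app_eq α 1

/-- The embedding of the first left derived functor defined by a projective resolution whose
second differential vanishes. -/
def leftDerivedOneIncl (F : 𝓐 ⥤ 𝓑) [F.Additive] {Z : 𝓐} (P : ProjectiveResolution Z)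
    (h : P.complex.d 2 1 = 0) : (F.leftDerived 1).obj Z ⟶
      ((F.mapHomologicalComplex (ComplexShape.down ℕ)).obj P.complex).X 1 :=
  (leftDerivedOneIso F P).hom ≫
    homologyIncl ((F.mapHomologicalComplex (ComplexShape.down ℕ)).obj P.complex) 1
      (map_d_eq_zero F P.complex h)

instance (F : 𝓐 ⥤ 𝓑) [F.Additive] {Z : 𝓐} (P : ProjectiveResolution Z)
    (h : P.complex.d 2 1 = 0) : Mono (leftDerivedOneIncl F P h) := mono_comp _ _

theorem leftDerivedOneIncl_comp (F : 𝓐 ⥤ 𝓑) [F.Additive] {Z : 𝓐} (P : ProjectiveResolution Z)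
    (h : P.complex.d 2 1 = 0) : leftDerivedOneIncl F P h ≫
      ((F.mapHomologicalComplex (ComplexShape.down ℕ)).obj P.complex).d 1 0 = 0 :=
  (Category.assoc _ _ _).trans ((congrArg _ (homologyIncl_d
    ((F.mapHomologicalComplex (ComplexShape.down ℕ)).obj P.complex) 1 0 _)).trans comp_zero)

theorem leftDerivedOneIncl_exact (F : 𝓐 ⥤ 𝓑) [F.Additive] {Z : 𝓐} (P : ProjectiveResolution Z)
    (h : P.complex.d 2 1 = 0) : (ShortComplex.mk _ _ (leftDerivedOneIncl_comp F P h)).Exact := by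
  refine ShortComplex.exact_of_iso ?_
    (homologyIncl_exact ((F.mapHomologicalComplex (ComplexShape.down ℕ)).obj P.complex) 0
      (map_d_eq_zero F P.complex h))
  refine ShortComplex.isoMk (leftDerivedOneIso F P).symm (Iso.refl _) (Iso.refl _) ?_ ?_
  · exact (Iso.inv_hom_id_assoc _ _).trans (Category.comp_id _).symm
  · exact (Category.id_comp _).trans (Category.comp_id _).symm

theorem leftDerivedOneIncl_natural (F : 𝓐 ⥤ 𝓑) [F.Additive] {Z Z' : 𝓐} (f : Z ⟶ Z')
    (P : ProjectiveResolution Z) (P' : ProjectiveResolution Z') (hP : P.complex.d 2 1 = 0)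
    (hP' : P'.complex.d 2 1 = 0) (φ : P.complex ⟶ P'.complex)
    (h : φ.f 0 ≫ P'.π.f 0 = P.π.f 0 ≫ f) :
    (F.leftDerived 1).map f ≫ leftDerivedOneIncl F P' hP' =
      leftDerivedOneIncl F P hP ≫
        ((F.mapHomologicalComplex (ComplexShape.down ℕ)).map φ).f 1 := by
  rw [leftDerivedOneIncl, leftDerivedOneIncl,
    reassoc_of% (leftDerivedOneIso_natural F f P P' φ h), Category.assoc, homologyIncl_natural]

theorem leftDerivedOneIncl_natural_functor {F F' : 𝓐 ⥤ 𝓑} [F.Additive] [F'.Additive] (α : F ⟶ F')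
    {Z : 𝓐} (P : ProjectiveResolution Z) (hP : P.complex.d 2 1 = 0) :
    (NatTrans.leftDerived α 1).app Z ≫ leftDerivedOneIncl F' P hP =
      leftDerivedOneIncl F P hP ≫
        ((NatTrans.mapHomologicalComplex α (ComplexShape.down ℕ)).app P.complex).f 1 := by
  rw [leftDerivedOneIncl, leftDerivedOneIncl,
    reassoc_of% (leftDerivedOneIso_natural_functor α P), Category.assoc, homologyIncl_natural]

end LengthOne

/-! ### `Tor_1` as a kernel, from a projective resolution of length one -/

section Tor

variable (A : Type 1) [AddCommGroup A] {S : ShortComplex (ModuleCat.{1} ℤ)} (hS : S.ShortExact)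
  (h₁ : Projective S.X₁) (h₂ : Projective S.X₂)

/-- The embedding of `Tor_1` defined by a projective resolution of length one. -/
def torIncl : ((tensorLeft A).leftDerived 1).obj S.X₃ →ₗ[ℤ] A ⊗[ℤ] S.X₁ :=
  (leftDerivedOneIncl (tensorLeft A) (lengthOneResolution hS h₁ h₂)
    (lengthOneResolution_d hS h₁ h₂)).hom

theorem torIncl_injective : Function.Injective (torIncl A hS h₁ h₂) :=
  (ModuleCat.mono_iff_injective
    (leftDerivedOneIncl (tensorLeft A) (lengthOneResolution hS h₁ h₂)
    (lengthOneResolution_d hS h₁ h₂))).1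
    inferInstance

theorem torIncl_exact : Function.Exact (torIncl A hS h₁ h₂) (S.f.hom.lTensor A) := by
  have h := (ShortComplex.ShortExact.moduleCat_exact_iff_function_exact _).1
    (leftDerivedOneIncl_exact (tensorLeft A) (lengthOneResolution hS h₁ h₂)
    (lengthOneResolution_d hS h₁ h₂))
  have e : (((tensorLeft A).mapHomologicalComplex (ComplexShape.down ℕ)).obj
      (lengthOneResolution hS h₁ h₂).complex).d 1 0 = (tensorLeft A).map S.f :=
    congrArg (tensorLeft A).map (lengthOne_d S 0)
  intro x
  refine Iff.trans ?_ (h x)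
  exact Eq.congr_left (LinearMap.congr_fun (congrArg ModuleCat.Hom.hom e) x).symm

/-- Functoriality comes from two sources: a transformation of functors in the first argument, and a
lift to the resolutions in the second, given here by `g`. -/
theorem torIncl_natural {A A' : Type 1} [AddCommGroup A] [AddCommGroup A'] (f : A →ₗ[ℤ] A')
    {S S' : ShortComplex (ModuleCat.{1} ℤ)} (hS : S.ShortExact)
    (h₁ : Projective S.X₁) (h₂ : Projective S.X₂) (hS' : S'.ShortExact)
    (h₁' : Projective S'.X₁) (h₂' : Projective S'.X₂) (g : S ⟶ S')
    (x : ((tensorLeft A).leftDerived 1).obj S.X₃) :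
    torIncl A' hS' h₁' h₂' (((NatTrans.leftDerived (tensorLeftMap f) 1).app S.X₃ ≫
      ((tensorLeft A').leftDerived 1).map g.τ₃).hom x) =
        TensorProduct.map f g.τ₁.hom (torIncl A hS h₁ h₂ x) := by
  have e₁ := LinearMap.congr_fun (congrArg ModuleCat.Hom.hom (leftDerivedOneIncl_natural_functor
    (tensorLeftMap f) (lengthOneResolution hS h₁ h₂)
    (lengthOneResolution_d hS h₁ h₂))) x
  have e₂ := LinearMap.congr_fun (congrArg ModuleCat.Hom.hom (leftDerivedOneIncl_natural
    (tensorLeft A') g.τ₃ (lengthOneResolution hS h₁ h₂) (lengthOneResolution hS' h₁' h₂')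
    (lengthOneResolution_d hS h₁ h₂) (lengthOneResolution_d hS' h₁' h₂') (lengthOneMap g) (lengthOneMap_comm _ _ _ _ _ _ g)))
    (((NatTrans.leftDerived (tensorLeftMap f) 1).app S.X₃).hom x)
  refine e₂.trans ((congrArg (LinearMap.lTensor A' g.τ₁.hom) e₁).trans ?_)
  exact LinearMap.congr_fun (LinearMap.lTensor_comp_rTensor A f g.τ₁.hom) (torIncl A hS h₁ h₂ x)

end Tor

end FreeGroupFunctors

end

noncomputable section

namespace FreeGroupFunctors

/-! ### Symmetric powers of free modules -/

section SymmetricPower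

variable {d : ℕ} {M : Type} [AddCommGroup M] [Module ℤ M] {ι : Type} (b : Module.Basis ι ℤ M)

theorem sym_hom_ext_basis {N : Type} [AddCommGroup N] [Module ℤ N]
    {f g : SymmetricPower ℤ (Fin d) M →ₗ[ℤ] N}
    (h : ∀ v : Fin d → ι, f (SymmetricPower.tprod ℤ fun i => b (v i)) =
      g (SymmetricPower.tprod ℤ fun i => b (v i))) : f = g :=
  sym_hom_ext fun v => MultilinearMap.congr_fun (Module.Basis.ext_multilinear (fun _ => b)
    (f := f.compMultilinearMap (SymmetricPower.tprod ℤ))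
    (g := g.compMultilinearMap (SymmetricPower.tprod ℤ)) h) v

theorem symmetricPower_finite [Finite ι] (b : Module.Basis ι ℤ M) : Module.Finite ℤ (SymmetricPower ℤ (Fin d) M) := by
  let e : (Fin d → ι) → SymmetricPower ℤ (Fin d) M := fun v =>
    SymmetricPower.tprod ℤ fun i => b (v i)
  refine ⟨Submodule.fg_def.2 ⟨Set.range e, Set.finite_range e, ?_⟩⟩
  have h : (Submodule.span ℤ (Set.range e)).mkQ = 0 := sym_hom_ext_basis b fun v =>
    (Submodule.Quotient.mk_eq_zero _).2 (Submodule.subset_span ⟨v, rfl⟩)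
  rw [← Submodule.ker_mkQ (Submodule.span ℤ (Set.range e)), h, LinearMap.ker_zero]

/-- The product of the polynomials of degree one attached to elements of a module with a basis. -/
def linearFormProd : MultilinearMap ℤ (fun _ : Fin d => M) (MvPolynomial ι ℤ) :=
  (MultilinearMap.mkPiAlgebra ℤ (Fin d) (MvPolynomial ι ℤ)).compLinearMap
    fun _ => b.constr ℤ MvPolynomial.X

/-- The linear map from the symmetric power of a module with a basis to polynomials in the basis
elements. -/
def symToPolynomial : SymmetricPower ℤ (Fin d) M →ₗ[ℤ] MvPolynomial ι ℤ :=
  (AddCon.lift (addConGen (SymmetricPower.Rel ℤ (Fin d) M))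
    (PiTensorProduct.lift (linearFormProd b)).toAddMonoidHom
    (AddCon.addConGen_le.2 fun x y h => by
      cases h with
      | perm e v =>
        change PiTensorProduct.lift (linearFormProd b) (PiTensorProduct.tprod ℤ _) =
          PiTensorProduct.lift (linearFormProd b) (PiTensorProduct.tprod ℤ _)
        rw [PiTensorProduct.lift.tprod, PiTensorProduct.lift.tprod]
        exact (Equiv.prod_comp e fun i => b.constr ℤ MvPolynomial.X (v i)).symm)).toIntLinearMap

theorem symToPolynomial_basis (v : Fin d → ι) :
    symToPolynomial b (SymmetricPower.tprod ℤ fun i => b (v i)) =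
      MvPolynomial.monomial (∑ i, Finsupp.single (v i) 1) 1 := by
  refine (PiTensorProduct.lift.tprod (φ := linearFormProd b) _).trans ?_
  rw [MvPolynomial.monomial_sum_one]
  refine (MultilinearMap.mkPiAlgebra_apply (R := ℤ) (fun i => b.constr ℤ MvPolynomial.X (b (v i)))).trans ?_
  exact Finset.prod_congr rfl fun i _ => b.constr_basis ℤ (MvPolynomial.X (R := ℤ)) (v i)

/-- Equal exponents mean that `v` and `w` have fibres of equal size; matching the fibres gives the
permutation. -/
theorem exists_perm_of_sum_single_eq {v w : Fin d → ι}
    (h : ∑ i, Finsupp.single (v i) 1 = ∑ i, Finsupp.single (w i) 1) :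
    ∃ e : Equiv.Perm (Fin d), v = w ∘ e := by
  classical
  have key : ∀ (u : Fin d → ι) (a : ι), (∑ i, Finsupp.single (u i) 1 : ι →₀ ℕ) a =
      Fintype.card {i // u i = a} := fun u a => by
    rw [Finsupp.finsetSum_apply, Fintype.card_subtype, Finset.card_filter]
    exact Finset.sum_congr rfl fun i _ => Finsupp.single_apply
  have e : ∀ a, {i // v i = a} ≃ {i // w i = a} := fun a =>
    Fintype.equivOfCardEq (by rw [← key, ← key, h])
  refine ⟨(Equiv.sigmaFiberEquiv v).symm.trans ((Equiv.sigmaCongrRight e).trans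
    (Equiv.sigmaFiberEquiv w)), funext fun i => ?_⟩
  exact (e (v i) ⟨i, rfl⟩).2.symm

open Classical in
/-- A left inverse of `symToPolynomial`. -/
def polynomialToSym : MvPolynomial ι ℤ →ₗ[ℤ] SymmetricPower ℤ (Fin d) M :=
  (MvPolynomial.basisMonomials ι ℤ).constr ℤ fun m =>
    if h : ∃ v : Fin d → ι, ∑ i, Finsupp.single (v i) 1 = m then
      SymmetricPower.tprod ℤ fun i => b (h.choose i) else 0

/-- The word chosen for a monomial is determined up to a permutation, which the symmetric power does
not see. -/
theorem polynomialToSym_comp : polynomialToSym (d := d) b ∘ₗ symToPolynomial b = LinearMap.id := by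
  refine sym_hom_ext_basis b fun v => ?_
  have h : ∃ w : Fin d → ι, ∑ i, Finsupp.single (w i) 1 = ∑ i, Finsupp.single (v i) 1 := ⟨v, rfl⟩
  obtain ⟨e, he⟩ := exists_perm_of_sum_single_eq h.choose_spec
  rw [LinearMap.comp_apply, symToPolynomial_basis, polynomialToSym,
    ← congrFun (MvPolynomial.coe_basisMonomials ι ℤ) (∑ i, Finsupp.single (v i) 1),
    Module.Basis.constr_basis, dif_pos h]
  have e' : (fun i => b (h.choose i)) = fun i => (fun j => b (v j)) (e i) :=
    funext fun i => congrArg b (congrFun he i)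
  exact (congrArg (SymmetricPower.tprod ℤ) e').trans
    (SymmetricPower.tprod_equiv e fun j => b (v j))

/-- The embedding into a polynomial ring shows torsion-freeness, and finitely generated torsion-free
modules over `ℤ` are free. -/
theorem symmetricPower_free [Finite ι] (b : Module.Basis ι ℤ M) :
    Module.Free ℤ (SymmetricPower ℤ (Fin d) M) := by
  have := symmetricPower_finite (d := d) b
  have h : Function.Injective (symToPolynomial (d := d) b) :=
    Function.LeftInverse.injective (g := polynomialToSym b)
      (LinearMap.congr_fun (polynomialToSym_comp b))
  have : Module.IsTorsionFree ℤ (SymmetricPower ℤ (Fin d) M) :=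
    h.moduleIsTorsionFree _ (map_smul _)
  infer_instance

end SymmetricPower

/-- The abelianization of a free group is free abelian. -/
def abelianizationBasis (n : ℕ) :
    Module.Basis (Fin n) ℤ (Additive (Abelianization (FreeGroup (Fin n)))) :=
  FreeAbelianGroup.basis (Fin n)

instance (i n : ℕ) : Module.Finite ℤ ((symAb i).obj (freeGr n)) :=
  symmetricPower_finite (abelianizationBasis n)

instance (i n : ℕ) : Module.Free ℤ ((symAb i).obj (freeGr n)) :=
  symmetricPower_free (abelianizationBasis n)

end FreeGroupFunctors

end

noncomputable section

namespace FreeGroupFunctors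

open Limits

/-! ### Computation of extension groups by projective resolutions -/

section Ext

variable {𝓐 : Type*} [Category.{1} 𝓐] [Abelian 𝓐] [HasExt.{1} 𝓐] {Z : 𝓐}

/-- The complex of homomorphisms from a projective resolution to an object. -/
def homComplex (K : ChainComplex 𝓐 ℕ) (F : 𝓐) : CochainComplex (ModuleCat.{1} ℤ) ℕ where
  X n := ModuleCat.of ℤ (K.X n ⟶ F)
  d i j := ModuleCat.ofHom (Preadditive.leftComp F (K.d j i)).toIntLinearMap
  shape i j h := by
    ext1
    refine LinearMap.ext fun f => ?_
    exact (congrArg (· ≫ f) (K.shape j i h)).trans zero_comp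
  d_comp_d' i j k _ _ := by
    ext1
    refine LinearMap.ext fun f => ?_
    exact (Category.assoc _ _ _).symm.trans
      ((congrArg (· ≫ f) (K.d_comp_d k j i)).trans zero_comp)

/-- The map of complexes of homomorphisms induced by a morphism of coefficients. -/
def homComplexMap (K : ChainComplex 𝓐 ℕ) {F F' : 𝓐} (φ : F ⟶ F') :
    homComplex K F ⟶ homComplex K F' where
  f n := ModuleCat.ofHom (Preadditive.rightComp (K.X n) φ).toIntLinearMap
  comm' i j _ := by
    ext1
    refine LinearMap.ext fun f => ?_
    exact (Category.assoc _ _ _).symm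

/-- A coboundary would come from cohomological degree 1 of the resolution, which is zero, and
precomposition with the epimorphism onto the degree 0 term is injective. -/
theorem extMk_zero_eq_zero_iff (P : ProjectiveResolution Z) {F : 𝓐} (f : P.complex.X 0 ⟶ F)
    (hf : P.complex.d 1 0 ≫ f = 0) : P.extMk f 1 rfl hf = 0 ↔ f = 0 := by
  refine ⟨fun h => ?_, ?_⟩
  · rw [← P.extEquivCohomologyClass.apply_eq_iff_eq, P.extEquivCohomologyClass_extMk,
      P.extEquivCohomologyClass_zero, CochainComplex.HomComplex.CohomologyClass.mk_eq_zero_iff,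
      CochainComplex.HomComplex.Cocycle.toSingleMk_mem_coboundaries_iff _ _ _ _ _ 1 (by simp)] at h
    obtain ⟨g, hg⟩ := h
    have hz : IsZero (P.cochainComplex.X 1) :=
      P.cochainComplex.isZero_of_isStrictlyLE 0 1 (by simp)
    rw [hz.eq_of_src g 0, comp_zero] at hg
    exact (cancel_epi _).1 (hg.symm.trans comp_zero.symm)
  · rintro rfl
    exact P.extMk_zero 1 rfl

/-- The presentation of extension groups by cocycles in the complex of homomorphisms. -/
def extPresentation (P : ProjectiveResolution Z) (F : 𝓐) (n : ℕ) :
    CohomologyPresentation (homComplex P.complex F) n (ModuleCat.of ℤ (Ext.{1} Z F n)) where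
  π := AddMonoidHom.toIntLinearMap
    { toFun := fun f => P.extMk f.1 (n + 1) rfl f.2
      map_zero' := P.extMk_zero (n + 1) rfl
      map_add' := fun f g => (P.add_extMk f.1 g.1 (n + 1) rfl f.2 g.2).symm }
  surjective x := by
    obtain ⟨f, hf, rfl⟩ := P.extMk_surjective x (n + 1) rfl
    exact ⟨⟨f, hf⟩, rfl⟩
  ker f := by
    cases n with
    | zero =>
      refine (extMk_zero_eq_zero_iff P f.1 f.2).trans ⟨fun h => h ▸ zero_mem _, fun h => ?_⟩
      exact congrArg Subtype.val (cobd_zero_eq_zero _ ⟨f.1, h⟩)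
    | succ n => exact P.extMk_eq_zero_iff f.1 (n + 2) rfl f.2 n rfl

theorem extPresentation_natural (P : ProjectiveResolution Z) {F F' : 𝓐} (φ : F ⟶ F') (n : ℕ) :
    ((Ext.mk₀ φ).postcomp Z (add_zero n)).toIntLinearMap ∘ₗ (extPresentation P F n).π =
      (extPresentation P F' n).π ∘ₗ cocycMap (homComplexMap P.complex φ) n :=
  LinearMap.ext fun f => P.extMk_comp_mk₀ f.1 (n + 1) rfl f.2 φ

end Ext

end FreeGroupFunctors

end

noncomputable section

namespace FreeGroupFunctors

open Limits

/-! ### The complexes computing the extension groups -/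

/-- An additive equivalence of modules over the integers, as a linear equivalence. -/
def intLinearEquiv {M N : Type*} [AddCommGroup M] [Module ℤ M] [AddCommGroup N] [Module ℤ N]
    (e : M ≃+ N) : M ≃ₗ[ℤ] N :=
  e.toLinearEquiv fun c x => map_intCast_smul e ℤ ℤ c x

/-- The complex computing `Ext(𝔞, F)`. -/
abbrev barHom (F : FGr) : CochainComplex (ModuleCat.{1} ℤ) ℕ := homComplex barComplex F

/-- The cochains of the complex computing `Ext(𝔞, F)`. -/
def barHomEquiv (a : ℕ) (F : FGr) : (barHom F).X a ≃ₗ[ℤ] F.obj (freeGr (a + 1)) :=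
  intLinearEquiv (barYoneda (a + 1) F)

/-- Natural transformations out of the external product of bar functors. -/
abbrev BoxHom (a b : ℕ) (X : FGr2) : ModuleCat.{1} ℤ := ModuleCat.of ℤ (boxBar (a + 1) (b + 1) ⟶ X)

/-- The external product of natural transformations is a tensor product. -/
def boxHom (a b : ℕ) (F G : FGr) :
    (barHom F).X a ⊗[ℤ] (barHom G).X b ≃ₗ[ℤ] BoxHom a b (F ⊠ G) :=
  -- The value of `F ⊠ G` at a pair of free groups is the tensor product of the values, so no
  -- finiteness of `F` or `G` is needed.
  (TensorProduct.congr (barHomEquiv a F) (barHomEquiv b G)).trans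
    (intLinearEquiv (boxYoneda (a + 1) (b + 1) (F ⊠ G))).symm

/-- This allows compatibility with differentials and coefficients to be checked on pure tensors, as
functoriality of `⊠`. -/
theorem boxHom_tmul {a b : ℕ} {F G : FGr} (f : barFun (a + 1) ⟶ F) (g : barFun (b + 1) ⟶ G) :
    boxHom a b F G ((f : (barHom F).X a) ⊗ₜ (g : (barHom G).X b)) = boxMap f g :=
  (LinearEquiv.symm_apply_eq _).2 rfl

theorem boxHom_rTensor {a b : ℕ} {F G : FGr} (x : (barHom F).X a ⊗[ℤ] (barHom G).X b) :
    boxHom (a + 1) b F G ((cd (barHom F) a (a + 1)).rTensor _ x) =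
      boxMap (barFunD (a + 1)) (𝟙 _) ≫ (boxHom a b F G x : boxBar (a + 1) (b + 1) ⟶ F ⊠ G) := by
  induction x using TensorProduct.induction_on with
  | zero => rw [map_zero, map_zero, map_zero]; exact comp_zero.symm
  | add x y hx hy =>
    rw [map_add, map_add, map_add, hx, hy]
    exact (Preadditive.comp_add _ _ _ _ _ _).symm
  | tmul f g =>
    have h : ∀ (f : barFun (a + 1) ⟶ F) (g : barFun (b + 1) ⟶ G),
        boxMap (barFunD (a + 1) ≫ f) g = boxMap (barFunD (a + 1)) (𝟙 _) ≫ boxMap f g :=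
      fun f g => by rw [← boxMap_comp, Category.id_comp]
    exact (boxHom_tmul (F := F) (barComplex.d (a + 1) a ≫ f) g).trans
      ((congrArg (fun d => boxMap (d ≫ f) g) (barComplex_d a)).trans
        ((h f g).trans (congrArg (boxMap (barFunD (a + 1)) (𝟙 _) ≫ ·) (boxHom_tmul f g)).symm))

theorem boxHom_lTensor {a b : ℕ} {F G : FGr} (x : (barHom F).X a ⊗[ℤ] (barHom G).X b) :
    boxHom a (b + 1) F G ((cd (barHom G) b (b + 1)).lTensor _ x) =
      boxMap (𝟙 _) (barFunD (b + 1)) ≫ (boxHom a b F G x : boxBar (a + 1) (b + 1) ⟶ F ⊠ G) := by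
  induction x using TensorProduct.induction_on with
  | zero => rw [map_zero, map_zero, map_zero]; exact comp_zero.symm
  | add x y hx hy =>
    rw [map_add, map_add, map_add, hx, hy]
    exact (Preadditive.comp_add _ _ _ _ _ _).symm
  | tmul f g =>
    have h : ∀ (f : barFun (a + 1) ⟶ F) (g : barFun (b + 1) ⟶ G),
        boxMap f (barFunD (b + 1) ≫ g) = boxMap (𝟙 _) (barFunD (b + 1)) ≫ boxMap f g :=
      fun f g => by rw [← boxMap_comp, Category.id_comp]
    exact (boxHom_tmul (G := G) f (barComplex.d (b + 1) b ≫ g)).trans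
      ((congrArg (fun d => boxMap f (d ≫ g)) (barComplex_d b)).trans
        ((h f g).trans (congrArg (boxMap (𝟙 _) (barFunD (b + 1)) ≫ ·) (boxHom_tmul f g)).symm))

theorem boxHom_map {a b : ℕ} {F F' G G' : FGr} (φ : F ⟶ F') (ψ : G ⟶ G')
    (x : (barHom F).X a ⊗[ℤ] (barHom G).X b) :
    boxHom a b F' G' (TensorProduct.map ((homComplexMap barComplex φ).f a).hom
      ((homComplexMap barComplex ψ).f b).hom x) =
        (boxHom a b F G x : boxBar (a + 1) (b + 1) ⟶ F ⊠ G) ≫ boxMap φ ψ := by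
  induction x using TensorProduct.induction_on with
  | zero => rw [map_zero, map_zero, map_zero]; exact zero_comp.symm
  | add x y hx hy =>
    rw [map_add, map_add, map_add, hx, hy]
    exact (Preadditive.add_comp _ _ _ _ _ _).symm
  | tmul f g =>
    exact (boxHom_tmul (F := F') (G := G') (f ≫ φ) (g ≫ ψ)).trans
      ((boxMap_comp f φ g ψ).trans (congrArg (· ≫ boxMap φ ψ) (boxHom_tmul f g)).symm)

theorem totFunInc_totFunProj_of_ne {a b a' b' k : ℕ} (h : a' + b' = k)
    (hne : (a', b') ≠ (a, b)) : totFunInc a b k ≫ totFunProj h = 0 := by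
  ext P : 3
  exact LinearMap.ext fun x => totInc_ne (A := barObj P.1) (B := barObj P.2) x ⟨(a', b'), h⟩ hne

theorem totFunInc_totFunProj {a b k : ℕ} (h : a + b = k) :
    totFunInc a b k ≫ totFunProj h = 𝟙 _ := by
  ext P : 3
  exact LinearMap.ext fun x => totInc_same (A := barObj P.1) (B := barObj P.2) h x

theorem totFun_hom_ext {k : ℕ} {X : FGr2} {f g : totFun k ⟶ X}
    (h : ∀ a b, a + b = k → totFunInc a b k ≫ f = totFunInc a b k ≫ g) : f = g := by
  rw [← Category.id_comp f, ← Category.id_comp g, ← sum_totFunProj_totFunInc,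
    Preadditive.sum_comp, Preadditive.sum_comp]
  refine Finset.sum_congr rfl fun p _ => ?_
  rw [Category.assoc, Category.assoc, h _ _ (Finset.HasAntidiagonal.mem_antidiagonal.1 p.2)]

/-- The natural transformation out of the total complex defined by a family. -/
def totHom (k : ℕ) (F G : FGr) :
    Fam (barHom F) (barHom G) →ₗ[ℤ] ModuleCat.of ℤ (totFun k ⟶ (F ⊠ G : FGr2)) :=
  ∑ p : {p : ℕ × ℕ // p ∈ Finset.HasAntidiagonal.antidiagonal k},
    (Preadditive.leftComp (F ⊠ G : FGr2)
      (totFunProj (Finset.HasAntidiagonal.mem_antidiagonal.1 p.2))).toIntLinearMap ∘ₗ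
      (boxHom p.1.1 p.1.2 F G).toLinearMap ∘ₗ LinearMap.proj p.1.2 ∘ₗ LinearMap.proj p.1.1

variable {F G : FGr}

theorem totFunInc_totHom {a b k : ℕ} (h : a + b = k) (t : Fam (barHom F) (barHom G)) :
    totFunInc a b k ≫ (totHom k F G t : totFun k ⟶ F ⊠ G) = boxHom a b F G (t a b) := by
  have e : (totHom k F G t : totFun k ⟶ F ⊠ G) =
      ∑ p : {p : ℕ × ℕ // p ∈ Finset.HasAntidiagonal.antidiagonal k},
        totFunProj (Finset.HasAntidiagonal.mem_antidiagonal.1 p.2) ≫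
          (boxHom p.1.1 p.1.2 F G (t p.1.1 p.1.2) : boxBar (p.1.1 + 1) (p.1.2 + 1) ⟶ F ⊠ G) :=
    LinearMap.sum_apply _ _ t
  rw [e, Preadditive.comp_sum, Finset.sum_eq_single
    ⟨(a, b), Finset.HasAntidiagonal.mem_antidiagonal.2 h⟩, ← Category.assoc, totFunInc_totFunProj h,
    Category.id_comp]
  · rintro ⟨⟨a', b'⟩, hp⟩ - hne
    rw [← Category.assoc, totFunInc_totFunProj_of_ne _ fun e => hne (Subtype.ext e), zero_comp]
  · exact fun h' => absurd (Finset.mem_univ _) h'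

theorem totHom_eq_iff {k : ℕ} (t : Fam (barHom F) (barHom G)) (f : totFun k ⟶ (F ⊠ G : FGr2)) :
    totHom k F G t = f ↔
      ∀ a b, a + b = k → (boxHom a b F G (t a b) : boxBar (a + 1) (b + 1) ⟶ F ⊠ G) =
        totFunInc a b k ≫ f := by
  constructor
  · rintro rfl a b h
    exact (totFunInc_totHom h t).symm
  · intro h
    refine totFun_hom_ext fun a b hab => ?_
    rw [totFunInc_totHom hab, h a b hab]

theorem exists_totHom_eq {k : ℕ} (f : totFun k ⟶ (F ⊠ G : FGr2)) :
    ∃ t : Fam (barHom F) (barHom G), (∀ a b, a + b ≠ k → t a b = 0) ∧ totHom k F G t = f := by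
  refine ⟨fun a b => (boxHom a b F G).symm (totFunInc a b k ≫ f), fun a b h => ?_,
    (totHom_eq_iff _ _).2 fun a b _ => LinearEquiv.apply_symm_apply _ _⟩
  change (boxHom a b F G).symm (totFunInc a b k ≫ f) = 0
  rw [totFunInc_eq_zero h, zero_comp]
  exact map_zero _

theorem totHom_eq_zero {k : ℕ} {t : Fam (barHom F) (barHom G)} (ht : ∀ a b, a + b ≠ k → t a b = 0)
    (h : totHom k F G t = 0) : t = 0 := by
  funext a b
  by_cases hab : a + b = k
  · refine (boxHom a b F G).injective ?_
    refine (((totHom_eq_iff t 0).1 h) a b hab).trans ?_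
    exact comp_zero.trans (map_zero _).symm
  · exact ht a b hab

/-- Both differentials carry the sign `(-1)^a` at the bidegree `(a, b)` of total degree `k + 1`, so
`totHom` commutes with them without further signs. -/
theorem totHom_famD (k : ℕ) (t : Fam (barHom F) (barHom G)) :
    totHom (k + 1) F G (famD _ _ t) = totFunD k ≫ (totHom k F G t : totFun k ⟶ F ⊠ G) := by
  refine (totHom_eq_iff _ _).2 fun a b hab => ?_
  have h₁ : ∀ a b, a + b = k →
      (boxHom (a + 1) b F G ((cd (barHom F) a (a + 1)).rTensor _ (t a b)) :
        boxBar (a + 1 + 1) (b + 1) ⟶ F ⊠ G) =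
      boxMap (barFunD (a + 1)) (𝟙 _) ≫ totFunInc a b k ≫ (totHom k F G t : totFun k ⟶ F ⊠ G) :=
    fun a b h => by rw [boxHom_rTensor, totFunInc_totHom h]
  have h₂ : ∀ a b, a + b = k →
      (boxHom a (b + 1) F G ((cd (barHom G) b (b + 1)).lTensor _ (t a b)) :
        boxBar (a + 1) (b + 1 + 1) ⟶ F ⊠ G) =
      boxMap (𝟙 _) (barFunD (b + 1)) ≫ totFunInc a b k ≫ (totHom k F G t : totFun k ⟶ F ⊠ G) :=
    fun a b h => by rw [boxHom_lTensor, totFunInc_totHom h]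
  rw [← Category.assoc]
  cases a with
  | zero =>
    cases b with
    | zero => omega
    | succ b =>
      have e : famD _ _ t 0 (b + 1) = (cd (barHom G) b (b + 1)).lTensor _ (t 0 b) := by
        rw [famD_apply, Nat.zero_sub, cd_zero, LinearMap.rTensor_zero, LinearMap.zero_apply,
          zero_add, pow_zero]
        exact one_smul ℤ _
      rw [e, h₂ 0 b (by omega), totFunInc_zero_succ, Category.assoc]
  | succ a =>
    cases b with
    | zero =>
      have e : famD _ _ t (a + 1) 0 = (cd (barHom F) a (a + 1)).rTensor _ (t a 0) := by
        rw [famD_apply, Nat.zero_sub, cd_zero, LinearMap.lTensor_zero, LinearMap.zero_apply,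
          smul_zero, add_zero]
        rfl
      rw [e, h₁ a 0 (by omega), totFunInc_succ_zero, Category.assoc]
    | succ b =>
      have e : famD _ _ t (a + 1) (b + 1) = (cd (barHom F) a (a + 1)).rTensor _ (t a (b + 1)) +
        (-1 : ℤ) ^ (a + 1) • (cd (barHom G) b (b + 1)).lTensor _ (t (a + 1) b) := rfl
      rw [e, map_add, map_smul, h₁ a (b + 1) (by omega), h₂ (a + 1) b (by omega),
        totFunInc_succ_succ, Preadditive.add_comp, Preadditive.zsmul_comp, Category.assoc,
        Category.assoc]

end FreeGroupFunctors

end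

noncomputable section

namespace FreeGroupFunctors

open Limits

/-! ### Extension groups of external products and the tensor product of two complexes -/

theorem boxResolution_d (k : ℕ) : boxResolution.complex.d (k + 1) k = totFunD k := totComplex_d k

theorem boxResolution_d_totHom {F G : FGr} {k : ℕ} {t : Fam (barHom F) (barHom G)}
    (ht : famD _ _ t = 0) :
    boxResolution.complex.d (k + 1) k ≫ (totHom k F G t : totFun k ⟶ F ⊠ G) = 0 :=
  (congrArg (· ≫ (totHom k F G t : totFun k ⟶ F ⊠ G)) (boxResolution_d k)).trans
    ((totHom_famD k t).symm.trans (by rw [ht, map_zero]; rfl))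

theorem extMk_congr {𝓐 : Type*} [Category.{1} 𝓐] [Abelian 𝓐] [HasExt.{1} 𝓐] {Z F : 𝓐}
    (P : ProjectiveResolution Z) {n : ℕ} {f g : P.complex.X n ⟶ F} (h : f = g)
    (hf : P.complex.d (n + 1) n ≫ f = 0) :
    P.extMk f (n + 1) rfl hf = P.extMk g (n + 1) rfl (h ▸ hf) := by
  subst h
  rfl

/-- The presentation of the extension groups of external products by cocycles in the tensor
product of two complexes. -/
def boxPresentation (F G : FGr) (k : ℕ) : FamPresentation (barHom F) (barHom G) k
    (ModuleCat.of ℤ (ExtAA k (F ⊠ G))) where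
  π := AddMonoidHom.toIntLinearMap
    { toFun := fun t => boxResolution.extMk (totHom k F G t.1) (k + 1) rfl
        (boxResolution_d_totHom t.2.2)
      map_zero' := (extMk_congr boxResolution (map_zero (totHom k F G)) _).trans
        (boxResolution.extMk_zero (k + 1) rfl)
      map_add' := fun s t => (extMk_congr boxResolution (map_add (totHom k F G) s.1 t.1) _).trans
        (boxResolution.add_extMk _ _ (k + 1) rfl (boxResolution_d_totHom s.2.2)
          (boxResolution_d_totHom t.2.2)).symm }
  surjective x := by
    obtain ⟨f, hf, rfl⟩ := boxResolution.extMk_surjective x (k + 1) rfl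
    obtain ⟨t, ht, h⟩ := exists_totHom_eq (F := F) (G := G) f
    -- The differential of `t` is supported in total degree `k + 1`, where `totHom` is injective.
    have ht' : famD _ _ t = 0 := by
      refine totHom_eq_zero (k := k + 1) (famD_supp fun a b h => ht a b (by omega)) ?_
      rw [totHom_famD, h]
      exact (congrArg (· ≫ f) (boxResolution_d k)).symm.trans hf
    exact ⟨⟨t, ht, ht'⟩, extMk_congr boxResolution h (boxResolution_d_totHom ht')⟩
  ker t := by
    cases k with
    | zero =>
      refine (extMk_zero_eq_zero_iff boxResolution _ (boxResolution_d_totHom t.2.2)).trans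
        ⟨fun h => ⟨0, fun _ _ _ => rfl, ?_⟩, ?_⟩
      · rw [map_zero]
        exact (totHom_eq_zero t.2.1 h).symm
      · rintro ⟨y, hy, h⟩
        have hy' : y = 0 := funext fun a => funext fun b => hy a b (by omega)
        rw [hy', map_zero] at h
        rw [← h]
        exact map_zero _
    | succ k =>
      refine (boxResolution.extMk_eq_zero_iff _ (k + 2) rfl (boxResolution_d_totHom t.2.2)
        k rfl).trans ⟨?_, ?_⟩
      · rintro ⟨g, hg⟩
        obtain ⟨y, hy, rfl⟩ := exists_totHom_eq (F := F) (G := G) g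
        have hy' : ∀ a b, a + b + 1 ≠ k + 1 → y a b = 0 := fun a b h => hy a b (by omega)
        refine ⟨y, hy', sub_eq_zero.1 (totHom_eq_zero (k := k + 1) (fun a b h => ?_) ?_)⟩
        · rw [Pi.sub_apply, Pi.sub_apply, famD_supp hy' a b h, t.2.1 a b h, sub_zero]
        · rw [map_sub, totHom_famD, sub_eq_zero]
          exact (congrArg (· ≫ (totHom k F G y : totFun k ⟶ F ⊠ G)) (boxResolution_d k)).symm.trans hg
      · rintro ⟨y, -, h⟩
        refine ⟨totHom k F G y, ?_⟩
        rw [← h, totHom_famD]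
        exact congrArg (· ≫ (totHom k F G y : totFun k ⟶ F ⊠ G)) (boxResolution_d k)

theorem totHom_famMap {F F' G G' : FGr} (φ : F ⟶ F') (ψ : G ⟶ G') (k : ℕ)
    (t : Fam (barHom F) (barHom G)) :
    totHom k F' G' (famMap (homComplexMap barComplex φ) (homComplexMap barComplex ψ) t) =
      (totHom k F G t : totFun k ⟶ F ⊠ G) ≫ boxMap φ ψ := by
  refine (totHom_eq_iff _ _).2 fun a b hab => ?_
  rw [famMap_apply, boxHom_map, ← Category.assoc, totFunInc_totHom hab]

theorem boxPresentation_natural {F F' G G' : FGr} (φ : F ⟶ F') (ψ : G ⟶ G') (k : ℕ)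
    (t : famCocyc (barHom F) (barHom G) k) :
    (extAAMap k (boxMap φ ψ)).toIntLinearMap ((boxPresentation F G k).π t) =
      (boxPresentation F' G' k).π
        (famCocycMap (homComplexMap barComplex φ) (homComplexMap barComplex ψ) k t) :=
  (boxResolution.extMk_comp_mk₀ _ (k + 1) rfl (boxResolution_d_totHom t.2.2) (boxMap φ ψ)).trans
    (extMk_congr boxResolution (totHom_famMap φ ψ k t.1).symm _)

/-! ### Splittings of complexes of free modules -/

/-- A complex of finite free abelian groups splits. -/
def splittingOfFree {R : Type} [CommRing R] [IsDomain R] [IsPrincipalIdealRing R]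
    (C : CochainComplex (ModuleCat.{1} R) ℕ) (h₁ : ∀ n, Module.Finite R (C.X n))
    (h₂ : ∀ n, Module.Free R (C.X n)) : Splitting C where
  s n := (Module.projective_lifting_property (toCobd C n) LinearMap.id
    (LinearMap.surjective_rangeRestrict _)).choose
  toCobd_s n := (Module.projective_lifting_property (toCobd C n) LinearMap.id
    (LinearMap.surjective_rangeRestrict _)).choose_spec

/-- The cochains are values of `Sⁱ ∘ 𝔞` at free groups. That these are finitely generated and free
is the only property of the coefficients that the Künneth argument uses. -/
instance (i n : ℕ) : Module.Finite ℤ ((barHom (symAb i)).X n) :=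
  Module.Finite.equiv (barHomEquiv n (symAb i)).symm

instance (i n : ℕ) : Module.Free ℤ ((barHom (symAb i)).X n) :=
  Module.Free.of_equiv (barHomEquiv n (symAb i)).symm

/-- The split complex that computes `Ext(𝔞, Sⁱ ∘ 𝔞)`. -/
def symComplex (i : ℕ) : SplitComplex ℤ where
  C := barHom (symAb i)
  H n := ModuleCat.of ℤ (ExtA n (symAb i))
  S := splittingOfFree _ inferInstance inferInstance
  pres n := extPresentation barResolution (symAb i) n
  flat _ := inferInstance
  flat_cobd _ := inferInstance

end FreeGroupFunctors

end

noncomputable section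

namespace FreeGroupFunctors

open Limits

/-! ### Short exact sequences of direct sums -/

section DirectSum

variable {M V T : Type*} [AddCommGroup M] [AddCommGroup V] [AddCommGroup T]

/-- The factorization of a homomorphism through an injective homomorphism. -/
def factorInjective (j : T →+ V) (hj : Function.Injective j) (g : M →+ V)
    (h : ∀ x, ∃ y, j y = g x) : M →+ T where
  toFun x := (h x).choose
  map_zero' := hj ((h 0).choose_spec.trans ((map_zero g).trans (map_zero j).symm))
  map_add' x y := hj ((h (x + y)).choose_spec.trans ((map_add g x y).trans
    ((congrArg₂ (· + ·) (h x).choose_spec (h y).choose_spec).symm.trans (map_add j _ _).symm)))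

theorem factorInjective_spec (j : T →+ V) (hj : Function.Injective j) (g : M →+ V)
    (h : ∀ x, ∃ y, j y = g x) (x : M) : j (factorInjective j hj g h x) = g x :=
  (h x).choose_spec

variable {ι κ : Type*} [DecidableEq ι] [Fintype κ] {A : ι → Type*}
  [∀ i, AddCommMonoid (A i)] {B : κ → Type*} [∀ q, AddCommMonoid (B q)]

/-- The homomorphism to a finite direct sum with given components. -/
def toDirectSum (g : ∀ q, M →+ B q) : M →+ ⨁ q, B q :=
  (DirectSum.addEquivProd B).symm.toAddMonoidHom.comp (AddMonoidHom.pi g)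

theorem toDirectSum_apply (g : ∀ q, M →+ B q) (x : M) (q : κ) : toDirectSum g x q = g q x :=
  congrFun ((DirectSum.addEquivProd B).apply_symm_apply fun q => g q x) q

theorem toAddMonoid_injective (f : ∀ i, A i →+ M) (h : ∀ i, ∃ r : M →+ A i,
    (∀ z, r (f i z) = z) ∧ ∀ i', i ≠ i' → ∀ z, r (f i' z) = 0) :
    Function.Injective (DirectSum.toAddMonoid f) := by
  refine fun x y hxy => DFinsupp.ext fun i => ?_
  obtain ⟨r, hr, hr'⟩ := h i
  have h : ∀ x, r (DirectSum.toAddMonoid f x) = x i := by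
    intro x
    induction x using DirectSum.induction_on with
    | zero => rw [map_zero, map_zero]; rfl
    | add x y hx hy => rw [map_add, map_add, hx, hy]; rfl
    | of i' z =>
      rw [DirectSum.toAddMonoid_of]
      by_cases e : i = i'
      · subst e
        rw [hr, DirectSum.of_eq_same]
      · rw [hr' _ e, DirectSum.of_eq_of_ne _ _ _ e]
  rw [← h, ← h, hxy]

theorem toAddMonoid_exact {A : ι → Type*} [∀ i, AddCommGroup (A i)] (f : ∀ i, A i →+ M) (g : ∀ q, M →+ B q)
    (h₀ : ∀ i q z, g q (f i z) = 0) (h : ∀ x, (∀ q, g q x = 0) → ∀ N : AddSubgroup M,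
      (∀ i z, f i z ∈ N) → x ∈ N) :
    Function.Exact (DirectSum.toAddMonoid f) (toDirectSum g) := by
  intro x
  constructor
  · intro hx
    refine h x (fun q => ?_) (DirectSum.toAddMonoid f).range fun i z =>
      ⟨DirectSum.of A i z, DirectSum.toAddMonoid_of _ _ _⟩
    rw [← toDirectSum_apply g x q, hx]
    rfl
  · rintro ⟨y, rfl⟩
    induction y using DirectSum.induction_on with
    | zero => rw [map_zero, map_zero]
    | add x y hx hy => rw [map_add, map_add, hx, hy, add_zero]
    | of i z =>
      refine DFinsupp.ext fun q => ?_
      rw [toDirectSum_apply, DirectSum.toAddMonoid_of]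
      exact h₀ i q z

theorem toDirectSum_surjective [DecidableEq κ] (g : ∀ q, M →+ B q)
    (h : ∀ q z, ∃ x, g q x = z ∧ ∀ q', q' ≠ q → g q' x = 0) :
    Function.Surjective (toDirectSum g) := by
  intro y
  induction y using DirectSum.induction_on with
  | zero => exact ⟨0, map_zero _⟩
  | add x y hx hy =>
    obtain ⟨x, rfl⟩ := hx
    obtain ⟨y, rfl⟩ := hy
    exact ⟨x + y, map_add _ _ _⟩
  | of q z =>
    obtain ⟨x, hx, hx'⟩ := h q z
    refine ⟨x, DFinsupp.ext fun q' => ?_⟩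
    rw [toDirectSum_apply]
    by_cases e : q' = q
    · subst e
      rw [DirectSum.of_eq_same, hx]
    · rw [DirectSum.of_eq_of_ne _ _ _ e, hx' q' e]

theorem toAddMonoid_natural {M' : Type*} [AddCommGroup M'] {A' : ι → Type*}
    [∀ i, AddCommMonoid (A' i)] (f : ∀ i, A i →+ M) (f' : ∀ i, A' i →+ M') (α : ∀ i, A i →+ A' i)
    (m : M →+ M') (h : ∀ i z, m (f i z) = f' i (α i z)) :
    m.comp (DirectSum.toAddMonoid f) = (DirectSum.toAddMonoid f').comp (DirectSum.map α) := by
  refine DirectSum.addHom_ext fun i z => ?_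
  rw [AddMonoidHom.comp_apply, AddMonoidHom.comp_apply, DirectSum.toAddMonoid_of,
    DirectSum.map_of, DirectSum.toAddMonoid_of, h]

theorem toDirectSum_natural {M' : Type*} [AddCommGroup M'] {B' : κ → Type*}
    [∀ q, AddCommMonoid (B' q)] (g : ∀ q, M →+ B q) (g' : ∀ q, M' →+ B' q) (β : ∀ q, B q →+ B' q)
    (m : M →+ M') (h : ∀ q x, β q (g q x) = g' q (m x)) :
    (DirectSum.map β).comp (toDirectSum g) = (toDirectSum g').comp m := by
  refine AddMonoidHom.ext fun x => DFinsupp.ext fun q => ?_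
  rw [AddMonoidHom.comp_apply, AddMonoidHom.comp_apply]
  refine (DirectSum.map_apply β q _).trans ?_
  rw [toDirectSum_apply, toDirectSum_apply, h]

end DirectSum

instance (k : ℕ) : Fintype {p : ℕ × ℕ // p.1 + p.2 = k} :=
  Fintype.subtype (Finset.HasAntidiagonal.antidiagonal k) fun _ =>
    Finset.HasAntidiagonal.mem_antidiagonal

theorem forall_of_subtype {k : ℕ} (P : ℕ → ℕ → Prop)
    (h : ∀ p : {p : ℕ × ℕ // p.1 + p.2 = k}, P p.1.1 p.1.2) (a b : ℕ) (hab : a + b = k) : P a b :=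
  h ⟨(a, b), hab⟩

/-! ### The Künneth sequence -/

/-- The presentation of cohomology in degree `b` as a short exact sequence. -/
abbrev presentationComplex {R : Type} [CommRing R] (Y : SplitComplex R) (b : ℕ) :
    ShortComplex (ModuleCat.{1} R) :=
  ShortComplex.mk (X₁ := ModuleCat.of R (cobd Y.C b)) (X₂ := ModuleCat.of R (cocyc Y.C b))
    (X₃ := Y.H b) (ModuleCat.ofHom (cobdIncl Y.C b)) (ModuleCat.ofHom (Y.π b)) (by
      ext1
      exact (Y.exact_cobdIncl b).linearMap_comp_eq_zero)

theorem presentationComplex_shortExact {R : Type} [CommRing R] (Y : SplitComplex R) (b : ℕ) :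
    (presentationComplex Y b).ShortExact where
  exact := (ShortComplex.ShortExact.moduleCat_exact_iff_function_exact _).2 (Y.exact_cobdIncl b)
  mono_f := (ModuleCat.mono_iff_injective _).2
    (Submodule.inclusion_injective (cobd_le_cocyc Y.C b))
  epi_g := (ModuleCat.epi_iff_surjective _).2 (Y.π_surjective b)

/-- Applied to coboundaries and cocycles, this makes `0 → B → Z → H → 0` a projective resolution of
the cohomology. -/
theorem projective_of_submodule {R : Type} [CommRing R] [IsDomain R] [IsPrincipalIdealRing R]
    (M : ModuleCat.{1} R) [Module.Finite R M] [Module.Free R M] (N : Submodule R M) : Projective (ModuleCat.of R N) :=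
  (IsProjective.iff_projective N).1 inferInstance

theorem symComplex_projective_cobd (i b : ℕ) :
    Projective (presentationComplex (symComplex i) b).X₁ :=
  projective_of_submodule ((barHom (symAb i)).X b) _

theorem symComplex_projective_cocyc (i b : ℕ) :
    Projective (presentationComplex (symComplex i) b).X₂ :=
  projective_of_submodule ((barHom (symAb i)).X b) _

/-- The embedding of `Tor_1` of two extension groups. -/
def symTorIncl (i j a b : ℕ) : Tor1 (ExtA a (symAb i)) (ExtA b (symAb j)) →ₗ[ℤ]
    ExtA a (symAb i) ⊗[ℤ] cobd (barHom (symAb j)) b :=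
  torIncl (ExtA a (symAb i)) (presentationComplex_shortExact (symComplex j) b)
    (symComplex_projective_cobd j b) (symComplex_projective_cocyc j b)

theorem symTorIncl_injective (i j a b : ℕ) : Function.Injective (symTorIncl i j a b) :=
  torIncl_injective _ (presentationComplex_shortExact (symComplex j) b)
    (symComplex_projective_cobd j b) (symComplex_projective_cocyc j b)

theorem symTorIncl_exact (i j a b : ℕ) : Function.Exact (symTorIncl i j a b)
    ((cobdIncl (barHom (symAb j)) b).lTensor (ExtA a (symAb i))) :=
  torIncl_exact _ (presentationComplex_shortExact (symComplex j) b)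
    (symComplex_projective_cobd j b) (symComplex_projective_cocyc j b)

/-- The presentation of the middle term of the Künneth sequence. -/
abbrev symBox (i j k : ℕ) : FamPresentation (symComplex i).C (symComplex j).C k
    (ModuleCat.of ℤ (ExtAA k (symAb i ⊠ symAb j))) := boxPresentation (symAb i) (symAb j) k

/-- The components of the first map of the Künneth sequence. -/
def symCross (i j : ℕ) {k a b : ℕ} (h : a + b = k) :
    ExtA a (symAb i) ⊗[ℤ] ExtA b (symAb j) →ₗ[ℤ] ExtAA k (symAb i ⊠ symAb j) :=
  kunnethCross (X := symComplex i) (Y := symComplex j) (symBox i j k) h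

/-- The components of a retraction of the first map of the Künneth sequence. -/
def symRetract (i j k a b : ℕ) :
    ExtAA k (symAb i ⊠ symAb j) →ₗ[ℤ] ExtA a (symAb i) ⊗[ℤ] ExtA b (symAb j) :=
  kunnethRetract (X := symComplex i) (Y := symComplex j) (symBox i j k) a b

/-- The components of the second map of the Künneth sequence, composed with the embedding of
`Tor_1`. -/
def symTor (i j k a b : ℕ) : ExtAA k (symAb i ⊠ symAb j) →ₗ[ℤ]
    ExtA a (symAb i) ⊗[ℤ] cobd (barHom (symAb j)) b :=
  kunnethTor (X := symComplex i) (Y := symComplex j) (symBox i j k) a b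

theorem symRetract_cross_same (i j : ℕ) {k a b : ℕ} (h : a + b = k)
    (z : ExtA a (symAb i) ⊗[ℤ] ExtA b (symAb j)) :
    symRetract i j k a b (symCross i j h z) = z :=
  kunnethRetract_cross_same (X := symComplex i) (Y := symComplex j) (symBox i j k) h z

theorem symRetract_cross_ne (i j : ℕ) {k a b a' b' : ℕ} (h : a + b = k)
    (h' : ¬(a' = a ∧ b' = b)) (z : ExtA a (symAb i) ⊗[ℤ] ExtA b (symAb j)) :
    symRetract i j k a' b' (symCross i j h z) = 0 :=
  kunnethRetract_cross_ne (X := symComplex i) (Y := symComplex j) (symBox i j k) h h' z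

theorem symTor_cross (i j : ℕ) {k a b a' b' : ℕ} (h : a + b = k) (h' : a' + b' = k + 1)
    (z : ExtA a (symAb i) ⊗[ℤ] ExtA b (symAb j)) :
    symTor i j k a' b' (symCross i j h z) = 0 :=
  kunnethTor_cross (X := symComplex i) (Y := symComplex j) (symBox i j k) h a' b' h' z

/-- The connecting map takes values in the kernel that `symTorIncl` identifies with `Tor_1`, and
therefore factors through it. -/
theorem exists_symTorIncl_eq (i j k a b : ℕ) (x : ExtAA k (symAb i ⊠ symAb j)) :
    ∃ y, symTorIncl i j a b y = symTor i j k a b x :=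
  (symTorIncl_exact i j a b (symTor i j k a b x)).1
    (kunnethTor_mem_ker (X := symComplex i) (Y := symComplex j) (symBox i j k) a b x)

theorem symTor_surjective (i j : ℕ) {k a b : ℕ} (h : a + b = k + 1)
    (z : Tor1 (ExtA a (symAb i)) (ExtA b (symAb j))) :
    ∃ x, symTor i j k a b x = symTorIncl i j a b z ∧
      ∀ a' b', a' + b' = k + 1 → ¬(a' = a ∧ b' = b) → symTor i j k a' b' x = 0 :=
  kunnethTor_surjective (X := symComplex i) (Y := symComplex j) (symBox i j k) a b h
    (symTorIncl i j a b z) ((symTorIncl_exact i j a b _).2 ⟨z, rfl⟩)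

theorem symCross_exact (i j k : ℕ) (x : ExtAA k (symAb i ⊠ symAb j))
    (hx : ∀ a b, a + b = k + 1 → symTor i j k a b x = 0)
    (N : AddSubgroup (ExtAA k (symAb i ⊠ symAb j)))
    (hN : ∀ a b (h : a + b = k) z, symCross i j h z ∈ N) : x ∈ N :=
  kunneth_exact (X := symComplex i) (Y := symComplex j) (symBox i j k) x hx
    (AddSubgroup.toIntSubmodule N) hN

theorem symCross_natural {i j i' j' : ℕ} (φ : symAb i ⟶ symAb i') (ψ : symAb j ⟶ symAb j')
    {k a b : ℕ} (h : a + b = k) (z : ExtA a (symAb i) ⊗[ℤ] ExtA b (symAb j)) :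
    extAAMap k (boxMap φ ψ) (symCross i j h z) =
      symCross i' j' h (TensorProduct.map (extAMap a φ) (extAMap b ψ) z) :=
  kunnethCross_natural (X := symComplex i) (Y := symComplex j) (X' := symComplex i')
    (Y' := symComplex j') (symBox i j k) (symBox i' j' k) (homComplexMap barComplex φ)
    (homComplexMap barComplex ψ) (extAAMap k (boxMap φ ψ)).toIntLinearMap
    (boxPresentation_natural φ ψ k) h (extAMap a φ) (extAMap b ψ)
    (extPresentation_natural barResolution φ a) (extPresentation_natural barResolution ψ b) z

theorem symTor_natural {i j i' j' : ℕ} (φ : symAb i ⟶ symAb i') (ψ : symAb j ⟶ symAb j')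
    (k a b : ℕ) (x : ExtAA k (symAb i ⊠ symAb j)) :
    symTor i' j' k a b (extAAMap k (boxMap φ ψ) x) =
      TensorProduct.map (extAMap a φ) (cobdMap (homComplexMap barComplex ψ) b)
        (symTor i j k a b x) :=
  kunnethTor_natural (X := symComplex i) (Y := symComplex j) (X' := symComplex i')
    (Y' := symComplex j') (symBox i j k) (symBox i' j' k) (homComplexMap barComplex φ)
    (homComplexMap barComplex ψ) (extAAMap k (boxMap φ ψ)).toIntLinearMap
    (boxPresentation_natural φ ψ k) a b (extAMap a φ)
    (extPresentation_natural barResolution φ a) x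

/-- The morphism of presentations induced by a morphism of coefficient functors. -/
def presentationComplexMap {j j' : ℕ} (ψ : symAb j ⟶ symAb j') (b : ℕ) :
    presentationComplex (symComplex j) b ⟶ presentationComplex (symComplex j') b where
  τ₁ := ModuleCat.ofHom (cobdMap (homComplexMap barComplex ψ) b)
  τ₂ := ModuleCat.ofHom (cocycMap (homComplexMap barComplex ψ) b)
  τ₃ := ModuleCat.ofHom (extAMap b ψ)
  comm₁₂ := rfl
  comm₂₃ := ModuleCat.hom_ext (extPresentation_natural barResolution ψ b).symm

theorem symTorIncl_natural {i j i' j' : ℕ} (φ : symAb i ⟶ symAb i') (ψ : symAb j ⟶ symAb j')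
    (a b : ℕ) (x : Tor1 (ExtA a (symAb i)) (ExtA b (symAb j))) :
    symTorIncl i' j' a b (tor1Map (extAMap a φ) (extAMap b ψ) x) =
      TensorProduct.map (extAMap a φ) (cobdMap (homComplexMap barComplex ψ) b)
        (symTorIncl i j a b x) :=
  torIncl_natural (extAMap a φ) (presentationComplex_shortExact (symComplex j) b)
    (symComplex_projective_cobd j b) (symComplex_projective_cocyc j b)
    (presentationComplex_shortExact (symComplex j') b)
    (symComplex_projective_cobd j' b) (symComplex_projective_cocyc j' b)
    (presentationComplexMap ψ b) x

/-- The components of the second map of the Künneth sequence. -/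
def symTau (i j k a b : ℕ) : ExtAA k (symAb i ⊠ symAb j) →+
    Tor1 (ExtA a (symAb i)) (ExtA b (symAb j)) :=
  factorInjective (symTorIncl i j a b).toAddMonoidHom (symTorIncl_injective i j a b)
    (symTor i j k a b).toAddMonoidHom (exists_symTorIncl_eq i j k a b)

theorem symTorIncl_tau (i j k a b : ℕ) (x : ExtAA k (symAb i ⊠ symAb j)) :
    symTorIncl i j a b (symTau i j k a b x) = symTor i j k a b x :=
  factorInjective_spec (symTorIncl i j a b).toAddMonoidHom (symTorIncl_injective i j a b)
    (symTor i j k a b).toAddMonoidHom (exists_symTorIncl_eq i j k a b) x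

theorem symTau_eq_zero_iff (i j k a b : ℕ) (x : ExtAA k (symAb i ⊠ symAb j)) :
    symTau i j k a b x = 0 ↔ symTor i j k a b x = 0 := by
  rw [← symTorIncl_tau, map_eq_zero_iff _ (symTorIncl_injective i j a b)]

/-- The embedding of `Tor_1` is injective and natural, so the claim follows from naturality of the
connecting map. -/
theorem symTau_natural {i j i' j' : ℕ} (φ : symAb i ⟶ symAb i') (ψ : symAb j ⟶ symAb j')
    (k a b : ℕ) (x : ExtAA k (symAb i ⊠ symAb j)) :
    tor1Map (extAMap a φ) (extAMap b ψ) (symTau i j k a b x) =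
      symTau i' j' k a b (extAAMap k (boxMap φ ψ) x) := by
  apply symTorIncl_injective
  rw [symTorIncl_natural, symTorIncl_tau, symTorIncl_tau, symTor_natural]

/-- The first map of the Künneth sequence. -/
def kunnethκ (k i j : ℕ) :
    TensorSum k (symAb i) (symAb j) →+ ExtAA k (symAb i ⊠ symAb j) :=
  DirectSum.toAddMonoid fun p => (symCross i j p.2).toAddMonoidHom

/-- The second map of the Künneth sequence. -/
def kunnethτ (k i j : ℕ) :
    ExtAA k (symAb i ⊠ symAb j) →+ TorSum (k + 1) (symAb i) (symAb j) :=
  toDirectSum fun p => symTau i j k p.1.1 p.1.2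

theorem kunnethκ_injective (k i j : ℕ) : Function.Injective (kunnethκ k i j) :=
  toAddMonoid_injective (fun p : {p : ℕ × ℕ // p.1 + p.2 = k} =>
    (symCross i j p.2).toAddMonoidHom) fun p =>
      ⟨(symRetract i j k p.1.1 p.1.2).toAddMonoidHom, symRetract_cross_same i j p.2,
        fun q e => symRetract_cross_ne i j q.2 fun h => e (Subtype.ext (Prod.ext h.1 h.2))⟩

theorem kunneth_sequence_exact (k i j : ℕ) :
    Function.Exact (kunnethκ k i j) (kunnethτ k i j) := by
  refine toAddMonoid_exact (fun p : {p : ℕ × ℕ // p.1 + p.2 = k} =>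
    (symCross i j p.2).toAddMonoidHom)
    (fun p : {p : ℕ × ℕ // p.1 + p.2 = k + 1} => symTau i j k p.1.1 p.1.2) ?_ ?_
  · intro p q z
    exact (symTau_eq_zero_iff i j k _ _ _).2 (symTor_cross i j p.2 q.2 z)
  · intro x hx N hN
    refine symCross_exact i j k x (forall_of_subtype (fun a b => symTor i j k a b x = 0) ?_) N
      fun a b h => forall_of_subtype (fun a b => ∀ (h : a + b = k) z, symCross i j h z ∈ N) ?_
        a b h h
    · intro p
      exact (symTau_eq_zero_iff i j k _ _ x).1 (hx p)
    · intro p _ z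
      exact hN p z

theorem kunnethτ_surjective (k i j : ℕ) : Function.Surjective (kunnethτ k i j) := by
  refine toDirectSum_surjective
    (fun p : {p : ℕ × ℕ // p.1 + p.2 = k + 1} => symTau i j k p.1.1 p.1.2) fun q z => ?_
  obtain ⟨x, hx, hx'⟩ := symTor_surjective i j q.2 z
  refine ⟨x, symTorIncl_injective i j _ _ ((symTorIncl_tau i j k _ _ x).trans hx), ?_⟩
  exact fun q' e => (symTau_eq_zero_iff i j k _ _ _).2
    (hx' _ _ q'.2 fun h => e (Subtype.ext (Prod.ext h.1 h.2)))

theorem kunnethκ_natural (k : ℕ) {i j i' j' : ℕ} (φ : symAb i ⟶ symAb i')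
    (ψ : symAb j ⟶ symAb j') : (extAAMap k (boxMap φ ψ)).comp (kunnethκ k i j) =
      (kunnethκ k i' j').comp (tensorSumMap k φ ψ) := by
  refine toAddMonoid_natural (fun p : {p : ℕ × ℕ // p.1 + p.2 = k} =>
    (symCross i j p.2).toAddMonoidHom) (fun p => (symCross i' j' p.2).toAddMonoidHom)
    (fun p => (TensorProduct.map (extAMap p.1.1 φ) (extAMap p.1.2 ψ)).toAddMonoidHom)
    (extAAMap k (boxMap φ ψ)) ?_
  intro p z
  exact symCross_natural φ ψ p.2 z

theorem kunnethτ_natural (k : ℕ) {i j i' j' : ℕ} (φ : symAb i ⟶ symAb i')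
    (ψ : symAb j ⟶ symAb j') : (torSumMap (k + 1) φ ψ).comp (kunnethτ k i j) =
      (kunnethτ k i' j').comp (extAAMap k (boxMap φ ψ)) := by
  refine toDirectSum_natural
    (fun p : {p : ℕ × ℕ // p.1 + p.2 = k + 1} => symTau i j k p.1.1 p.1.2)
    (fun p => symTau i' j' k p.1.1 p.1.2)
    (fun p => (tor1Map (extAMap p.1.1 φ) (extAMap p.1.2 ψ)).toAddMonoidHom)
    (extAAMap k (boxMap φ ψ)) ?_
  intro p x
  rw [LinearMap.toAddMonoidHom_coe]
  exact symTau_natural φ ψ k p.1.1 p.1.2 x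

end FreeGroupFunctors

end

open FreeGroupFunctors in
theorem proposition202508211555 (k : ℕ) :
    ∃ (κ : ∀ i₁ i₂ : ℕ, TensorSum k (symAb i₁) (symAb i₂) →+
          ExtAA k (symAb i₁ ⊠ symAb i₂))
      (τ : ∀ i₁ i₂ : ℕ, ExtAA k (symAb i₁ ⊠ symAb i₂) →+
          TorSum (k + 1) (symAb i₁) (symAb i₂)),
      (∀ i₁ i₂ : ℕ, Function.Injective (κ i₁ i₂) ∧ Function.Exact (κ i₁ i₂) (τ i₁ i₂) ∧
        Function.Surjective (τ i₁ i₂)) ∧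
      (∀ (i₁ i₂ j₁ j₂ : ℕ) (φ : symAb i₁ ⟶ symAb j₁) (ψ : symAb i₂ ⟶ symAb j₂),
        (extAAMap k (boxMap φ ψ)).comp (κ i₁ i₂) = (κ j₁ j₂).comp (tensorSumMap k φ ψ) ∧
        (torSumMap (k + 1) φ ψ).comp (τ i₁ i₂) = (τ j₁ j₂).comp (extAAMap k (boxMap φ ψ))) :=
  ⟨kunnethκ k, kunnethτ k, fun i₁ i₂ => ⟨kunnethκ_injective k i₁ i₂,
    kunneth_sequence_exact k i₁ i₂, kunnethτ_surjective k i₁ i₂⟩, fun _ _ _ _ φ ψ =>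
    ⟨kunnethκ_natural k φ ψ, kunnethτ_natural k φ ψ⟩⟩
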